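/- Let $\mathbb F=\mathbb R$ or $\mathbb H$ and endow the space $\mathbb F^{n\times n}$ of matrices with the real inner product $\langle X,Y\rangle=\operatorname{Re}\operatorname{tr}(\overline X^{T}Y)$. Let $(G,M)$ be one of the pairs $(Sp(1,1),Sp_1)$ (with $\mathbb F=\mathbb H$, $n=1$) and $(O_o(3,3),SO_3)$ (with $\mathbb F=\mathbb R$, $n=3$), where $Sp(1,1)$ is the group of matrices in $\mathbb H^{2\times 2}$ preserving the form $\overline x^{T}\xi-\overline y^{T}\eta$ and $O_o(3,3)$ is the identity component of the group $O(3,3)$ of matrices in $\mathbb R^{6\times 6}$ preserving the corresponding real form. Give $M\subset\mathbb F^{n\times n}$ the induced Riemannian metric, with volume measure $\mu$, and let $G$ act on $M$ by the Möbius action $$\begin{pmatrix}A&B\\C&D\end{pmatrix}* U=(AU+B)(CU+D)^{-1}.$$ The kinetic energy metric on $G$ is the Riemannian metric $$\langle X,Y\rangle_g=\int_M\langle \widetilde X(q),\widetilde Y(q)\rangle\,d\mu(q),\qquad X,Y\in T_gG,$$ where $\widetilde X(q)=\frac{d}{dt}\big|_0\,\gamma(t)* q$ for any smooth curve $\gamma$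 in $G$ with $\gamma(0)=g$, $\gamma'(0)=X$. Regard $M\times M$ as the subgroup of the block diagonal matrices $\operatorname{diag}(A,D)$, $A,D\in M$, of $G$, with the induced Riemannian metric. Geodesics are the smooth curves, defined on open intervals, that are critical points of the energy $\frac12\int_a^b|\gamma'|^2\,dt$ under variations with fixed end points on each compact subinterval $[a,b]$. Then: (a) $Sp_1\times Sp_1$ is totally geodesic in $Sp(1,1)$, that is, each geodesic of $Sp_1\times Sp_1$ is a geodesic of $Sp(1,1)$. (b) A geodesic $\gamma=\operatorname{diag}(\gamma_1,\gamma_2)$ of $SO_3\times SO_3$ is a geodesic of $O_o(3,3)$ if and only if it stays in one of the factors, that is, in $SO_3\times\{D\}$ for some $D\in SO_3$ or in $\{A\}\times SO_3$ for some $A\in SO_3$ (if $\gamma$ passes through the identity, this means in $SO_3\times\{I_3\}$ or in $\{I_3\}\times SO_3$). -/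

import Mathlib

open MeasureTheory Matrix
open scoped ContDiff

/-! Matrices over `ℝ` or over the quaternions carry the Frobenius norm, that is, the Euclidean norm
of the real inner product `Re (tr (X̄ᵀ Y))`, and the corresponding Borel sets. -/

attribute [local instance] Matrix.frobeniusNormedAddCommGroup Matrix.frobeniusNormedSpace

instance Mobius.measurableSpaceMatrix {m n 𝔽 : Type*} [TopologicalSpace 𝔽] :
    MeasurableSpace (Matrix m n 𝔽) := borel _

instance Mobius.borelSpaceMatrix {m n 𝔽 : Type*} [TopologicalSpace 𝔽] :
    BorelSpace (Matrix m n 𝔽) := ⟨rfl⟩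

/-- The topology of the Frobenius norm is the usual one. -/
instance Mobius.borelSpaceFrobenius {m n 𝔽 : Type*} [Fintype m] [Fintype n]
    [NormedAddCommGroup 𝔽] :
    @BorelSpace (Matrix m n 𝔽) PseudoMetricSpace.toUniformSpace.toTopologicalSpace
      Mobius.measurableSpaceMatrix := ⟨rfl⟩

noncomputable section

/-! ### Geodesics as critical points of the energy

`E` is the ambient vector space, `S ⊆ E` a submanifold, and `B g X Y` is the inner product of the
tangent vectors `X`, `Y` of `S` at `g ∈ S`. A submanifold of `S` with the induced metric is described
by the smaller set and the same `B`. -/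

namespace Mobius

section Geodesics

variable {E : Type*} [NormedAddCommGroup E] [NormedSpace ℝ E]

/-- The energy `½ ∫ₐᵇ |γ'|² dt` of the curve `γ` on `[a, b]`. -/
def energy (B : E → E → E → ℝ) (a b : ℝ) (γ : ℝ → E) : ℝ :=
  (1 / 2) * ∫ t in a..b, B (γ t) (deriv γ t) (deriv γ t)

/-- `Γ s t`, for `|s| < ε` and `t ∈ J`, is a smooth variation of `γ` through curves in `S` which
coincide with `γ` at `a` and at `b`. -/
structure IsProperVariation (S : Set E) (J : Set ℝ) (γ : ℝ → E) (a b ε : ℝ) (Γ : ℝ → ℝ → E) :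
    Prop where
  smooth : ContDiffOn ℝ ∞ (fun p : ℝ × ℝ => Γ p.1 p.2) (Set.Ioo (-ε) ε ×ˢ J)
  mem : ∀ s ∈ Set.Ioo (-ε) ε, ∀ t ∈ J, Γ s t ∈ S
  zero : ∀ t ∈ J, Γ 0 t = γ t
  left : ∀ s ∈ Set.Ioo (-ε) ε, Γ s a = γ a
  right : ∀ s ∈ Set.Ioo (-ε) ε, Γ s b = γ b

/-- `γ`, defined on the open interval `J`, is a geodesic of `S` with the Riemannian metric `B`: it is
smooth, lies in `S`, and on each compact subinterval `[a, b]` it is a critical point of the energy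
among the curves in `S` with the same end points. -/
def IsGeodesic (B : E → E → E → ℝ) (S : Set E) (J : Set ℝ) (γ : ℝ → E) : Prop :=
  ContDiffOn ℝ ∞ γ J ∧ (∀ t ∈ J, γ t ∈ S) ∧
    ∀ a b ε : ℝ, a < b → Set.Icc a b ⊆ J → 0 < ε → ∀ Γ : ℝ → ℝ → E,
      IsProperVariation S J γ a b ε Γ → HasDerivAt (fun s => energy B a b (Γ s)) 0 0

/-- `N` is totally geodesic in `S`: every geodesic of `N` with the induced metric, defined on any
open interval, is a geodesic of `S`. -/
def IsTotallyGeodesic (B : E → E → E → ℝ) (N S : Set E) : Prop :=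
  N ⊆ S ∧ ∀ J : Set ℝ, IsOpen J → J.OrdConnected → ∀ γ : ℝ → E,
    IsGeodesic B N J γ → IsGeodesic B S J γ

end Geodesics

/-! ### The Möbius action and its kinetic energy metric -/

section Action

variable {n : Type*} [Fintype n] [DecidableEq n]
variable {𝔽 : Type*} [NormedDivisionRing 𝔽]

/-- The Möbius action `[A B; C D] ∗ U = (A U + B) (C U + D)⁻¹`. -/
def mobius (T : Matrix (n ⊕ n) (n ⊕ n) 𝔽) (U : Matrix n n 𝔽) : Matrix n n 𝔽 :=
  (T.toBlocks₁₁ * U + T.toBlocks₁₂) * Ring.inverse (T.toBlocks₂₁ * U + T.toBlocks₂₂)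

/-- The block diagonal matrices `diag(A, D)` with `A, D ∈ M`. -/
def blockDiag (M : Set (Matrix n n 𝔽)) : Set (Matrix (n ⊕ n) (n ⊕ n) 𝔽) :=
  {T | ∃ A ∈ M, ∃ D ∈ M, T = fromBlocks A 0 0 D}

/-- The group `U(n, n, 𝔽)` of the matrices that preserve the Hermitian form
`x̄ᵀ ξ - ȳᵀ η` of signature `(n, n)`. -/
def splitUnitary [StarRing 𝔽] (n : Type*) [Fintype n] [DecidableEq n] :
    Set (Matrix (n ⊕ n) (n ⊕ n) 𝔽) :=
  {T | Tᴴ * fromBlocks 1 0 0 (-1) * T = fromBlocks 1 0 0 (-1)}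

variable [InnerProductSpace ℝ 𝔽]

/-- The real inner product `Re (tr (X̄ᵀ Y))`: the sum over all entries of `Re (x̄ y)`. -/
def reInner (X Y : Matrix n n 𝔽) : ℝ := ∑ i, ∑ j, inner ℝ (X i j) (Y i j)

/-- The velocity at time `0` of the point `q` under a motion `t ↦ γ(t) ∗ q` with `γ(0) = g` and
`γ'(0) = X`. -/
def velocityField (g X : Matrix (n ⊕ n) (n ⊕ n) 𝔽) (q : Matrix n n 𝔽) : Matrix n n 𝔽 :=
  fderiv ℝ (fun T => mobius T q) g X

/-- The kinetic energy metric induced by the Möbius action on the `d`-dimensional compact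
submanifold `M` of the space of matrices. The Riemannian volume of `M` is the `d`-dimensional
Euclidean Hausdorff measure. -/
def kineticMetric (M : Set (Matrix n n 𝔽)) (d : ℕ) (g X Y : Matrix (n ⊕ n) (n ⊕ n) 𝔽) : ℝ :=
  ∫ q in M, reInner (velocityField g X q) (velocityField g Y q) ∂μHE[d]

end Action

/-! ### The groups -/

/-- `Sp₁`, the group of `1 × 1` quaternionic unitary matrices. -/
def sp1 : Set (Matrix (Fin 1) (Fin 1) (Quaternion ℝ)) := {U | Uᴴ * U = 1}

/-- `Sp(1,1)`. -/
def sp11 : Set (Matrix (Fin 1 ⊕ Fin 1) (Fin 1 ⊕ Fin 1) (Quaternion ℝ)) := splitUnitary (Fin 1)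

/-- `SO₃`. -/
def so3 : Set (Matrix (Fin 3) (Fin 3) ℝ) := Matrix.specialOrthogonalGroup (Fin 3) ℝ

/-- `Oₒ(3,3)`, the identity component of `O(3,3)`. -/
def oo33 : Set (Matrix (Fin 3 ⊕ Fin 3) (Fin 3 ⊕ Fin 3) ℝ) :=
  connectedComponentIn (splitUnitary (Fin 3)) 1

/-- The kinetic energy metric of `Sp(1,1)` acting on the three-dimensional manifold `Sp₁`. -/
def metricSp11 :
    Matrix (Fin 1 ⊕ Fin 1) (Fin 1 ⊕ Fin 1) (Quaternion ℝ) →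
      Matrix (Fin 1 ⊕ Fin 1) (Fin 1 ⊕ Fin 1) (Quaternion ℝ) →
        Matrix (Fin 1 ⊕ Fin 1) (Fin 1 ⊕ Fin 1) (Quaternion ℝ) → ℝ :=
  kineticMetric sp1 3

/-- The kinetic energy metric of `Oₒ(3,3)` acting on the three-dimensional manifold `SO₃`. -/
def metricOo33 :
    Matrix (Fin 3 ⊕ Fin 3) (Fin 3 ⊕ Fin 3) ℝ →
      Matrix (Fin 3 ⊕ Fin 3) (Fin 3 ⊕ Fin 3) ℝ →
        Matrix (Fin 3 ⊕ Fin 3) (Fin 3 ⊕ Fin 3) ℝ → ℝ :=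
  kineticMetric so3 3

end Mobius

end

noncomputable section

namespace Mobius

set_option linter.unusedSectionVars false

/-! ### Differentiation of a double integral of a squared velocity -/

section Parametric

/-! The energy of a curve in `G` is half the integral, over time and over `q ∈ M`, of the squared
speed of `t ↦ γ(t) ∗ q`. Its first variation is therefore ∫∫ ⟨∂ₜ(γ ∗ q), ∂ₜ w(q)⟩, where w(q) is the
velocity of `q` produced by the variation field W; it is linear in W (`hasDerivAt_energy`). Along γ
= diag(A, D) the field W splits into a diagonal part, tangent to M × M, and an off-diagonal part.
The diagonal part contributes nothing when γ is a geodesic of M × M, so γ is a geodesic of G as soon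
as the off-diagonal part contributes nothing either (`isGeodesic_of_blockDiag`).

For Sp₁ symmetry decides: γ ∗ q = A q Dᴴ is odd in `q`, the off-diagonal velocity is even, and `q ↦
-q` is an isometry preserving Sp₁. The off-diagonal integral equals its own negative
(`totallyGeodesic_sp1`).

SO₃ is not invariant under `q ↦ -q`, and a cubic term survives. Put u = A q Dᵀ, a = A'Aᵀ, d = D'Dᵀ.
An off-diagonal direction β moves u with velocity β - uβᵀu, while u' = au - ud. Terms linear in u
have mean zero, and what remains is -2 ∫ tr(d uᵀ a u βᵀ u) (`firstVariation_so3_offDiagonal`). If a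
or d is zero this vanishes, which gives one implication.

Conversely, geodesics of SO₃ × SO₃ have constant a and d (`deriv_angularVelocity_eq_zero`). Write a
and d as the cross products with x and y, and test with β = f(t) x yᵀ. The trace becomes f (|x|²|y|²
- (x·uy)²), and (x·uy)² has mean |x|²|y|²/3, so the first variation at time t is -(4/3) vol(SO₃)
|x|²|y|² f(t). For a geodesic of O₀(3,3) this forces x = 0 or y = 0, so one factor stands still. -/

theorem hasDerivAt_intervalIntegral_setIntegral {X : Type*} [TopologicalSpace X] [T2Space X]
    [TopologicalSpace.PseudoMetrizableSpace X] [SecondCountableTopology X] [MeasurableSpace X]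
    [BorelSpace X] {μ : Measure X} {M : Set X} (hM : IsCompact M) (hμ : μ M < ⊤)
    {a b r : ℝ} (hab : a ≤ b) (hr : 0 < r) {H H' : ℝ × ℝ × X → ℝ}
    (hH : ContinuousOn H (Set.Icc (-r) r ×ˢ Set.Icc a b ×ˢ M))
    (hH' : ContinuousOn H' (Set.Icc (-r) r ×ˢ Set.Icc a b ×ˢ M))
    (hd : ∀ s ∈ Set.Icc (-r) r, ∀ t ∈ Set.Icc a b, ∀ q ∈ M,
      HasDerivAt (fun s => H (s, t, q)) (H' (s, t, q)) s) :
    HasDerivAt (fun s => ∫ t in a..b, ∫ q in M, H (s, t, q) ∂μ)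
      (∫ t in a..b, ∫ q in M, H' (0, t, q) ∂μ) 0 := by
  have : IsFiniteMeasure (μ.restrict M) := ⟨by simpa using hμ⟩
  set ν : Measure (ℝ × X) := (volume.restrict (Set.Icc a b)).prod (μ.restrict M) with hν
  have hMm : MeasurableSet M := hM.measurableSet
  have hK : IsCompact (Set.Icc a b ×ˢ M) := isCompact_Icc.prod hM
  have hKm : MeasurableSet (Set.Icc a b ×ˢ M) := measurableSet_Icc.prod hMm
  -- The product measure already lives on the compact box, so functions continuous on the box are
  -- integrable and bounds are needed only there.
  have hνK : ν = ν.restrict (Set.Icc a b ×ˢ M) := by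
    rw [hν, ← Measure.prod_restrict, Measure.restrict_restrict measurableSet_Icc, Set.inter_self,
      Measure.restrict_restrict hMm, Set.inter_self]
  have hsl : ∀ s ∈ Set.Icc (-r) r, ∀ F : ℝ × ℝ × X → ℝ,
      ContinuousOn F (Set.Icc (-r) r ×ˢ Set.Icc a b ×ˢ M) →
        Integrable (fun p : ℝ × X => F (s, p)) ν := by
    intro s hs F hF
    rw [hνK]
    exact ContinuousOn.integrableOn_compact hK
      (hF.comp (by fun_prop) (fun p hp => Set.mk_mem_prod hs hp))
  have hconv : ∀ s ∈ Set.Icc (-r) r, ∀ F : ℝ × ℝ × X → ℝ,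
      ContinuousOn F (Set.Icc (-r) r ×ˢ Set.Icc a b ×ˢ M) →
        ∫ t in a..b, ∫ q in M, F (s, t, q) ∂μ = ∫ p, F (s, p) ∂ν := by
    intro s hs F hF
    rw [intervalIntegral.integral_of_le hab, ← integral_Icc_eq_integral_Ioc,
      hν, integral_prod _ (hsl s hs F hF)]
  have hnhds : Set.Icc (-r) r ∈ nhds (0 : ℝ) := Icc_mem_nhds (by linarith) hr
  have h0 : (0 : ℝ) ∈ Set.Icc (-r) r := mem_of_mem_nhds hnhds
  obtain ⟨C, hC⟩ := (isCompact_Icc.prod hK).exists_bound_of_continuousOn hH'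
  have hae : ∀ᵐ p ∂ν, p ∈ Set.Icc a b ×ˢ M := by
    rw [hνK]
    exact ae_restrict_mem hKm
  have key := hasDerivAt_integral_of_dominated_loc_of_deriv_le (𝕜 := ℝ) (μ := ν)
    (F := fun s p => H (s, p)) (F' := fun s p => H' (s, p)) (bound := fun _ => C) hnhds
    (Filter.eventually_of_mem hnhds fun s hs => (hsl s hs H hH).aestronglyMeasurable)
    (hsl 0 h0 H hH) (hsl 0 h0 H' hH').aestronglyMeasurable
    (hae.mono fun p hp s hs => hC (s, p) (Set.mk_mem_prod hs hp))
    (integrable_const C)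
    (hae.mono fun p hp s hs => hd s hs p.1 hp.1 p.2 hp.2)
  rw [hconv 0 h0 H' hH']
  exact key.2.congr_of_eventuallyEq
    (Filter.eventually_of_mem hnhds fun s hs => hconv s hs H hH)

variable {X : Type*} [NormedAddCommGroup X] [NormedSpace ℝ X]
variable {F : Type*} [NormedAddCommGroup F] [NormedSpace ℝ F]

theorem fderiv_fderiv_apply_comm {c : X → F} {p : X} (hc : ContDiffAt ℝ ∞ c p) (v w : X) :
    fderiv ℝ (fun x => fderiv ℝ c x v) p w = fderiv ℝ (fun x => fderiv ℝ c x w) p v := by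
  have h2 : DifferentiableAt ℝ (fderiv ℝ c) p :=
    (hc.fderiv_right (m := 1) (by norm_cast)).differentiableAt (by norm_num)
  have hs := hc.isSymmSndFDerivAt (by rw [minSmoothness_of_isRCLikeNormedField]; norm_cast)
  have e : ∀ v w : X, fderiv ℝ (fun x => fderiv ℝ c x v) p w = fderiv ℝ (fderiv ℝ c) p w v := by
    intro v w
    rw [fderiv_clm_apply h2 (differentiableAt_const v)]
    simp
  rw [e, e]
  exact hs w v

theorem hasDerivAt_slice_fst {Y : Type*} [NormedAddCommGroup Y] [NormedSpace ℝ Y]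
    {c : ℝ × Y → F} {s : ℝ} {y : Y} (hc : DifferentiableAt ℝ c (s, y)) :
    HasDerivAt (fun s => c (s, y)) (fderiv ℝ c (s, y) (1, 0)) s :=
  hc.hasFDerivAt.comp_hasDerivAt s ((hasDerivAt_id s).prodMk (hasDerivAt_const s y))

theorem hasDerivAt_slice_snd {Y : Type*} [NormedAddCommGroup Y] [NormedSpace ℝ Y]
    {c : ℝ × ℝ × Y → F} {s t : ℝ} {y : Y} (hc : DifferentiableAt ℝ c (s, t, y)) :
    HasDerivAt (fun t => c (s, t, y)) (fderiv ℝ c (s, t, y) (0, 1, 0)) t :=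
  hc.hasFDerivAt.comp_hasDerivAt t
    ((hasDerivAt_const t s).prodMk ((hasDerivAt_id t).prodMk (hasDerivAt_const t y)))

theorem hasDerivAt_half_sq {β : F →L[ℝ] F →L[ℝ] ℝ} (hβ : ∀ x y, β x y = β y x) {u : ℝ → F} {u' : F}
    {s : ℝ} (hu : HasDerivAt u u' s) :
    HasDerivAt (fun s => (1 / 2) * β (u s) (u s)) (β (u s) u') s := by
  have h := ((β.isBoundedBilinearMap.hasFDerivAt (u s, u s)).comp_hasDerivAt s
    (hu.prodMk hu)).const_mul (1 / 2 : ℝ)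
  refine h.congr_deriv ?_
  rw [β.isBoundedBilinearMap.deriv_apply]
  simp only [hβ u' (u s)]
  ring

set_option maxHeartbeats 400000 in
/-- First variation of `½ ∫ ∫ |∂ₜ c|²` in terms of `∂ₜ ∂ₛ c`. -/
theorem hasDerivAt_half_integral_sq_velocity [SecondCountableTopology X] [MeasurableSpace X]
    [BorelSpace X] {μ : Measure X} {M : Set X} (hM : IsCompact M) (hμ : μ M < ⊤)
    (β : F →L[ℝ] F →L[ℝ] ℝ) (hβ : ∀ x y, β x y = β y x)
    {Ω : Set (ℝ × ℝ × X)} (hΩ : IsOpen Ω) {c : ℝ × ℝ × X → F} (hc : ContDiffOn ℝ ∞ c Ω)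
    {a b ε : ℝ} (hab : a ≤ b) (hε : 0 < ε)
    (hsub : Set.Ioo (-ε) ε ×ˢ Set.Icc a b ×ˢ M ⊆ Ω) :
    HasDerivAt (fun s => (1 / 2) * ∫ t in a..b, ∫ q in M,
        β (deriv (fun τ => c (s, τ, q)) t) (deriv (fun τ => c (s, τ, q)) t) ∂μ)
      (∫ t in a..b, ∫ q in M, β (deriv (fun τ => c (0, τ, q)) t)
        (deriv (fun τ => deriv (fun s => c (s, τ, q)) 0) t) ∂μ) 0 := by
  have hMm : MeasurableSet M := hM.measurableSet
  have hcd : ∀ p ∈ Ω, ContDiffAt ℝ ∞ c p := fun p hp => hc.contDiffAt (hΩ.mem_nhds hp)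
  set ct : ℝ × ℝ × X → F := fun p => fderiv ℝ c p (0, 1, 0) with hct
  have hctd : ContDiffOn ℝ ∞ ct Ω :=
    (hc.fderiv_of_isOpen hΩ (by norm_cast)).clm_apply contDiffOn_const
  set ctd : ℝ × ℝ × X → F := fun p => fderiv ℝ ct p (1, 0, 0) with hctdd
  have hctc : ContinuousOn ctd Ω :=
    ((hctd.fderiv_of_isOpen hΩ (m := ∞) (by norm_cast)).clm_apply contDiffOn_const).continuousOn
  have hct_deriv : ∀ s t q, (s, t, q) ∈ Ω → deriv (fun τ => c (s, τ, q)) t = ct (s, t, q) :=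
    fun s t q h => (hasDerivAt_slice_snd ((hcd _ h).differentiableAt (by simp))).deriv
  -- Halving ε replaces the open parameter interval by a compact one inside it, which supplies the
  -- uniform bound for differentiation under the integral.
  have hmem : ∀ s ∈ Set.Icc (-(ε/2)) (ε/2), ∀ t ∈ Set.Icc a b, ∀ q ∈ M, (s, t, q) ∈ Ω := by
    intro s hs t ht q hq
    exact hsub ⟨⟨by linarith [hs.1], by linarith [hs.2]⟩, ht, hq⟩
  have hsub' : Set.Icc (-(ε/2)) (ε/2) ×ˢ Set.Icc a b ×ˢ M ⊆ Ω :=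
    fun p hp => hmem p.1 hp.1 p.2.1 hp.2.1 p.2.2 hp.2.2
  have h0 : (0 : ℝ) ∈ Set.Icc (-(ε/2)) (ε/2) := ⟨by linarith, by linarith⟩
  have key := hasDerivAt_intervalIntegral_setIntegral (μ := μ) hM hμ hab (half_pos hε)
    (H := fun p => (1 / 2) * β (ct p) (ct p)) (H' := fun p => β (ct p) (ctd p))
    (by
      have h1 := hctd.continuousOn.mono hsub'
      fun_prop)
    (by
      have h1 := hctd.continuousOn.mono hsub'
      have h2 := hctc.mono hsub'
      fun_prop)
    (by
      intro s hs t ht q hq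
      have hp := hmem s hs t ht q hq
      have h1 : HasDerivAt (fun s => ct (s, t, q)) (ctd (s, t, q)) s :=
        hasDerivAt_slice_fst ((hctd.contDiffAt (hΩ.mem_nhds hp)).differentiableAt (by simp))
      exact hasDerivAt_half_sq hβ h1)
  have hlim : ∫ t in a..b, ∫ q in M, β (deriv (fun τ => c (0, τ, q)) t)
        (deriv (fun τ => deriv (fun s => c (s, τ, q)) 0) t) ∂μ
      = ∫ t in a..b, ∫ q in M, β (ct (0, t, q)) (ctd (0, t, q)) ∂μ := by
    refine intervalIntegral.integral_congr fun t ht => ?_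
    rw [Set.uIcc_of_le hab] at ht
    refine setIntegral_congr_fun hMm fun q hq => ?_
    have hp := hmem 0 h0 t ht q hq
    rw [hct_deriv 0 t q hp]
    congr 1
    have hev : (fun τ => deriv (fun s => c (s, τ, q)) 0)
        =ᶠ[nhds t] fun τ => fderiv ℝ c (0, τ, q) (1, 0, 0) := by
      have hO : IsOpen {τ : ℝ | ((0 : ℝ), τ, q) ∈ Ω} := hΩ.preimage (by fun_prop)
      filter_upwards [hO.mem_nhds hp] with τ hτ
      exact (hasDerivAt_slice_fst ((hcd _ hτ).differentiableAt (by simp))).deriv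
    rw [hev.deriv_eq]
    -- Differentiating the speed produces ∂ₛ∂ₜ c; exchanging the order leaves an expression that
    -- involves only the initial curve and the variation field ∂ₛ c along it.
    change _ = fderiv ℝ (fun x => fderiv ℝ c x (0, 1, 0)) (0, t, q) (1, 0, 0)
    rw [fderiv_fderiv_apply_comm (hcd _ hp)]
    refine (hasDerivAt_slice_snd (c := fun p => fderiv ℝ c p (1, 0, 0)) ?_).deriv
    exact (((hc.fderiv_of_isOpen hΩ (m := ∞) (by norm_cast)).clm_apply
      contDiffOn_const).contDiffAt (hΩ.mem_nhds hp)).differentiableAt (by simp)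
  rw [hlim]
  refine key.congr_of_eventuallyEq ?_
  filter_upwards [Icc_mem_nhds (show -(ε/2) < 0 by linarith) (half_pos hε)] with s hs
  rw [← intervalIntegral.integral_const_mul]
  refine intervalIntegral.integral_congr fun t ht => ?_
  rw [Set.uIcc_of_le hab] at ht
  rw [← integral_const_mul]
  refine setIntegral_congr_fun hMm fun q hq => ?_
  rw [hct_deriv s t q (hmem s hs t ht q hq)]

end Parametric

/-! ### Kinetic energy of a smooth family of maps -/

section Action

variable {E X F : Type*} [NormedAddCommGroup E] [NormedSpace ℝ E] [NormedAddCommGroup X]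
  [NormedSpace ℝ X] [NormedAddCommGroup F] [NormedSpace ℝ F] {Φ : E → X → F} {D : Set (E × X)}

theorem hasDerivAt_action_comp (hD : IsOpen D)
    (hΦ : ContDiffOn ℝ ∞ (fun p : E × X => Φ p.1 p.2) D) {T : E} {q : X} (h : (T, q) ∈ D)
    {u : ℝ → E} {W : E} {t : ℝ} (hu : HasDerivAt u W t) (hT : u t = T) :
    HasDerivAt (fun τ => Φ (u τ) q) (fderiv ℝ (fun T => Φ T q) T W) t := by
  subst hT
  have h1 : DifferentiableAt ℝ (fun T => Φ T q) (u t) := by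
    have h2 := (hΦ.contDiffAt (hD.mem_nhds h)).differentiableAt (by simp)
    exact h2.comp (f := fun T => (T, q)) (u t) (by fun_prop)
  exact h1.hasFDerivAt.comp_hasDerivAt t hu

set_option maxHeartbeats 1000000 in
/-- First variation of the kinetic energy of a smooth family `Φ` of maps. -/
theorem hasDerivAt_energy_of_action [SecondCountableTopology X] [MeasurableSpace X]
    [BorelSpace X] {μ : Measure X} {M : Set X} (hM : IsCompact M) (hμ : μ M < ⊤)
    (β : F →L[ℝ] F →L[ℝ] ℝ) (hβ : ∀ x y, β x y = β y x) (hD : IsOpen D)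
    (hΦ : ContDiffOn ℝ ∞ (fun p : E × X => Φ p.1 p.2) D)
    {J : Set ℝ} (hJ : IsOpen J) {a b ε : ℝ} (hε : 0 < ε) {Γ : ℝ → ℝ → E}
    (hΓ : ContDiffOn ℝ ∞ (fun p : ℝ × ℝ => Γ p.1 p.2) (Set.Ioo (-ε) ε ×ˢ J))
    (hU : ∀ s ∈ Set.Ioo (-ε) ε, ∀ t ∈ J, ∀ q ∈ M, (Γ s t, q) ∈ D)
    (hab : a ≤ b) (hJab : Set.Icc a b ⊆ J) :
    HasDerivAt (fun s => energy (fun g V W => ∫ q in M, β (fderiv ℝ (fun T => Φ T q) g V)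
        (fderiv ℝ (fun T => Φ T q) g W) ∂μ) a b (Γ s))
      (∫ t in a..b, ∫ q in M, β (deriv (fun τ => Φ (Γ 0 τ) q) t)
        (deriv (fun τ => fderiv ℝ (fun T => Φ T q) (Γ 0 τ) (deriv (fun s => Γ s τ) 0)) t) ∂μ)
      0 := by
  have hMm : MeasurableSet M := hM.measurableSet
  have hO : IsOpen (Set.Ioo (-ε) ε ×ˢ J) := isOpen_Ioo.prod hJ
  have hO'o : IsOpen {p : ℝ × ℝ × X | (p.1, p.2.1) ∈ Set.Ioo (-ε) ε ×ˢ J} :=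
    hO.preimage (by fun_prop)
  have hG : ContDiffOn ℝ ∞ (fun p : ℝ × ℝ × X => (Γ p.1 p.2.1, p.2.2))
      {p : ℝ × ℝ × X | (p.1, p.2.1) ∈ Set.Ioo (-ε) ε ×ˢ J} :=
    (hΓ.comp (f := fun p : ℝ × ℝ × X => (p.1, p.2.1)) (by fun_prop)
      fun p hp => hp).prodMk (by fun_prop)
  -- `Φ` is smooth only on `D`, so the composite motion is studied on the open set of triples (s, t,
  -- q) that are sent into `D`.
  have hΩ := hG.continuousOn.isOpen_inter_preimage hO'o hD
  have hc := hΦ.comp (hG.mono Set.inter_subset_left) fun p hp => hp.2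
  have hΓd : ∀ s ∈ Set.Ioo (-ε) ε, ∀ t ∈ J,
      DifferentiableAt ℝ (fun p : ℝ × ℝ => Γ p.1 p.2) (s, t) := fun s hs t ht =>
    (hΓ.contDiffAt (hO.mem_nhds ⟨hs, ht⟩)).differentiableAt (by simp)
  have h0 : (0 : ℝ) ∈ Set.Ioo (-ε) ε := ⟨by linarith, hε⟩
  have ht_deriv : ∀ s ∈ Set.Ioo (-ε) ε, ∀ t ∈ J, ∀ q ∈ M,
      fderiv ℝ (fun T => Φ T q) (Γ s t) (deriv (Γ s) t) = deriv (fun τ => Φ (Γ s τ) q) t := by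
    intro s hs t ht q hq
    have h1 : DifferentiableAt ℝ (Γ s) t :=
      (hΓd s hs t ht).comp (f := fun t => (s, t)) t (by fun_prop)
    exact (hasDerivAt_action_comp hD hΦ (hU s hs t ht q hq) h1.hasDerivAt rfl).deriv.symm
  have hs_deriv : ∀ t ∈ J, ∀ q ∈ M,
      fderiv ℝ (fun T => Φ T q) (Γ 0 t) (deriv (fun s => Γ s t) 0)
        = deriv (fun s => Φ (Γ s t) q) 0 := by
    intro t ht q hq
    have h1 : DifferentiableAt ℝ (fun s => Γ s t) 0 :=
      (hΓd 0 h0 t ht).comp (f := fun s => (s, t)) 0 (by fun_prop)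
    exact (hasDerivAt_action_comp hD hΦ (hU 0 h0 t ht q hq) h1.hasDerivAt rfl).deriv.symm
  have key := hasDerivAt_half_integral_sq_velocity (μ := μ) hM hμ β hβ hΩ hc hab hε
    (fun p hp => ⟨⟨hp.1, hJab hp.2.1⟩, hU p.1 hp.1 p.2.1 (hJab hp.2.1) p.2.2 hp.2.2⟩)
  refine (key.congr_of_eventuallyEq ?_).congr_deriv ?_
  · filter_upwards [isOpen_Ioo.mem_nhds h0] with s hs
    simp only [energy]
    congr 1
    refine intervalIntegral.integral_congr fun t ht => ?_
    rw [Set.uIcc_of_le hab] at ht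
    refine setIntegral_congr_fun hMm fun q hq => ?_
    simp only [Function.comp]
    rw [ht_deriv s hs t (hJab ht) q hq]
  · refine intervalIntegral.integral_congr fun t ht => ?_
    rw [Set.uIcc_of_le hab] at ht
    refine setIntegral_congr_fun hMm fun q hq => ?_
    simp only [Function.comp]
    congr 1
    refine Filter.EventuallyEq.deriv_eq ?_
    filter_upwards [hJ.mem_nhds (hJab ht)] with τ hτ
    exact (hs_deriv τ hτ q hq).symm

end Action

/-! ### The Frobenius norm on square matrices over a normed division ring -/

section Frobenius

variable {n : Type*} [Fintype n] [DecidableEq n] {𝔽 : Type*} [NormedDivisionRing 𝔽]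

/-- Passing to the matrix of entry norms keeps the Frobenius norm, and the triangle inequality
dominates the product entrywise. This reduces division rings, quaternions included, to real
matrices. -/
theorem frobenius_norm_mul_le (A B : Matrix n n 𝔽) : ‖A * B‖ ≤ ‖A‖ * ‖B‖ := by
  have h1 : ∀ A : Matrix n n 𝔽, ‖A‖ = ‖A.map (fun x => ‖x‖)‖ := fun A =>
    (Matrix.frobenius_norm_map_eq A (fun x => ‖x‖) (by simp)).symm
  rw [h1 A, h1 B]
  refine le_trans ?_ (Matrix.frobenius_norm_mul _ _)
  rw [Matrix.frobenius_norm_def, Matrix.frobenius_norm_def]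
  gcongr with i _ j _
  simp only [Matrix.mul_apply, Matrix.map_apply]
  refine (norm_sum_le _ _).trans ?_
  rw [Real.norm_of_nonneg (by positivity)]
  gcongr
  exact norm_mul_le _ _

/-- Square matrices over a normed division ring with the Frobenius norm form a normed ring. -/
abbrev frobeniusRing : NormedRing (Matrix n n 𝔽) :=
  { Matrix.frobeniusNormedAddCommGroup, Matrix.instRing with
    norm_mul_le := frobenius_norm_mul_le }

attribute [local instance] frobeniusRing
attribute [local instance] Matrix.frobeniusNormedAddCommGroup Matrix.frobeniusNormedSpace

variable [InnerProductSpace ℝ 𝔽]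

/-- Square matrices over a real division algebra with the Frobenius norm form a normed algebra. -/
abbrev frobeniusAlgebra [IsScalarTower ℝ 𝔽 𝔽] [SMulCommClass ℝ 𝔽 𝔽] :
    NormedAlgebra ℝ (Matrix n n 𝔽) :=
  { Algebra.ofModule (R := ℝ) (A := Matrix n n 𝔽) smul_mul_assoc mul_smul_comm with
    norm_smul_le := norm_smul_le }

attribute [local instance] frobeniusAlgebra
attribute [local instance] Matrix.frobeniusNormedAddCommGroup Matrix.frobeniusNormedSpace

theorem completeSpace_matrix [FiniteDimensional ℝ 𝔽] : CompleteSpace (Matrix n n 𝔽) :=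
  FiniteDimensional.complete ℝ _

theorem contDiff_of_linear {E F : Type*} [NormedAddCommGroup E] [NormedSpace ℝ E]
    [FiniteDimensional ℝ E] [NormedAddCommGroup F] [NormedSpace ℝ F] (f : E →ₗ[ℝ] F)
    {k : WithTop ℕ∞} : ContDiff ℝ k f :=
  (LinearMap.toContinuousLinearMap f).contDiff

theorem hasDerivAt_of_linear {E F : Type*} [NormedAddCommGroup E] [NormedSpace ℝ E]
    [FiniteDimensional ℝ E] [NormedAddCommGroup F] [NormedSpace ℝ F] (f : E →ₗ[ℝ] F)
    {u : ℝ → E} {u' : E} {t : ℝ} (hu : HasDerivAt u u' t) :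
    HasDerivAt (fun t => f (u t)) (f u') t :=
  (LinearMap.toContinuousLinearMap f).hasFDerivAt.comp_hasDerivAt t hu

/-- The blocks of a matrix, as linear maps. -/
def blockL (i j : n → n ⊕ n) : Matrix (n ⊕ n) (n ⊕ n) 𝔽 →ₗ[ℝ] Matrix n n 𝔽 where
  toFun T := T.submatrix i j
  map_add' _ _ := rfl
  map_smul' _ _ := rfl

/-- Block matrices, as a linear map of the blocks. -/
def fromBlocksL : (Matrix n n 𝔽 × Matrix n n 𝔽) × Matrix n n 𝔽 × Matrix n n 𝔽 →ₗ[ℝ]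
    Matrix (n ⊕ n) (n ⊕ n) 𝔽 where
  toFun p := fromBlocks p.1.1 p.1.2 p.2.1 p.2.2
  map_add' p q := by simp [fromBlocks_add]
  map_smul' c p := by simp [fromBlocks_smul]

variable [FiniteDimensional ℝ 𝔽]

theorem contDiff_toBlocks₁₁ :
    ContDiff ℝ ∞ (fun T : Matrix (n ⊕ n) (n ⊕ n) 𝔽 => T.toBlocks₁₁) := by
  have h := contDiff_of_linear (k := ∞) (blockL (n := n) (𝔽 := 𝔽) Sum.inl Sum.inl)
  exact h

theorem contDiff_toBlocks₁₂ :
    ContDiff ℝ ∞ (fun T : Matrix (n ⊕ n) (n ⊕ n) 𝔽 => T.toBlocks₁₂) := by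
  have h := contDiff_of_linear (k := ∞) (blockL (n := n) (𝔽 := 𝔽) Sum.inl Sum.inr)
  exact h

theorem contDiff_toBlocks₂₁ :
    ContDiff ℝ ∞ (fun T : Matrix (n ⊕ n) (n ⊕ n) 𝔽 => T.toBlocks₂₁) := by
  have h := contDiff_of_linear (k := ∞) (blockL (n := n) (𝔽 := 𝔽) Sum.inr Sum.inl)
  exact h

theorem contDiff_toBlocks₂₂ :
    ContDiff ℝ ∞ (fun T : Matrix (n ⊕ n) (n ⊕ n) 𝔽 => T.toBlocks₂₂) := by
  have h := contDiff_of_linear (k := ∞) (blockL (n := n) (𝔽 := 𝔽) Sum.inr Sum.inr)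
  exact h

theorem hasDerivAt_toBlocks {u : ℝ → Matrix (n ⊕ n) (n ⊕ n) 𝔽} {u' : Matrix (n ⊕ n) (n ⊕ n) 𝔽}
    {t : ℝ} (hu : HasDerivAt u u' t) :
    HasDerivAt (fun t => (u t).toBlocks₁₁) u'.toBlocks₁₁ t ∧
      HasDerivAt (fun t => (u t).toBlocks₁₂) u'.toBlocks₁₂ t ∧
      HasDerivAt (fun t => (u t).toBlocks₂₁) u'.toBlocks₂₁ t ∧
      HasDerivAt (fun t => (u t).toBlocks₂₂) u'.toBlocks₂₂ t :=
  ⟨hasDerivAt_of_linear (blockL Sum.inl Sum.inl) hu,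
    hasDerivAt_of_linear (blockL Sum.inl Sum.inr) hu,
    hasDerivAt_of_linear (blockL Sum.inr Sum.inl) hu,
    hasDerivAt_of_linear (blockL Sum.inr Sum.inr) hu⟩

theorem _root_.ContDiffOn.fromBlocks {E : Type*} [NormedAddCommGroup E] [NormedSpace ℝ E]
    {s : Set E} {A B C D : E → Matrix n n 𝔽} (hA : ContDiffOn ℝ ∞ A s) (hB : ContDiffOn ℝ ∞ B s)
    (hC : ContDiffOn ℝ ∞ C s) (hD : ContDiffOn ℝ ∞ D s) :
    ContDiffOn ℝ ∞ (fun x => Matrix.fromBlocks (A x) (B x) (C x) (D x)) s :=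
  (contDiff_of_linear (k := ∞) (fromBlocksL (n := n) (𝔽 := 𝔽))).comp_contDiffOn
    ((hA.prodMk hB).prodMk (hC.prodMk hD))

/-- The real inner product of matrices, as a continuous bilinear map. -/
def reInnerL : Matrix n n 𝔽 →L[ℝ] Matrix n n 𝔽 →L[ℝ] ℝ :=
  LinearMap.toContinuousBilinearMap (LinearMap.mk₂ ℝ (reInner (n := n) (𝔽 := 𝔽))
    (fun X Y Z => by simp [reInner, inner_add_left, Finset.sum_add_distrib])
    (fun c X Y => by simp [reInner, inner_smul_left, Finset.mul_sum])
    (fun X Y Z => by simp [reInner, inner_add_right, Finset.sum_add_distrib])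
    (fun c X Y => by simp [reInner, inner_smul_right, Finset.mul_sum]))

theorem reInnerL_apply (X Y : Matrix n n 𝔽) : reInnerL X Y = reInner X Y := rfl

theorem reInner_comm (X Y : Matrix n n 𝔽) : reInner X Y = reInner Y X := by
  simp [reInner, real_inner_comm]

variable [IsScalarTower ℝ 𝔽 𝔽] [SMulCommClass ℝ 𝔽 𝔽]

/-! ### Smoothness of the Möbius action -/

theorem isOpen_isUnit_matrix : IsOpen {U : Matrix n n 𝔽 | IsUnit U} := by
  have := completeSpace_matrix (n := n) (𝔽 := 𝔽)
  exact Units.isOpen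

theorem contDiffOn_ringInverse :
    ContDiffOn ℝ ∞ (Ring.inverse : Matrix n n 𝔽 → Matrix n n 𝔽) {U | IsUnit U} := by
  have := completeSpace_matrix (n := n) (𝔽 := 𝔽)
  rintro _ ⟨u, rfl⟩
  exact (contDiffAt_ringInverse _ _).contDiffWithinAt

theorem isOpen_mobius_domain :
    IsOpen {p : Matrix (n ⊕ n) (n ⊕ n) 𝔽 × Matrix n n 𝔽 |
      IsUnit (p.1.toBlocks₂₁ * p.2 + p.1.toBlocks₂₂)} := by
  have h1 := (contDiff_toBlocks₂₁ (n := n) (𝔽 := 𝔽)).continuous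
  have h2 := (contDiff_toBlocks₂₂ (n := n) (𝔽 := 𝔽)).continuous
  exact isOpen_isUnit_matrix.preimage
    (((h1.comp continuous_fst).mul continuous_snd).add (h2.comp continuous_fst))

theorem contDiffOn_mobius :
    ContDiffOn ℝ ∞ (fun p : Matrix (n ⊕ n) (n ⊕ n) 𝔽 × Matrix n n 𝔽 => mobius p.1 p.2)
      {p | IsUnit (p.1.toBlocks₂₁ * p.2 + p.1.toBlocks₂₂)} := by
  have h11 := (contDiff_toBlocks₁₁ (n := n) (𝔽 := 𝔽)).comp
    (contDiff_fst (F := Matrix n n 𝔽) (𝕜 := ℝ))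
  have h12 := (contDiff_toBlocks₁₂ (n := n) (𝔽 := 𝔽)).comp
    (contDiff_fst (F := Matrix n n 𝔽) (𝕜 := ℝ))
  have h21 := (contDiff_toBlocks₂₁ (n := n) (𝔽 := 𝔽)).comp
    (contDiff_fst (F := Matrix n n 𝔽) (𝕜 := ℝ))
  have h22 := (contDiff_toBlocks₂₂ (n := n) (𝔽 := 𝔽)).comp
    (contDiff_fst (F := Matrix n n 𝔽) (𝕜 := ℝ))
  have hs := contDiff_snd (E := Matrix (n ⊕ n) (n ⊕ n) 𝔽) (F := Matrix n n 𝔽) (𝕜 := ℝ) (n := ∞)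
  exact ((h11.mul hs).add h12).contDiffOn.mul
    (contDiffOn_ringInverse.comp ((h21.mul hs).add h22).contDiffOn fun p hp => hp)

theorem hasDerivAt_mobius_comp {T : Matrix (n ⊕ n) (n ⊕ n) 𝔽} {q : Matrix n n 𝔽}
    (h : IsUnit (T.toBlocks₂₁ * q + T.toBlocks₂₂)) {u : ℝ → Matrix (n ⊕ n) (n ⊕ n) 𝔽}
    {W : Matrix (n ⊕ n) (n ⊕ n) 𝔽} {t : ℝ} (hu : HasDerivAt u W t) (hT : u t = T) :
    HasDerivAt (fun τ => mobius (u τ) q) (velocityField T W q) t := by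
  have h1 : IsOpen {p : Matrix (n ⊕ n) (n ⊕ n) 𝔽 × Matrix n n 𝔽 |
      IsUnit (p.1.toBlocks₂₁ * p.2 + p.1.toBlocks₂₂)} := isOpen_mobius_domain
  exact hasDerivAt_action_comp (Φ := mobius (n := n) (𝔽 := 𝔽)) h1 contDiffOn_mobius (T := T)
    (q := q) h hu hT

/-- The derivative of the energy of a variation with initial curve `γ` and variation field `W` is
the integral of this function. -/
def firstVariation (M : Set (Matrix n n 𝔽)) (d : ℕ) (γ W : ℝ → Matrix (n ⊕ n) (n ⊕ n) 𝔽)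
    (t : ℝ) : ℝ :=
  ∫ q in M, reInner (deriv (fun τ => mobius (γ τ) q) t)
    (deriv (fun τ => velocityField (γ τ) (W τ) q) t) ∂μHE[d]

/-- The metric sees a curve only through the motions of the points of `M`, and the Möbius action is
smooth where the denominator is invertible, so the general first variation applies to it. -/
theorem hasDerivAt_energy {M : Set (Matrix n n 𝔽)} {d : ℕ} (hM : IsCompact M)
    (hfin : μHE[d] M < ⊤) {J : Set ℝ} (hJ : IsOpen J) {a b ε : ℝ} (hε : 0 < ε)
    {Γ : ℝ → ℝ → Matrix (n ⊕ n) (n ⊕ n) 𝔽}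
    (hΓ : ContDiffOn ℝ ∞ (fun p : ℝ × ℝ => Γ p.1 p.2) (Set.Ioo (-ε) ε ×ˢ J))
    (hU : ∀ s ∈ Set.Ioo (-ε) ε, ∀ t ∈ J, ∀ q ∈ M,
      IsUnit ((Γ s t).toBlocks₂₁ * q + (Γ s t).toBlocks₂₂))
    (hab : a ≤ b) (hJab : Set.Icc a b ⊆ J) :
    HasDerivAt (fun s => energy (kineticMetric M d) a b (Γ s))
      (∫ t in a..b, firstVariation M d (Γ 0) (fun τ => deriv (fun s => Γ s τ) 0) t) 0 := by
  have h1 : IsOpen {p : Matrix (n ⊕ n) (n ⊕ n) 𝔽 × Matrix n n 𝔽 |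
      IsUnit (p.1.toBlocks₂₁ * p.2 + p.1.toBlocks₂₂)} := isOpen_mobius_domain
  have key := hasDerivAt_energy_of_action (Φ := mobius (n := n) (𝔽 := 𝔽)) (μ := μHE[d]) hM hfin
    (reInnerL (n := n) (𝔽 := 𝔽)) reInner_comm
    h1 contDiffOn_mobius hJ hε hΓ hU hab hJab
  exact key

end Frobenius

section Unitary

attribute [local instance] frobeniusRing frobeniusAlgebra
attribute [local instance] Matrix.frobeniusNormedAddCommGroup Matrix.frobeniusNormedSpace

variable {n : Type*} [Fintype n] [DecidableEq n] {𝔽 : Type*} [NormedDivisionRing 𝔽]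
  [InnerProductSpace ℝ 𝔽] [FiniteDimensional ℝ 𝔽] [IsScalarTower ℝ 𝔽 𝔽] [SMulCommClass ℝ 𝔽 𝔽]
  [StarRing 𝔽] [StarModule ℝ 𝔽] [ContinuousStar 𝔽]

/-! ### Unitary and pseudo-unitary matrices -/

/-- In finite dimension an injective left multiplication is surjective, which gives a right inverse;
cancellation makes it two-sided. The argument needs no determinant, hence works over the
quaternions. -/
theorem isUnit_of_mul_left_cancel {Q : Matrix n n 𝔽} (h : ∀ X : Matrix n n 𝔽, Q * X = 0 → X = 0) :
    IsUnit Q := by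
  have hinj : Function.Injective (LinearMap.mulLeft ℝ Q) := by
    rw [← LinearMap.ker_eq_bot, LinearMap.ker_eq_bot']
    exact h
  obtain ⟨Y, hY⟩ := LinearMap.injective_iff_surjective.1 hinj 1
  have hY' : Q * Y = 1 := hY
  have hY2 : Y * Q = 1 := by
    rw [← sub_eq_zero]
    apply h
    rw [mul_sub, ← mul_assoc, hY', one_mul, mul_one, sub_self]
  exact ⟨⟨Q, Y, hY', hY2⟩, rfl⟩

theorem mul_conjTranspose_eq_one {A : Matrix n n 𝔽} (h : Aᴴ * A = 1) : A * Aᴴ = 1 := by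
  have hu : IsUnit A := isUnit_of_mul_left_cancel fun X hX => by
    rw [← one_mul X, ← h, mul_assoc, hX, mul_zero]
  obtain ⟨u, rfl⟩ := hu
  rw [← Units.inv_eq_of_mul_eq_one_left h, Units.mul_inv]

theorem ringInverse_eq_conjTranspose {A : Matrix n n 𝔽} (h : Aᴴ * A = 1) :
    Ring.inverse A = Aᴴ := by
  have := Ring.inverse_unit (⟨A, Aᴴ, mul_conjTranspose_eq_one h, h⟩ : (Matrix n n 𝔽)ˣ)
  exact this

theorem mem_splitUnitary_iff {A B C D : Matrix n n 𝔽} :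
    fromBlocks A B C D ∈ splitUnitary n ↔
      Aᴴ * A - Cᴴ * C = 1 ∧ Aᴴ * B - Cᴴ * D = 0 ∧ Bᴴ * A - Dᴴ * C = 0 ∧ Bᴴ * B - Dᴴ * D = -1 := by
  simp only [splitUnitary, Set.mem_ofPred_eq, fromBlocks_conjTranspose, fromBlocks_multiply,
    fromBlocks_inj]
  simp [sub_eq_add_neg]

theorem blockDiag_subset_splitUnitary {M : Set (Matrix n n 𝔽)} (hM : ∀ U ∈ M, Uᴴ * U = 1) :
    blockDiag M ⊆ splitUnitary n := by
  rintro _ ⟨A, hA, D, hD, rfl⟩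
  rw [mem_splitUnitary_iff]
  simp [hM A hA, hM D hD]

/-- This makes the Möbius action well defined on unitary `q`. The column (q, 1) is isotropic and `T`
preserves the form, so Aq + B and Cq + D have the same Gram matrix. By definiteness a kernel vector
of Cq + D is killed by Aq + B too, and then invertibility of `T` makes it zero. -/
theorem isUnit_of_mem_splitUnitary
    (hpos : ∀ P : Matrix n n 𝔽, Pᴴ * P = 0 → P = 0) {T : Matrix (n ⊕ n) (n ⊕ n) 𝔽}
    (hT : T ∈ splitUnitary n) {q : Matrix n n 𝔽} (hq : qᴴ * q = 1) :
    IsUnit (T.toBlocks₂₁ * q + T.toBlocks₂₂) := by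
  rw [← fromBlocks_toBlocks T, mem_splitUnitary_iff] at hT
  set A := T.toBlocks₁₁
  set B := T.toBlocks₁₂
  set C := T.toBlocks₂₁
  set D := T.toBlocks₂₂
  obtain ⟨h1, h2, h3, h4⟩ := hT
  have hPQ : (A * q + B)ᴴ * (A * q + B) = (C * q + D)ᴴ * (C * q + D) := by
    have e : (A * q + B)ᴴ * (A * q + B) - (C * q + D)ᴴ * (C * q + D)
        = qᴴ * (Aᴴ * A - Cᴴ * C) * q + qᴴ * (Aᴴ * B - Cᴴ * D) + (Bᴴ * A - Dᴴ * C) * q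
          + (Bᴴ * B - Dᴴ * D) := by
      simp only [conjTranspose_add, conjTranspose_mul]
      noncomm_ring
    rw [← sub_eq_zero, e, h1, h2, h3, h4]
    simp [hq]
  refine isUnit_of_mul_left_cancel fun X hX => ?_
  have hPX : (A * q + B) * X = 0 := by
    apply hpos
    rw [conjTranspose_mul]
    calc Xᴴ * (A * q + B)ᴴ * ((A * q + B) * X) = Xᴴ * ((A * q + B)ᴴ * (A * q + B)) * X := by
          noncomm_ring
      _ = Xᴴ * (C * q + D)ᴴ * ((C * q + D) * X) := by rw [hPQ]; noncomm_ring
      _ = 0 := by rw [hX, mul_zero]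
  have hqX : q * X = 0 := by
    -- The first block row of the relation for `T` acts as a left inverse: it recovers q X from the
    -- two vanishing blocks.
    have e : Aᴴ * ((A * q + B) * X) - Cᴴ * ((C * q + D) * X)
        = (Aᴴ * A - Cᴴ * C) * q * X + (Aᴴ * B - Cᴴ * D) * X := by noncomm_ring
    rw [hPX, hX, h1, h2] at e
    simpa using e.symm
  rw [← one_mul X, ← hq, mul_assoc, hqX, mul_zero]

theorem conjTranspose_exp_mul_exp {x : Matrix n n 𝔽} (hx : xᴴ = -x) :
    (NormedSpace.exp x)ᴴ * NormedSpace.exp x = 1 := by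
  have := completeSpace_matrix (n := n) (𝔽 := 𝔽)
  let _ : NormedAlgebra ℚ (Matrix n n 𝔽) := NormedAlgebra.restrictScalars ℚ ℝ _
  have h1 : (NormedSpace.exp x)ᴴ = NormedSpace.exp (-x) := by
    rw [← hx]
    exact (Matrix.exp_conjTranspose x).symm
  have h2 := NormedSpace.exp_add_of_commute (Commute.neg_left (Commute.refl x))
  rw [neg_add_cancel, NormedSpace.exp_zero] at h2
  rw [h1]
  exact h2.symm

theorem contDiff_exp_matrix :
    ContDiff ℝ ∞ (NormedSpace.exp : Matrix n n 𝔽 → Matrix n n 𝔽) := by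
  have := completeSpace_matrix (n := n) (𝔽 := 𝔽)
  rw [contDiff_iff_contDiffAt]
  exact fun x => (NormedSpace.exp_analytic (𝕂 := ℝ) x).contDiffAt

theorem hasDerivAt_exp_smul_mul (x A : Matrix n n 𝔽) :
    HasDerivAt (fun s : ℝ => NormedSpace.exp (s • x) * A) (x * A) 0 := by
  have := completeSpace_matrix (n := n) (𝔽 := 𝔽)
  have h := (hasDerivAt_exp_smul_const (𝕂 := ℝ) x (0 : ℝ)).mul_const A
  have h2 : NormedSpace.exp ((0 : ℝ) • x) * x * A = x * A := by
    rw [zero_smul, NormedSpace.exp_zero, one_mul]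
  exact h.congr_deriv h2

/-- Conjugate transposition as a real linear map. -/
def conjTransposeR : Matrix n n 𝔽 →ₗ[ℝ] Matrix n n 𝔽 where
  toFun X := Xᴴ
  map_add' X Y := conjTranspose_add X Y
  map_smul' c X := by
    rw [conjTranspose_smul]
    simp

theorem _root_.ContDiffOn.conjTranspose {E : Type*} [NormedAddCommGroup E] [NormedSpace ℝ E]
    {s : Set E} {A : E → Matrix n n 𝔽} (hA : ContDiffOn ℝ ∞ A s) :
    ContDiffOn ℝ ∞ (fun x => (A x)ᴴ) s :=
  (contDiff_of_linear (k := ∞) (conjTransposeR (n := n) (𝔽 := 𝔽))).comp_contDiffOn hA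

theorem _root_.HasDerivAt.conjTranspose {u : ℝ → Matrix n n 𝔽} {u' : Matrix n n 𝔽} {t : ℝ}
    (hu : HasDerivAt u u' t) : HasDerivAt (fun t => (u t)ᴴ) u'ᴴ t :=
  hasDerivAt_of_linear (conjTransposeR (n := n) (𝔽 := 𝔽)) hu

/-! ### The action of block diagonal matrices -/

theorem mobius_fromBlocks {A D : Matrix n n 𝔽} (hD : Dᴴ * D = 1) (q : Matrix n n 𝔽) :
    mobius (fromBlocks A 0 0 D) q = A * q * Dᴴ := by
  simp [mobius, ringInverse_eq_conjTranspose hD]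

theorem isUnit_of_conjTranspose_mul {D : Matrix n n 𝔽} (hD : Dᴴ * D = 1) : IsUnit D :=
  ⟨⟨D, Dᴴ, mul_conjTranspose_eq_one hD, hD⟩, rfl⟩

/-- Differentiate (T ∗ q)(Cq + D) = Aq + B along the line T + τW and solve for the derivative of T ∗
q; the inverse itself never has to be differentiated explicitly. -/
theorem velocityField_fromBlocks {A D : Matrix n n 𝔽} (hD : Dᴴ * D = 1)
    (W : Matrix (n ⊕ n) (n ⊕ n) 𝔽) (q : Matrix n n 𝔽) :
    velocityField (fromBlocks A 0 0 D) W q =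
      (W.toBlocks₁₁ * q + W.toBlocks₁₂) * Dᴴ
        - A * q * Dᴴ * (W.toBlocks₂₁ * q + W.toBlocks₂₂) * Dᴴ := by
  set T := fromBlocks A 0 0 D with hT
  have hN0 : T.toBlocks₂₁ * q + T.toBlocks₂₂ = D := by simp [hT]
  have hu : IsUnit (T.toBlocks₂₁ * q + T.toBlocks₂₂) := by
    rw [hN0]; exact isUnit_of_conjTranspose_mul hD
  have hcurve : HasDerivAt (fun τ : ℝ => T + τ • W) W 0 := by
    have h := ((hasDerivAt_id (0 : ℝ)).smul_const W).const_add T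
    rw [one_smul] at h
    exact h
  have hg := hasDerivAt_mobius_comp hu hcurve (by simp)
  obtain ⟨h11, h12, h21, h22⟩ := hasDerivAt_toBlocks hcurve
  have hN := (h21.mul_const q).add h22
  have hP := (h11.mul_const q).add h12
  have hprod := hg.mul hN
  have hcont := hN.continuousAt
  have hev : ∀ᶠ τ in nhds (0 : ℝ),
      IsUnit ((T + τ • W).toBlocks₂₁ * q + (T + τ • W).toBlocks₂₂) := by
    refine hcont.eventually (isOpen_isUnit_matrix.mem_nhds ?_)
    simpa using hu
  have heq := (hP.congr_of_eventuallyEq (hev.mono fun τ hτ => ?_)).unique hprod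
  rotate_left
  · simp only [Pi.mul_apply, Pi.add_apply, mobius]
    rw [mul_assoc, Ring.inverse_mul_cancel _ hτ, mul_one]
  · simp only [Pi.add_apply, zero_smul, add_zero] at heq
    rw [hN0, hT, mobius_fromBlocks hD, ← hT] at heq
    have h2 : velocityField T W q * D = W.toBlocks₁₁ * q + W.toBlocks₁₂
        - A * q * Dᴴ * (W.toBlocks₂₁ * q + W.toBlocks₂₂) := by
      rw [heq]; abel
    calc velocityField T W q = velocityField T W q * D * Dᴴ := by
          rw [mul_assoc, mul_conjTranspose_eq_one hD, mul_one]
      _ = _ := by rw [h2, sub_mul]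

end Unitary

/-! ### Time derivatives of smooth functions of time and point -/

section SliceDerivative

variable {X F : Type*} [NormedAddCommGroup X] [NormedSpace ℝ X] [NormedAddCommGroup F]
  [NormedSpace ℝ F] {f : ℝ × X → F} {J : Set ℝ}

theorem differentiableAt_slice (hJ : IsOpen J) (hf : ContDiffOn ℝ ∞ f (J ×ˢ Set.univ)) {t : ℝ}
    (ht : t ∈ J) (q : X) : DifferentiableAt ℝ (fun τ => f (τ, q)) t :=
  (hasDerivAt_slice_fst ((hf.contDiffAt ((hJ.prod isOpen_univ).mem_nhds
    ⟨ht, Set.mem_univ q⟩)).differentiableAt (by simp))).differentiableAt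

theorem continuous_deriv_slice (hJ : IsOpen J) (hf : ContDiffOn ℝ ∞ f (J ×ˢ Set.univ)) {t : ℝ}
    (ht : t ∈ J) : Continuous (fun q => deriv (fun τ => f (τ, q)) t) := by
  have h1 : ∀ q, deriv (fun τ => f (τ, q)) t = fderiv ℝ f (t, q) (1, 0) := fun q =>
    (hasDerivAt_slice_fst ((hf.contDiffAt ((hJ.prod isOpen_univ).mem_nhds
      ⟨ht, Set.mem_univ q⟩)).differentiableAt (by simp))).deriv
  simp_rw [h1]
  have h2 := hf.continuousOn_fderiv_of_isOpen (hJ.prod isOpen_univ) (by simp)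
  have h3 : Continuous (fun q => fderiv ℝ f (t, q)) :=
    h2.comp_continuous (by fun_prop) fun q => ⟨ht, Set.mem_univ q⟩
  exact h3.clm_apply continuous_const

end SliceDerivative

/-! ### The first variation along block diagonal curves -/

section FirstVariation

attribute [local instance] frobeniusRing frobeniusAlgebra
attribute [local instance] Matrix.frobeniusNormedAddCommGroup Matrix.frobeniusNormedSpace

variable {n : Type*} [Fintype n] [DecidableEq n] {𝔽 : Type*} [NormedDivisionRing 𝔽]
  [InnerProductSpace ℝ 𝔽] [FiniteDimensional ℝ 𝔽] [IsScalarTower ℝ 𝔽 𝔽] [SMulCommClass ℝ 𝔽 𝔽]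
  [StarRing 𝔽] [StarModule ℝ 𝔽] [ContinuousStar 𝔽]
  {M : Set (Matrix n n 𝔽)} {d : ℕ} {J : Set ℝ}
  {γ W : ℝ → Matrix (n ⊕ n) (n ⊕ n) 𝔽}

theorem firstVariation_congr (hJ : IsOpen J) {γ' W' : ℝ → Matrix (n ⊕ n) (n ⊕ n) 𝔽}
    (hγ : ∀ t ∈ J, γ t = γ' t) (hW : ∀ t ∈ J, W t = W' t) {t : ℝ} (ht : t ∈ J) :
    firstVariation M d γ W t = firstVariation M d γ' W' t := by
  have h : ∀ᶠ τ in nhds t, τ ∈ J := hJ.mem_nhds ht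
  simp only [firstVariation]
  congr 1
  ext q
  congr 1
  · refine Filter.EventuallyEq.deriv_eq (h.mono fun τ hτ => ?_)
    simp only [hγ τ hτ]
  · refine Filter.EventuallyEq.deriv_eq (h.mono fun τ hτ => ?_)
    simp only [hγ τ hτ, hW τ hτ]

theorem mem_blockDiag_iff {T : Matrix (n ⊕ n) (n ⊕ n) 𝔽} :
    T ∈ blockDiag M ↔ T.toBlocks₁₁ ∈ M ∧ T.toBlocks₂₂ ∈ M ∧
      T = fromBlocks T.toBlocks₁₁ 0 0 T.toBlocks₂₂ := by
  constructor
  · rintro ⟨A, hA, D, hD, rfl⟩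
    simpa using ⟨hA, hD⟩
  · rintro ⟨h1, h2, h3⟩
    exact ⟨_, h1, _, h2, h3⟩

/-- For unitary blocks the denominator is `D`, with inverse Dᴴ, so position and velocity become
polynomial in `q`. The derivatives may be computed from these formulas because `J` is open. -/
theorem firstVariation_of_blockDiag (hM : ∀ U ∈ M, Uᴴ * U = 1) (hJ : IsOpen J)
    (hγ : ∀ t ∈ J, γ t ∈ blockDiag M) {t : ℝ} (ht : t ∈ J) :
    firstVariation M d γ W t = ∫ q in M,
      reInner (deriv (fun τ => (γ τ).toBlocks₁₁ * q * ((γ τ).toBlocks₂₂)ᴴ) t)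
        (deriv (fun τ => ((W τ).toBlocks₁₁ * q + (W τ).toBlocks₁₂) * ((γ τ).toBlocks₂₂)ᴴ
          - (γ τ).toBlocks₁₁ * q * ((γ τ).toBlocks₂₂)ᴴ
            * ((W τ).toBlocks₂₁ * q + (W τ).toBlocks₂₂) * ((γ τ).toBlocks₂₂)ᴴ) t) ∂μHE[d] := by
  have h : ∀ᶠ τ in nhds t, τ ∈ J := hJ.mem_nhds ht
  simp only [firstVariation]
  congr 1
  ext q
  congr 1
  · refine Filter.EventuallyEq.deriv_eq (h.mono fun τ hτ => ?_)
    obtain ⟨-, h2, h3⟩ := mem_blockDiag_iff.1 (hγ τ hτ)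
    have := mobius_fromBlocks (A := (γ τ).toBlocks₁₁) (hM _ h2) q
    rwa [← h3] at this
  · refine Filter.EventuallyEq.deriv_eq (h.mono fun τ hτ => ?_)
    obtain ⟨-, h2, h3⟩ := mem_blockDiag_iff.1 (hγ τ hτ)
    have := velocityField_fromBlocks (A := (γ τ).toBlocks₁₁) (hM _ h2) (W τ) q
    rwa [← h3] at this

theorem contDiffOn_position {A D : ℝ → Matrix n n 𝔽} (hA : ContDiffOn ℝ ∞ A J)
    (hD : ContDiffOn ℝ ∞ D J) :
    ContDiffOn ℝ ∞ (fun p : ℝ × Matrix n n 𝔽 => A p.1 * p.2 * (D p.1)ᴴ) (J ×ˢ Set.univ) := by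
  have h1 := hA.comp (contDiffOn_fst (𝕜 := ℝ) (n := ∞) (F := Matrix n n 𝔽) (s := J ×ˢ Set.univ))
    fun p hp => hp.1
  have h2 := (hD.comp (contDiffOn_fst (𝕜 := ℝ) (n := ∞) (F := Matrix n n 𝔽) (s := J ×ˢ Set.univ))
    fun p hp => hp.1).conjTranspose
  exact (h1.mul contDiffOn_snd).mul h2

theorem contDiffOn_velocity {A D W₁ W₂ W₃ W₄ : ℝ → Matrix n n 𝔽} (hA : ContDiffOn ℝ ∞ A J)
    (hD : ContDiffOn ℝ ∞ D J) (h₁ : ContDiffOn ℝ ∞ W₁ J) (h₂ : ContDiffOn ℝ ∞ W₂ J)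
    (h₃ : ContDiffOn ℝ ∞ W₃ J) (h₄ : ContDiffOn ℝ ∞ W₄ J) :
    ContDiffOn ℝ ∞ (fun p : ℝ × Matrix n n 𝔽 => (W₁ p.1 * p.2 + W₂ p.1) * (D p.1)ᴴ
      - A p.1 * p.2 * (D p.1)ᴴ * (W₃ p.1 * p.2 + W₄ p.1) * (D p.1)ᴴ) (J ×ˢ Set.univ) := by
  have lift : ∀ {B : ℝ → Matrix n n 𝔽}, ContDiffOn ℝ ∞ B J →
      ContDiffOn ℝ ∞ (fun p : ℝ × Matrix n n 𝔽 => B p.1) (J ×ˢ Set.univ) := fun hB =>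
    hB.comp contDiffOn_fst fun p hp => hp.1
  have hq : ContDiffOn ℝ ∞ (fun p : ℝ × Matrix n n 𝔽 => p.2) (J ×ˢ Set.univ) := contDiffOn_snd
  exact ((((lift h₁).mul hq).add (lift h₂)).mul (lift hD).conjTranspose).sub
    ((((((lift hA).mul hq).mul (lift hD).conjTranspose)).mul
      (((lift h₃).mul hq).add (lift h₄))).mul (lift hD).conjTranspose)

theorem integrableOn_reInner_deriv (hMc : IsCompact M) (hfin : μHE[d] M < ⊤) (hJ : IsOpen J)
    {f g : ℝ × Matrix n n 𝔽 → Matrix n n 𝔽} (hf : ContDiffOn ℝ ∞ f (J ×ˢ Set.univ))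
    (hg : ContDiffOn ℝ ∞ g (J ×ˢ Set.univ)) {t : ℝ} (ht : t ∈ J) :
    IntegrableOn (fun q => reInner (deriv (fun τ => f (τ, q)) t) (deriv (fun τ => g (τ, q)) t)) M
      μHE[d] := by
  have hc : Continuous (fun q => reInnerL (deriv (fun τ => f (τ, q)) t)
      (deriv (fun τ => g (τ, q)) t)) :=
    ((reInnerL (n := n) (𝔽 := 𝔽)).continuous.comp (continuous_deriv_slice hJ hf ht)).clm_apply
      (continuous_deriv_slice hJ hg ht)
  have : IsFiniteMeasure ((μHE[d] : Measure (Matrix n n 𝔽)).restrict M) := ⟨by simpa using hfin⟩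
  have h := hc.continuousOn.integrableOn_compact (μ := (μHE[d]).restrict M) hMc
  rwa [IntegrableOn, Measure.restrict_restrict hMc.measurableSet, Set.inter_self] at h

/-- The velocity of a point is linear in W, and each half is integrable, being continuous in `q` on
the compact `M`. The splitting separates directions tangent to M × M from transversal ones. -/
theorem firstVariation_eq_add (hM : ∀ U ∈ M, Uᴴ * U = 1) (hMc : IsCompact M)
    (hfin : μHE[d] M < ⊤) (hJ : IsOpen J) (hγs : ContDiffOn ℝ ∞ γ J)
    (hγ : ∀ t ∈ J, γ t ∈ blockDiag M) (hW : ContDiffOn ℝ ∞ W J) {t : ℝ} (ht : t ∈ J) :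
    firstVariation M d γ W t =
      firstVariation M d γ (fun τ => fromBlocks (W τ).toBlocks₁₁ 0 0 (W τ).toBlocks₂₂) t +
      firstVariation M d γ (fun τ => fromBlocks 0 (W τ).toBlocks₁₂ (W τ).toBlocks₂₁ 0) t := by
  have hA := contDiff_toBlocks₁₁.comp_contDiffOn hγs
  have hD := contDiff_toBlocks₂₂.comp_contDiffOn hγs
  have h1 := contDiff_toBlocks₁₁.comp_contDiffOn hW
  have h2 := contDiff_toBlocks₁₂.comp_contDiffOn hW
  have h3 := contDiff_toBlocks₂₁.comp_contDiffOn hW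
  have h4 := contDiff_toBlocks₂₂.comp_contDiffOn hW
  have h0 : ContDiffOn ℝ ∞ (fun _ : ℝ => (0 : Matrix n n 𝔽)) J := contDiffOn_const
  have hp := contDiffOn_position hA hD
  have hv1 := contDiffOn_velocity hA hD h1 h0 h0 h4
  have hv2 := contDiffOn_velocity hA hD h0 h2 h3 h0
  rw [firstVariation_of_blockDiag hM hJ hγ ht, firstVariation_of_blockDiag hM hJ hγ ht,
    firstVariation_of_blockDiag hM hJ hγ ht]
  simp only [toBlocks_fromBlocks₁₁, toBlocks_fromBlocks₁₂, toBlocks_fromBlocks₂₁,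
    toBlocks_fromBlocks₂₂]
  refine Eq.trans ?_ (integral_add (integrableOn_reInner_deriv hMc hfin hJ hp hv1 ht)
    (integrableOn_reInner_deriv hMc hfin hJ hp hv2 ht))
  congr 1
  ext q
  have hd1 := differentiableAt_slice hJ hv1 ht q
  have hd2 := differentiableAt_slice hJ hv2 ht q
  have hsum := (hd1.hasDerivAt.add hd2.hasDerivAt).deriv
  simp only [← reInnerL_apply]
  rw [← map_add]
  congr 1
  refine Eq.trans ?_ hsum
  congr 1
  ext1 τ
  simp only [Function.comp, Pi.add_apply]
  noncomm_ring

end FirstVariation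

/-! ### Reduction to off-diagonal variations -/

section Criterion

attribute [local instance] frobeniusRing frobeniusAlgebra
attribute [local instance] Matrix.frobeniusNormedAddCommGroup Matrix.frobeniusNormedSpace

variable {n : Type*} [Fintype n] [DecidableEq n] {𝔽 : Type*} [NormedDivisionRing 𝔽]
  [InnerProductSpace ℝ 𝔽] [FiniteDimensional ℝ 𝔽] [IsScalarTower ℝ 𝔽 𝔽] [SMulCommClass ℝ 𝔽 𝔽]
  [StarRing 𝔽] [StarModule ℝ 𝔽] [ContinuousStar 𝔽]
  {M : Set (Matrix n n 𝔽)} {d : ℕ} {J : Set ℝ}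
  {γ : ℝ → Matrix (n ⊕ n) (n ⊕ n) 𝔽}

theorem contDiffOn_exp_smul_mul {w A : ℝ → Matrix n n 𝔽} (hw : ContDiffOn ℝ ∞ w J)
    (hA : ContDiffOn ℝ ∞ A J) (s : Set ℝ) :
    ContDiffOn ℝ ∞ (fun p : ℝ × ℝ => NormedSpace.exp (p.1 • w p.2) * A p.2) (s ×ˢ J) := by
  have lift : ∀ {B : ℝ → Matrix n n 𝔽}, ContDiffOn ℝ ∞ B J →
      ContDiffOn ℝ ∞ (fun p : ℝ × ℝ => B p.2) (s ×ˢ J) := fun hB =>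
    hB.comp contDiffOn_snd fun p hp => hp.2
  have h1 : ContDiffOn ℝ ∞ (fun p : ℝ × ℝ => p.1 • w p.2) (s ×ˢ J) :=
    contDiffOn_fst.smul (lift hw)
  exact (contDiff_exp_matrix.comp_contDiffOn h1).mul (lift hA)

/-- Right translation carries a tangent vector of the unitary group at `A` to the Lie algebra, so
that it can be exponentiated. -/
theorem conjTranspose_mul_conjTranspose_eq_neg {w A : Matrix n n 𝔽} (hA : Aᴴ * A = 1)
    (h : wᴴ * A + Aᴴ * w = 0) : (w * Aᴴ)ᴴ = -(w * Aᴴ) := by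
  have hA' := mul_conjTranspose_eq_one hA
  rw [conjTranspose_mul, conjTranspose_conjTranspose]
  calc A * wᴴ = A * (wᴴ * A) * Aᴴ := by
        rw [mul_assoc, mul_assoc, hA', mul_one]
    _ = A * (-(Aᴴ * w)) * Aᴴ := by rw [eq_neg_of_add_eq_zero_left h]
    _ = -(A * Aᴴ * w * Aᴴ) := by noncomm_ring
    _ = -(w * Aᴴ) := by rw [hA', one_mul]

/-- The first variation of the energy of a geodesic of `blockDiag M` vanishes for the variation
fields tangent to `blockDiag M` which vanish at the end points. -/
theorem integral_firstVariation_eq_zero (hpos : ∀ P : Matrix n n 𝔽, Pᴴ * P = 0 → P = 0)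
    (hM : ∀ U ∈ M, Uᴴ * U = 1)
    (hMexp : ∀ x : Matrix n n 𝔽, xᴴ = -x → ∀ A ∈ M, NormedSpace.exp x * A ∈ M)
    (hMc : IsCompact M) (hfin : μHE[d] M < ⊤) (hJ : IsOpen J)
    (hγ : IsGeodesic (kineticMetric M d) (blockDiag M) J γ) {w₁ w₂ : ℝ → Matrix n n 𝔽}
    (hw₁ : ContDiffOn ℝ ∞ w₁ J) (hw₂ : ContDiffOn ℝ ∞ w₂ J)
    (hs₁ : ∀ t ∈ J, (w₁ t)ᴴ * (γ t).toBlocks₁₁ + (γ t).toBlocks₁₁ᴴ * w₁ t = 0)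
    (hs₂ : ∀ t ∈ J, (w₂ t)ᴴ * (γ t).toBlocks₂₂ + (γ t).toBlocks₂₂ᴴ * w₂ t = 0)
    {a b : ℝ} (hab : a < b) (hJab : Set.Icc a b ⊆ J) (ha₁ : w₁ a = 0) (ha₂ : w₂ a = 0)
    (hb₁ : w₁ b = 0) (hb₂ : w₂ b = 0) :
    ∫ t in a..b, firstVariation M d γ (fun τ => fromBlocks (w₁ τ) 0 0 (w₂ τ)) t = 0 := by
  obtain ⟨hγs, hγm, hcrit⟩ := hγ
  have hA := contDiff_toBlocks₁₁.comp_contDiffOn hγs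
  have hD := contDiff_toBlocks₂₂.comp_contDiffOn hγs
  have hblk := fun t ht => mem_blockDiag_iff.1 (hγm t ht)
  have hAu : ∀ t ∈ J, (γ t).toBlocks₁₁ᴴ * (γ t).toBlocks₁₁ = 1 := fun t ht => hM _ (hblk t ht).1
  have hDu : ∀ t ∈ J, (γ t).toBlocks₂₂ᴴ * (γ t).toBlocks₂₂ = 1 := fun t ht => hM _ (hblk t ht).2.1
  -- Exponentiating the right-translated fields gives a variation inside M × M with velocity (w₁,
  -- w₂) at s = 0; it is fixed at the end points because the fields vanish there.
  set Γ : ℝ → ℝ → Matrix (n ⊕ n) (n ⊕ n) 𝔽 := fun s t =>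
    fromBlocks (NormedSpace.exp (s • (w₁ t * (γ t).toBlocks₁₁ᴴ)) * (γ t).toBlocks₁₁) 0 0
      (NormedSpace.exp (s • (w₂ t * (γ t).toBlocks₂₂ᴴ)) * (γ t).toBlocks₂₂) with hΓdef
  have hmem : ∀ s, ∀ t ∈ J, Γ s t ∈ blockDiag M := by
    intro s t ht
    refine ⟨_, hMexp _ ?_ _ (hblk t ht).1, _, hMexp _ ?_ _ (hblk t ht).2.1, rfl⟩
    · rw [conjTranspose_smul, conjTranspose_mul_conjTranspose_eq_neg (hAu t ht) (hs₁ t ht)]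
      simp
    · rw [conjTranspose_smul, conjTranspose_mul_conjTranspose_eq_neg (hDu t ht) (hs₂ t ht)]
      simp
  have hsm : ContDiffOn ℝ ∞ (fun p : ℝ × ℝ => Γ p.1 p.2) (Set.Ioo (-1) 1 ×ˢ J) :=
    ContDiffOn.fromBlocks (contDiffOn_exp_smul_mul (hw₁.mul hA.conjTranspose) hA _)
      contDiffOn_const contDiffOn_const
      (contDiffOn_exp_smul_mul (hw₂.mul hD.conjTranspose) hD _)
  have hz : ∀ s, ∀ t ∈ J, s • (w₁ t * (γ t).toBlocks₁₁ᴴ) = 0 →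
      s • (w₂ t * (γ t).toBlocks₂₂ᴴ) = 0 → Γ s t = γ t := by
    intro s t ht h1 h2
    simp only [hΓdef, h1, h2, NormedSpace.exp_zero, one_mul]
    exact (hblk t ht).2.2.symm
  have hvar : IsProperVariation (blockDiag M) J γ a b 1 Γ :=
    { smooth := hsm
      mem := fun s _ t ht => hmem s t ht
      zero := fun t ht => hz 0 t ht (zero_smul _ _) (zero_smul _ _)
      left := fun s _ => hz s a (hJab ⟨le_rfl, hab.le⟩) (by simp [ha₁]) (by simp [ha₂])
      right := fun s _ => hz s b (hJab ⟨hab.le, le_rfl⟩) (by simp [hb₁]) (by simp [hb₂]) }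
  have h0 := hcrit a b 1 hab hJab one_pos Γ hvar
  have h1 := hasDerivAt_energy hMc hfin hJ one_pos hsm (fun s _ t ht q hq =>
    isUnit_of_mem_splitUnitary hpos (blockDiag_subset_splitUnitary hM (hmem s t ht)) (hM q hq))
    hab.le hJab
  rw [h0.unique h1]
  refine intervalIntegral.integral_congr fun t ht => ?_
  rw [Set.uIcc_of_le hab.le] at ht
  refine firstVariation_congr hJ (fun τ hτ => (hvar.zero τ hτ).symm) (fun τ hτ => ?_) (hJab ht)
  have e1 := hasDerivAt_exp_smul_mul (w₁ τ * (γ τ).toBlocks₁₁ᴴ) (γ τ).toBlocks₁₁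
  have e2 := hasDerivAt_exp_smul_mul (w₂ τ * (γ τ).toBlocks₂₂ᴴ) (γ τ).toBlocks₂₂
  rw [mul_assoc, hAu τ hτ, mul_one] at e1
  rw [mul_assoc, hDu τ hτ, mul_one] at e2
  exact (hasDerivAt_of_linear (fromBlocksL (n := n) (𝔽 := 𝔽))
    ((e1.prodMk (hasDerivAt_const (0 : ℝ) (0 : Matrix n n 𝔽))).prodMk
      ((hasDerivAt_const (0 : ℝ) (0 : Matrix n n 𝔽)).prodMk e2))).deriv.symm

/-- Differentiate the block equations of the group at a block diagonal point. There B = C = 0, so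
the equations decouple: the diagonal blocks are tangent to the unitary group, and the off-diagonal
ones determine each other. -/
theorem tangent_splitUnitary {u : ℝ → Matrix (n ⊕ n) (n ⊕ n) 𝔽} {A D : Matrix n n 𝔽}
    {W : Matrix (n ⊕ n) (n ⊕ n) 𝔽} (hu : HasDerivAt u W 0) (h0 : u 0 = fromBlocks A 0 0 D)
    (hmem : ∀ᶠ s in nhds (0 : ℝ), u s ∈ splitUnitary n) :
    W.toBlocks₁₁ᴴ * A + Aᴴ * W.toBlocks₁₁ = 0 ∧ W.toBlocks₂₂ᴴ * D + Dᴴ * W.toBlocks₂₂ = 0 ∧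
      Aᴴ * W.toBlocks₁₂ = W.toBlocks₂₁ᴴ * D := by
  obtain ⟨h11, h12, h21, h22⟩ := hasDerivAt_toBlocks hu
  have hev := hmem.mono fun s hs => by
    rw [← fromBlocks_toBlocks (u s), mem_splitUnitary_iff] at hs
    exact hs
  have k1 := ((h11.conjTranspose.mul h11).sub (h21.conjTranspose.mul h21)).unique
    ((hasDerivAt_const (0 : ℝ) (1 : Matrix n n 𝔽)).congr_of_eventuallyEq
      (hev.mono fun s hs => hs.1))
  have k2 := ((h11.conjTranspose.mul h12).sub (h21.conjTranspose.mul h22)).unique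
    ((hasDerivAt_const (0 : ℝ) (0 : Matrix n n 𝔽)).congr_of_eventuallyEq
      (hev.mono fun s hs => hs.2.1))
  have k4 := ((h12.conjTranspose.mul h12).sub (h22.conjTranspose.mul h22)).unique
    ((hasDerivAt_const (0 : ℝ) (-1 : Matrix n n 𝔽)).congr_of_eventuallyEq
      (hev.mono fun s hs => hs.2.2.2))
  simp only [h0, toBlocks_fromBlocks₁₁, toBlocks_fromBlocks₁₂, toBlocks_fromBlocks₂₁,
    toBlocks_fromBlocks₂₂, conjTranspose_zero, mul_zero, zero_mul, add_zero, zero_add, sub_zero,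
    zero_sub, neg_eq_zero] at k1 k2 k4
  exact ⟨k1, k4, sub_eq_zero.1 k2⟩

/-- A geodesic of `blockDiag M` is a geodesic of a larger set `S` of pseudo-unitary matrices if
the first variation in the off-diagonal directions vanishes. -/
theorem isGeodesic_of_blockDiag (hpos : ∀ P : Matrix n n 𝔽, Pᴴ * P = 0 → P = 0)
    (hM : ∀ U ∈ M, Uᴴ * U = 1)
    (hMexp : ∀ x : Matrix n n 𝔽, xᴴ = -x → ∀ A ∈ M, NormedSpace.exp x * A ∈ M)
    (hMc : IsCompact M) (hfin : μHE[d] M < ⊤) (hJ : IsOpen J)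
    {S : Set (Matrix (n ⊕ n) (n ⊕ n) 𝔽)} (hS : S ⊆ splitUnitary n) (hMS : blockDiag M ⊆ S)
    (hγ : IsGeodesic (kineticMetric M d) (blockDiag M) J γ)
    (hP : ∀ b c : ℝ → Matrix n n 𝔽, ContDiffOn ℝ ∞ b J → ContDiffOn ℝ ∞ c J →
      (∀ t ∈ J, (γ t).toBlocks₁₁ᴴ * b t = (c t)ᴴ * (γ t).toBlocks₂₂) →
      ∀ t ∈ J, firstVariation M d γ (fun τ => fromBlocks 0 (b τ) (c τ) 0) t = 0) :
    IsGeodesic (kineticMetric M d) S J γ := by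
  refine ⟨hγ.1, fun t ht => hMS (hγ.2.1 t ht), fun a b ε hab hJab hε Γ hΓ => ?_⟩
  have hO : IsOpen (Set.Ioo (-ε) ε ×ˢ J) := isOpen_Ioo.prod hJ
  have h0 : (0 : ℝ) ∈ Set.Ioo (-ε) ε := ⟨by linarith, hε⟩
  have hΓd : ∀ t ∈ J, DifferentiableAt ℝ (fun p : ℝ × ℝ => Γ p.1 p.2) (0, t) := fun t ht =>
    (hΓ.smooth.contDiffAt (hO.mem_nhds ⟨h0, ht⟩)).differentiableAt (by simp)
  have hWd : ∀ t ∈ J, HasDerivAt (fun s => Γ s t) (deriv (fun s => Γ s t) 0) 0 := fun t ht =>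
    (hasDerivAt_slice_fst (c := fun p : ℝ × ℝ => Γ p.1 p.2) (hΓd t ht)).differentiableAt.hasDerivAt
  set W : ℝ → Matrix (n ⊕ n) (n ⊕ n) 𝔽 := fun t => deriv (fun s => Γ s t) 0 with hWdef
  have hWs : ContDiffOn ℝ ∞ W J := by
    have h1 : ContDiffOn ℝ ∞ (fun p : ℝ × ℝ => fderiv ℝ (fun p : ℝ × ℝ => Γ p.1 p.2) p (1, 0))
        (Set.Ioo (-ε) ε ×ˢ J) :=
      (hΓ.smooth.fderiv_of_isOpen hO (m := ∞) (by norm_cast)).clm_apply contDiffOn_const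
    have h2 : ContDiffOn ℝ ∞
        (fun t : ℝ => fderiv ℝ (fun p : ℝ × ℝ => Γ p.1 p.2) (0, t) (1, 0)) J :=
      h1.comp (f := fun t : ℝ => ((0 : ℝ), t)) (by fun_prop) fun t ht => ⟨h0, ht⟩
    exact h2.congr fun t ht =>
      (hasDerivAt_slice_fst (c := fun p : ℝ × ℝ => Γ p.1 p.2) (hΓd t ht)).deriv
  have htan := fun t ht => tangent_splitUnitary (hWd t ht)
    ((hΓ.zero t ht).trans (mem_blockDiag_iff.1 (hγ.2.1 t ht)).2.2)
    (Filter.eventually_of_mem (isOpen_Ioo.mem_nhds h0) fun s hs => hS (hΓ.mem s hs t ht))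
  have hWend : ∀ c, (∀ s ∈ Set.Ioo (-ε) ε, Γ s c = γ c) → W c = 0 := by
    intro c hc
    have h1 : (fun s => Γ s c) =ᶠ[nhds 0] fun _ => γ c :=
      Filter.eventually_of_mem (isOpen_Ioo.mem_nhds h0) hc
    exact h1.deriv_eq.trans (deriv_const _ _)
  have hWa := hWend a hΓ.left
  have hWb := hWend b hΓ.right
  have key := hasDerivAt_energy hMc hfin hJ hε hΓ.smooth (fun s hs t ht q hq =>
    isUnit_of_mem_splitUnitary hpos (hS (hΓ.mem s hs t ht)) (hM q hq)) hab.le hJab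
  refine key.congr_deriv ?_
  -- The diagonal blocks of the variation field are themselves an admissible field for γ as a
  -- geodesic of M × M.
  have hK := integral_firstVariation_eq_zero hpos hM hMexp hMc hfin hJ hγ
    (contDiff_toBlocks₁₁.comp_contDiffOn hWs) (contDiff_toBlocks₂₂.comp_contDiffOn hWs)
    (fun t ht => (htan t ht).1) (fun t ht => (htan t ht).2.1) hab hJab
    (by simp only [Function.comp, hWa]; rfl) (by simp only [Function.comp, hWa]; rfl)
    (by simp only [Function.comp, hWb]; rfl) (by simp only [Function.comp, hWb]; rfl)
  refine Eq.trans ?_ hK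
  refine intervalIntegral.integral_congr fun t ht => ?_
  rw [Set.uIcc_of_le hab.le] at ht
  have ht := hJab ht
  rw [firstVariation_congr hJ hΓ.zero (fun _ _ => rfl) ht,
    firstVariation_eq_add hM hMc hfin hJ hγ.1 hγ.2.1 hWs ht]
  have hPt := hP _ _ (contDiff_toBlocks₁₂.comp_contDiffOn hWs)
    (contDiff_toBlocks₂₁.comp_contDiffOn hWs) (fun t ht => (htan t ht).2.2) t ht
  exact (congrArg (_ + ·) hPt).trans (add_zero _)

end Criterion

/-! ### Hausdorff measure of the groups -/

section HausdorffMeasure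

variable {X : Type*} [NormedAddCommGroup X] [NormedSpace ℝ X] [MeasurableSpace X] [BorelSpace X]

/-- A C¹ map is Lipschitz on a compact set, and a Lipschitz map enlarges the Hausdorff measure by at
most a constant. On `Fin k → ℝ` that measure is Lebesgue measure. -/
theorem euclideanHausdorffMeasure_lt_top {k : ℕ} {f : (Fin k → ℝ) → X} (hf : ContDiff ℝ 1 f)
    {s : Set (Fin k → ℝ)} (hs : IsCompact s) {M : Set X} (hM : M ⊆ f '' s) : μHE[k] M < ⊤ := by
  obtain ⟨K, hK⟩ := (hf.locallyLipschitz.locallyLipschitzOn (s := s)).exists_lipschitzOnWith_of_compact hs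
  have h1 := hK.hausdorffMeasure_image_le (d := (k : ℝ)) (by positivity)
  have h2 : (μH[(k : ℝ)] : Measure (Fin k → ℝ)) = volume := by
    have h := hausdorffMeasure_pi_real (ι := Fin k)
    rwa [Fintype.card_fin] at h
  rw [h2] at h1
  have h3 : (μH[(k : ℝ)] : Measure X) M < ⊤ :=
    lt_of_le_of_lt ((measure_mono hM).trans h1)
      (ENNReal.mul_lt_top (by simp) hs.measure_lt_top)
  rw [Measure.euclideanHausdorffMeasure_def]
  exact ENNReal.mul_lt_top (by simp) h3

/-- The same Lipschitz estimate, now for a linear projection: a null set could not cover a set of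
positive volume. -/
theorem euclideanHausdorffMeasure_pos [FiniteDimensional ℝ X] {k : ℕ} (f : X →ₗ[ℝ] Fin k → ℝ)
    {s : Set (Fin k → ℝ)} (hs : 0 < volume s) {M : Set X} (hM : s ⊆ f '' M) : 0 < μHE[k] M := by
  have hL := (LinearMap.toContinuousLinearMap f).lipschitz
  have h1 := (hL.lipschitzOnWith (s := M)).hausdorffMeasure_image_le (d := (k : ℝ)) (by positivity)
  have h2 : (μH[(k : ℝ)] : Measure (Fin k → ℝ)) = volume := by
    have h := hausdorffMeasure_pi_real (ι := Fin k)
    rwa [Fintype.card_fin] at h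
  rw [h2] at h1
  have h3 : 0 < volume (f '' M) := hs.trans_le (measure_mono hM)
  have h4 : (μH[(k : ℝ)] : Measure X) M ≠ 0 := by
    intro h0
    rw [h0, mul_zero] at h1
    exact absurd h3 (not_lt.2 h1)
  rw [Measure.euclideanHausdorffMeasure_def]
  refine pos_iff_ne_zero.2 ?_
  rw [Measure.smul_apply]
  exact smul_ne_zero (Measure.addHaarScalarFactor_volume_hausdorffMeasure_ne_zero k) h4

theorem setIntegral_comp_isometryEquiv (e : X ≃ᵢ X) {d : ℕ} {M : Set X} (hM : e ⁻¹' M = M)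
    (F : X → ℝ) : ∫ q in M, F (e q) ∂μHE[d] = ∫ q in M, F q ∂μHE[d] := by
  conv_lhs => rw [← hM]
  exact (e.measurePreserving_euclideanHausdorffMeasure d).setIntegral_preimage_emb
    e.toHomeomorph.measurableEmbedding F M

end HausdorffMeasure

theorem exists_angle {x y : ℝ} (h : x ^ 2 + y ^ 2 = 1) :
    ∃ θ ∈ Set.Icc (-Real.pi) Real.pi, Real.cos θ = x ∧ Real.sin θ = y := by
  set z : ℂ := ⟨x, y⟩ with hz
  have hn : ‖z‖ = 1 := by
    rw [Complex.norm_def, Complex.normSq_apply, Real.sqrt_eq_one]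
    simp only [hz]; nlinarith
  have hz0 : z ≠ 0 := by
    rw [← norm_pos_iff, hn]; exact one_pos
  refine ⟨z.arg, ⟨(Complex.neg_pi_lt_arg z).le, Complex.arg_le_pi z⟩, ?_, ?_⟩
  · rw [Complex.cos_arg hz0, hn, div_one]
  · rw [Complex.sin_arg, hn, div_one]

theorem exists_polar (x y : ℝ) : ∃ θ ∈ Set.Icc (-Real.pi) Real.pi,
    x = √(x ^ 2 + y ^ 2) * Real.cos θ ∧ y = √(x ^ 2 + y ^ 2) * Real.sin θ := by
  by_cases h : x ^ 2 + y ^ 2 = 0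
  · have hx : x = 0 := by nlinarith [sq_nonneg x, sq_nonneg y]
    have hy : y = 0 := by nlinarith [sq_nonneg x, sq_nonneg y]
    exact ⟨0, ⟨by linarith [Real.pi_pos], Real.pi_pos.le⟩, by simp [hx, hy], by simp [hx, hy]⟩
  · have hpos : 0 < √(x ^ 2 + y ^ 2) := Real.sqrt_pos.2 (lt_of_le_of_ne (by positivity) (Ne.symm h))
    have hsq := Real.sq_sqrt (show 0 ≤ x ^ 2 + y ^ 2 by positivity)
    obtain ⟨θ, hθ, hc, hs⟩ := exists_angle (x := x / √(x ^ 2 + y ^ 2)) (y := y / √(x ^ 2 + y ^ 2))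
      (by rw [div_pow, div_pow, ← add_div, hsq, div_self h])
    refine ⟨θ, hθ, ?_, ?_⟩
    · rw [hc]; field_simp
    · rw [hs]; field_simp

/-! ### The group of unit quaternions -/

theorem mem_sp1_iff {U : Matrix (Fin 1) (Fin 1) (Quaternion ℝ)} :
    U ∈ sp1 ↔ Quaternion.normSq (U 0 0) = 1 := by
  simp only [sp1, Set.mem_ofPred_eq]
  rw [← Matrix.ext_iff]
  simp only [Fin.forall_fin_one, mul_apply, Fin.sum_univ_one, conjTranspose_apply, one_apply_eq,
    Quaternion.star_mul_self]
  rw [← Quaternion.coe_one, Quaternion.coe_inj]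

theorem isCompact_sp1 : IsCompact sp1 := by
  have hcl : IsClosed sp1 := by
    have h : sp1 = (fun U : Matrix (Fin 1) (Fin 1) (Quaternion ℝ) => Quaternion.normSq (U 0 0)) ⁻¹' {1} := by
      ext U; exact mem_sp1_iff
    rw [h]
    refine isClosed_singleton.preimage ?_
    have h1 : Continuous (fun U : Matrix (Fin 1) (Fin 1) (Quaternion ℝ) => U 0 0) :=
      continuous_id.matrix_elem 0 0
    exact Quaternion.continuous_normSq.comp h1
  refine Metric.isCompact_of_isClosed_isBounded hcl ?_
  refine (Metric.isBounded_closedBall (x := (0 : Matrix (Fin 1) (Fin 1) (Quaternion ℝ)))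
    (r := 1)).subset fun U hU => ?_
  rw [mem_closedBall_zero_iff, frobenius_norm_def]
  simp only [Fin.sum_univ_one]
  have h2 : ‖U 0 0‖ = 1 := by
    have := mem_sp1_iff.1 hU
    rw [Quaternion.normSq_eq_norm_mul_self] at this
    nlinarith [norm_nonneg (U 0 0)]
  rw [h2]; norm_num

/-- Hopf coordinates (cos α · e^{iβ}, sin α · e^{iδ}) cover the unit sphere of ℍ = ℂ² by a cube of
angles. -/
theorem sp1_subset_image : ∃ f : (Fin 3 → ℝ) → Matrix (Fin 1) (Fin 1) (Quaternion ℝ),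
    ContDiff ℝ 1 f ∧ sp1 ⊆ f '' Set.univ.pi fun _ => Set.Icc (-Real.pi) Real.pi := by
  set E : Quaternion ℝ → Matrix (Fin 1) (Fin 1) (Quaternion ℝ) := fun x => of fun _ _ => x
  refine ⟨fun p => (Real.cos (p 0) * Real.cos (p 1)) • E ⟨1, 0, 0, 0⟩
    + (Real.cos (p 0) * Real.sin (p 1)) • E ⟨0, 1, 0, 0⟩
    + (Real.sin (p 0) * Real.cos (p 2)) • E ⟨0, 0, 1, 0⟩
    + (Real.sin (p 0) * Real.sin (p 2)) • E ⟨0, 0, 0, 1⟩, by fun_prop, fun U hU => ?_⟩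
  have hU := mem_sp1_iff.1 hU
  rw [Quaternion.normSq_def'] at hU
  obtain ⟨β, hβ, hw, hx⟩ := exists_polar (U 0 0).re (U 0 0).imI
  obtain ⟨δ, hδ, hy, hz⟩ := exists_polar (U 0 0).imJ (U 0 0).imK
  obtain ⟨α, hα, hc, hs⟩ := exists_angle (x := √((U 0 0).re ^ 2 + (U 0 0).imI ^ 2))
    (y := √((U 0 0).imJ ^ 2 + (U 0 0).imK ^ 2))
    (by rw [Real.sq_sqrt (by positivity), Real.sq_sqrt (by positivity)]; linarith)
  refine ⟨![α, β, δ], ?_, ?_⟩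
  · intro i _
    fin_cases i <;> assumption
  · ext i j <;> fin_cases i <;> fin_cases j <;> simp [hc, hs, ← hw, ← hx, ← hy, ← hz]
    · change (U 0 0).re * 1 + (U 0 0).imI * 0 + (U 0 0).imJ * 0 + (U 0 0).imK * 0 = _
      ring
    · change (U 0 0).re * 0 + (U 0 0).imI * 1 + (U 0 0).imJ * 0 + (U 0 0).imK * 0 = _
      ring
    · change (U 0 0).re * 0 + (U 0 0).imI * 0 + (U 0 0).imJ * 1 + (U 0 0).imK * 0 = _
      ring
    · change (U 0 0).re * 0 + (U 0 0).imI * 0 + (U 0 0).imJ * 0 + (U 0 0).imK * 1 = _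
      ring

theorem euclideanHausdorffMeasure_sp1 : μHE[3] sp1 < ⊤ := by
  obtain ⟨f, hf, hsub⟩ := sp1_subset_image
  exact euclideanHausdorffMeasure_lt_top hf (isCompact_univ_pi fun _ => isCompact_Icc) hsub

theorem starModule_quaternion : StarModule ℝ (Quaternion ℝ) :=
  ⟨fun r a => by ext <;> simp⟩

/-- The reflection `q ↦ -q` of Sp₁ annihilates every off-diagonal first variation. -/
theorem totallyGeodesic_sp1 : IsTotallyGeodesic metricSp11 (blockDiag sp1) sp11 := by
  have hM : ∀ U ∈ sp1, Uᴴ * U = 1 := fun U hU => hU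
  have := starModule_quaternion
  have hsub : blockDiag sp1 ⊆ sp11 := blockDiag_subset_splitUnitary hM
  refine ⟨hsub, fun J hJ _ γ hγ => ?_⟩
  refine isGeodesic_of_blockDiag (fun P hP => ?_) hM (fun x hx A hA => ?_) isCompact_sp1
    euclideanHausdorffMeasure_sp1 hJ subset_rfl hsub hγ fun b c _ _ _ t ht => ?_
  · have h := congrFun (congrFun hP 0) 0
    simp only [mul_apply, Fin.sum_univ_one, conjTranspose_apply, Matrix.zero_apply] at h
    ext1 i j
    fin_cases i; fin_cases j
    exact (mul_eq_zero.1 h).elim (fun h => star_eq_zero.1 h) id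
  · have h : (NormedSpace.exp x)ᴴ * NormedSpace.exp x = 1 := conjTranspose_exp_mul_exp hx
    change (NormedSpace.exp x * A)ᴴ * (NormedSpace.exp x * A) = 1
    rw [conjTranspose_mul]
    calc Aᴴ * (NormedSpace.exp x)ᴴ * (NormedSpace.exp x * A)
        = Aᴴ * ((NormedSpace.exp x)ᴴ * NormedSpace.exp x) * A := by noncomm_ring
      _ = 1 := by rw [h, mul_one]; exact hA
  · rw [firstVariation_of_blockDiag hM hJ hγ.2.1 ht]
    have hneg : (IsometryEquiv.neg (Matrix (Fin 1) (Fin 1) (Quaternion ℝ))) ⁻¹' sp1 = sp1 := by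
      ext U
      simp [mem_sp1_iff]
    have h := setIntegral_comp_isometryEquiv (d := 3) _ hneg (fun q =>
      reInner (deriv (fun τ => (γ τ).toBlocks₁₁ * q * ((γ τ).toBlocks₂₂)ᴴ) t)
        (deriv (fun τ => ((fromBlocks 0 (b τ) (c τ) 0).toBlocks₁₁ * q
          + (fromBlocks 0 (b τ) (c τ) 0).toBlocks₁₂) * ((γ τ).toBlocks₂₂)ᴴ
          - (γ τ).toBlocks₁₁ * q * ((γ τ).toBlocks₂₂)ᴴ
            * ((fromBlocks 0 (b τ) (c τ) 0).toBlocks₂₁ * q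
              + (fromBlocks 0 (b τ) (c τ) 0).toBlocks₂₂) * ((γ τ).toBlocks₂₂)ᴴ) t))
    -- The derivative of A q Dᴴ is odd in `q`, that of b Dᴴ - A q Dᴴ c q Dᴴ is even. The integrand
    -- is thus odd, and its integral equals its negative.
    refine self_eq_neg.1 (h.symm.trans ?_)
    rw [← integral_neg]
    congr 1
    ext1 q
    simp only [toBlocks_fromBlocks₁₁, toBlocks_fromBlocks₁₂, toBlocks_fromBlocks₂₁,
      toBlocks_fromBlocks₂₂, IsometryEquiv.neg_apply, zero_mul, zero_add, add_zero, mul_neg, neg_mul,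
      neg_neg]
    have e : deriv (fun τ => -((γ τ).toBlocks₁₁ * q * ((γ τ).toBlocks₂₂)ᴴ)) t
        = -deriv (fun τ => (γ τ).toBlocks₁₁ * q * ((γ τ).toBlocks₂₂)ᴴ) t := deriv.fun_neg
    rw [e]
    simp [reInner]

/-! ### The rotation group -/

theorem mem_so3_iff {U : Matrix (Fin 3) (Fin 3) ℝ} : U ∈ so3 ↔ Uᵀ * U = 1 ∧ U.det = 1 := by
  simp only [so3, SetLike.mem_coe, mem_specialOrthogonalGroup_iff]
  rw [mem_orthogonalGroup_iff']

theorem conjTranspose_mul_of_mem_so3 {U : Matrix (Fin 3) (Fin 3) ℝ} (hU : U ∈ so3) :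
    Uᴴ * U = 1 := by
  rw [conjTranspose_eq_transpose_of_trivial]
  exact (mem_so3_iff.1 hU).1

theorem mul_transpose_of_mem_so3 {U : Matrix (Fin 3) (Fin 3) ℝ} (hU : U ∈ so3) : U * Uᵀ = 1 :=
  mul_eq_one_comm.1 (mem_so3_iff.1 hU).1

theorem mul_mem_so3 {U V : Matrix (Fin 3) (Fin 3) ℝ} (hU : U ∈ so3) (hV : V ∈ so3) :
    U * V ∈ so3 :=
  (specialOrthogonalGroup (Fin 3) ℝ).mul_mem hU hV

theorem one_mem_so3 : (1 : Matrix (Fin 3) (Fin 3) ℝ) ∈ so3 :=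
  (specialOrthogonalGroup (Fin 3) ℝ).one_mem

theorem transpose_mem_so3 {U : Matrix (Fin 3) (Fin 3) ℝ} (hU : U ∈ so3) : Uᵀ ∈ so3 := by
  rw [mem_so3_iff, transpose_transpose, det_transpose]
  exact ⟨mul_transpose_of_mem_so3 hU, (mem_so3_iff.1 hU).2⟩

theorem eq_zero_of_transpose_mul_self {P : Matrix (Fin 3) (Fin 3) ℝ} (h : Pᴴ * P = 0) : P = 0 :=
  conjTranspose_mul_self_eq_zero.1 h

/-- Orthogonality leaves determinant ±1; the sign is positive because exp x is the square of exp
(x/2). -/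
theorem exp_mul_mem_so3 {x : Matrix (Fin 3) (Fin 3) ℝ} (hx : xᴴ = -x)
    {A : Matrix (Fin 3) (Fin 3) ℝ} (hA : A ∈ so3) : NormedSpace.exp x * A ∈ so3 := by
  refine mul_mem_so3 ?_ hA
  have h1 : ∀ y : Matrix (Fin 3) (Fin 3) ℝ, yᴴ = -y →
      (NormedSpace.exp y)ᵀ * NormedSpace.exp y = 1 := by
    intro y hy
    rw [← conjTranspose_eq_transpose_of_trivial]
    exact conjTranspose_exp_mul_exp hy
  refine mem_so3_iff.2 ⟨h1 x hx, ?_⟩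
  have h2 : NormedSpace.exp x
      = NormedSpace.exp ((1 / 2 : ℝ) • x) * NormedSpace.exp ((1 / 2 : ℝ) • x) := by
    rw [← Matrix.exp_add_of_commute _ _ (Commute.refl _), ← add_smul]
    norm_num
  have h3 := congrArg det (h1 ((1 / 2 : ℝ) • x) (by rw [conjTranspose_smul, hx]; simp))
  rw [det_mul, det_transpose, det_one] at h3
  rw [h2, det_mul, h3]

/-- The rotation with Euler angles `p 0`, `p 1`, `p 2`. -/
def eulerRotation (p : Fin 3 → ℝ) : Matrix (Fin 3) (Fin 3) ℝ :=
  !![Real.cos (p 0), -Real.sin (p 0), 0; Real.sin (p 0), Real.cos (p 0), 0; 0, 0, 1] *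
  !![Real.cos (p 1), 0, Real.sin (p 1); 0, 1, 0; -Real.sin (p 1), 0, Real.cos (p 1)] *
  !![Real.cos (p 2), -Real.sin (p 2), 0; Real.sin (p 2), Real.cos (p 2), 0; 0, 0, 1]

theorem rotationZ_mem_so3 {c s : ℝ} (h : c ^ 2 + s ^ 2 = 1) :
    !![c, -s, 0; s, c, 0; 0, 0, 1] ∈ so3 := by
  rw [mem_so3_iff]
  constructor
  · ext i j
    fin_cases i <;> fin_cases j <;> simp [mul_apply, Fin.sum_univ_three] <;> nlinarith
  · simp [det_fin_three]; nlinarith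

theorem rotationY_mem_so3 {c s : ℝ} (h : c ^ 2 + s ^ 2 = 1) :
    !![c, 0, s; 0, 1, 0; -s, 0, c] ∈ so3 := by
  rw [mem_so3_iff]
  constructor
  · ext i j
    fin_cases i <;> fin_cases j <;> simp [mul_apply, Fin.sum_univ_three] <;> nlinarith
  · simp [det_fin_three]; nlinarith

theorem eulerRotation_mem_so3 (p : Fin 3 → ℝ) : eulerRotation p ∈ so3 :=
  mul_mem_so3 (mul_mem_so3 (rotationZ_mem_so3 (Real.cos_sq_add_sin_sq _))
    (rotationY_mem_so3 (Real.cos_sq_add_sin_sq _))) (rotationZ_mem_so3 (Real.cos_sq_add_sin_sq _))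

theorem contDiff_eulerRotation : ContDiff ℝ 1 eulerRotation := by
  have h : eulerRotation = fun p => ∑ i, ∑ j, eulerRotation p i j • single i j (1 : ℝ) := by
    ext1 p
    conv_lhs => rw [matrix_eq_sum_single (eulerRotation p)]
    simp [smul_single]
  rw [h]
  refine ContDiff.sum fun i _ => ContDiff.sum fun j _ => ?_
  suffices h : ContDiff ℝ 1 fun p => eulerRotation p i j from h.smul contDiff_const
  fin_cases i <;> fin_cases j <;> simp [eulerRotation, mul_apply, Fin.sum_univ_three] <;> fun_prop

/-- Every rotation has Euler angles. -/
theorem so3_subset_image_eulerRotation :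
    so3 ⊆ eulerRotation '' Set.univ.pi fun _ => Set.Icc (-Real.pi) Real.pi := by
  intro A hA
  have hAT := (mem_so3_iff.1 hA).1
  have hcol : A 0 2 ^ 2 + A 1 2 ^ 2 + A 2 2 ^ 2 = 1 := by
    have := congrFun (congrFun hAT 2) 2
    simp [mul_apply, Fin.sum_univ_three] at this
    nlinarith
  -- Spherical coordinates of the third column of `A` give a rotation `R` with that same column.
  -- Then Rᵀ A fixes the third axis, and it remains to see that it is a rotation about it.
  obtain ⟨φ, hφ, h1, h2⟩ := exists_polar (A 0 2) (A 1 2)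
  obtain ⟨θ, hθ, hc, hs⟩ := exists_angle (x := A 2 2) (y := √(A 0 2 ^ 2 + A 1 2 ^ 2))
    (by rw [Real.sq_sqrt (by positivity)]; linarith)
  rw [← hs] at h1 h2
  set R := !![Real.cos φ, -Real.sin φ, 0; Real.sin φ, Real.cos φ, 0; 0, 0, 1] *
    !![Real.cos θ, 0, Real.sin θ; 0, 1, 0; -Real.sin θ, 0, Real.cos θ] with hR
  have hRm : R ∈ so3 := mul_mem_so3 (rotationZ_mem_so3 (Real.cos_sq_add_sin_sq _))
    (rotationY_mem_so3 (Real.cos_sq_add_sin_sq _))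
  set B := Rᵀ * A with hB
  have hBm : B ∈ so3 := mul_mem_so3 (transpose_mem_so3 hRm) hA
  have hAB : A = R * B := by
    rw [hB, ← Matrix.mul_assoc, mul_transpose_of_mem_so3 hRm, Matrix.one_mul]
  have hRc : ∀ i, R i 2 = A i 2 := by
    intro i
    fin_cases i <;> simp [hR, h1, h2, hc, mul_comm]
  have hBc : ∀ i, B i 2 = (1 : Matrix (Fin 3) (Fin 3) ℝ) i 2 := by
    intro i
    rw [hB, ← (mem_so3_iff.1 hRm).1]
    simp only [mul_apply, hRc]
  have b02 : B 0 2 = 0 := hBc 0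
  have b12 : B 1 2 = 0 := hBc 1
  have b22 : B 2 2 = 1 := hBc 2
  have hBr := congrFun (congrFun (mul_transpose_of_mem_so3 hBm) 2) 2
  simp only [mul_apply, Fin.sum_univ_three, transpose_apply, one_apply_eq, b22] at hBr
  have b20 : B 2 0 = 0 := mul_self_eq_zero.1
    (by linarith [mul_self_nonneg (B 2 0), mul_self_nonneg (B 2 1)])
  have b21 : B 2 1 = 0 := mul_self_eq_zero.1
    (by linarith [mul_self_nonneg (B 2 0), mul_self_nonneg (B 2 1)])
  have hBT := (mem_so3_iff.1 hBm).1
  have e00 := congrFun (congrFun hBT 0) 0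
  have e11 := congrFun (congrFun hBT 1) 1
  have hdet := (mem_so3_iff.1 hBm).2
  simp only [mul_apply, Fin.sum_univ_three, transpose_apply, one_apply_eq, b20, b21] at e00 e11
  simp only [det_fin_three, b20, b21, b22, b02, b12] at hdet
  -- For a planar block with unit columns, this sum of squares is 2 - 2 det = 0, which forces the
  -- shape of a rotation.
  have hsum : (B 0 0 - B 1 1) ^ 2 + (B 0 1 + B 1 0) ^ 2 = 0 := by
    linear_combination e00 + e11 - 2 * hdet
  have b11 : B 0 0 - B 1 1 = 0 := pow_eq_zero_iff two_ne_zero |>.1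
    (by linarith [sq_nonneg (B 0 0 - B 1 1), sq_nonneg (B 0 1 + B 1 0)])
  have b01 : B 0 1 + B 1 0 = 0 := pow_eq_zero_iff two_ne_zero |>.1
    (by linarith [sq_nonneg (B 0 0 - B 1 1), sq_nonneg (B 0 1 + B 1 0)])
  replace b11 : B 1 1 = B 0 0 := by linarith
  replace b01 : B 0 1 = -B 1 0 := by linarith
  obtain ⟨ψ, hψ, hc', hs'⟩ := exists_angle (x := B 0 0) (y := B 1 0) (by linear_combination e00)
  refine ⟨![φ, θ, ψ], ?_, ?_⟩
  · intro i _
    fin_cases i <;> assumption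
  · rw [hAB]
    change R * _ = R * B
    congr 1
    ext i j
    fin_cases i <;> fin_cases j <;> simp [hc', hs', b01, b02, b11, b12, b20, b21, b22]

theorem isCompact_so3 : IsCompact so3 := by
  have h : so3 = eulerRotation '' Set.univ.pi fun _ => Set.Icc (-Real.pi) Real.pi :=
    so3_subset_image_eulerRotation.antisymm (by rintro _ ⟨p, -, rfl⟩; exact eulerRotation_mem_so3 p)
  rw [h]
  exact (isCompact_univ_pi fun _ => isCompact_Icc).image contDiff_eulerRotation.continuous

theorem isPreconnected_so3 : IsPreconnected so3 := by
  have h : so3 = eulerRotation '' Set.univ :=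
    (so3_subset_image_eulerRotation.trans (Set.image_mono (Set.subset_univ _))).antisymm
      (by rintro _ ⟨p, -, rfl⟩; exact eulerRotation_mem_so3 p)
  rw [h]
  exact isPreconnected_univ.image _ contDiff_eulerRotation.continuous.continuousOn

theorem euclideanHausdorffMeasure_so3_lt_top : μHE[3] so3 < ⊤ :=
  euclideanHausdorffMeasure_lt_top contDiff_eulerRotation
    (isCompact_univ_pi fun _ => isCompact_Icc) so3_subset_image_eulerRotation

/-- Three suitable matrix entries serve as local coordinates: in Euler angles they are cos φ sin θ,
sin φ sin θ and -sin θ cos ψ, and they fill a small cube. -/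
theorem euclideanHausdorffMeasure_so3_pos : 0 < μHE[3] so3 := by
  set f : Matrix (Fin 3) (Fin 3) ℝ →ₗ[ℝ] Fin 3 → ℝ :=
    { toFun := fun U => ![U 0 2, U 1 2, U 2 0]
      map_add' := fun U V => by ext i; fin_cases i <;> simp
      map_smul' := fun c U => by ext i; fin_cases i <;> simp } with hf
  -- On this cube r² = v₀² + v₁² lies between 1/8 and 2/9 and v₂² ≤ 1/9, so sin θ = r and cos ψ =
  -- -v₂/r are both solvable.
  refine euclideanHausdorffMeasure_pos f
    (s := Set.univ.pi fun _ => Set.Icc (1 / 4 : ℝ) (1 / 3)) ?_ ?_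
  · rw [volume_pi_pi]
    simp only [Real.volume_Icc]
    exact CanonicallyOrderedAdd.prod_pos.2 fun i _ => by rw [ENNReal.ofReal_pos]; norm_num
  · intro v hv
    have hv0 := hv 0 (Set.mem_univ _)
    have hv1 := hv 1 (Set.mem_univ _)
    have hv2 := hv 2 (Set.mem_univ _)
    obtain ⟨l0, u0⟩ := hv0
    obtain ⟨l1, u1⟩ := hv1
    obtain ⟨l2, u2⟩ := hv2
    set r := √(v 0 ^ 2 + v 1 ^ 2) with hr
    have hr2 : r ^ 2 = v 0 ^ 2 + v 1 ^ 2 := Real.sq_sqrt (by positivity)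
    have hrpos : 0 < r := Real.sqrt_pos.2 (by nlinarith)
    have hr1 : r ^ 2 ≤ 1 := by nlinarith
    have hzr : (v 2 / r) ^ 2 ≤ 1 := by
      rw [div_pow, div_le_one (by positivity), hr2]
      nlinarith
    obtain ⟨φ, -, h1, h2⟩ := exists_polar (v 0) (v 1)
    rw [← hr] at h1 h2
    obtain ⟨θ, -, hc, hs⟩ := exists_angle (x := √(1 - r ^ 2)) (y := r)
      (by rw [Real.sq_sqrt (by linarith)]; ring)
    obtain ⟨ψ, -, hc', hs'⟩ := exists_angle (x := -(v 2 / r)) (y := √(1 - (v 2 / r) ^ 2))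
      (by rw [Real.sq_sqrt (by linarith)]; ring)
    refine ⟨eulerRotation ![φ, θ, ψ], eulerRotation_mem_so3 _, ?_⟩
    ext i
    fin_cases i
    · simp [hf, eulerRotation, hs]
      linarith
    · simp [hf, eulerRotation, hs]
      linarith
    · simp [hf, eulerRotation, hs, hc']
      field_simp

/-- SO₃ × SO₃ is connected, contains the identity and preserves the form. -/
theorem blockDiag_so3_subset_oo33 : blockDiag so3 ⊆ oo33 := by
  have himg : blockDiag so3 = (fun p : Matrix (Fin 3) (Fin 3) ℝ × Matrix (Fin 3) (Fin 3) ℝ =>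
      fromBlocks p.1 0 0 p.2) '' (so3 ×ˢ so3) := by
    ext T
    constructor
    · rintro ⟨A, hA, D, hD, rfl⟩
      exact ⟨(A, D), ⟨hA, hD⟩, rfl⟩
    · rintro ⟨⟨A, D⟩, ⟨hA, hD⟩, rfl⟩
      exact ⟨A, hA, D, hD, rfl⟩
  have hpre : IsPreconnected (blockDiag so3) := by
    rw [himg]
    refine (isPreconnected_so3.prod isPreconnected_so3).image _ (Continuous.continuousOn ?_)
    exact Continuous.matrix_fromBlocks continuous_fst continuous_const continuous_const
      continuous_snd
  exact hpre.subset_connectedComponentIn ⟨1, one_mem_so3, 1, one_mem_so3, fromBlocks_one.symm⟩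
    (blockDiag_subset_splitUnitary fun U hU => conjTranspose_mul_of_mem_so3 hU)

theorem reInner_eq_trace (X Y : Matrix (Fin 3) (Fin 3) ℝ) : reInner X Y = (Xᵀ * Y).trace := by
  simp only [reInner, trace, diag_apply, mul_apply, transpose_apply]
  rw [Finset.sum_comm]
  simp [mul_comm]

theorem reInner_self (X : Matrix (Fin 3) (Fin 3) ℝ) : reInner X X = ‖X‖ ^ 2 := by
  rw [frobenius_norm_def, ← Real.sqrt_eq_rpow, Real.sq_sqrt (by positivity)]
  simp [reInner, pow_two]

/-- The isometry `X ↦ U X V` of the space of matrices given by two rotations. -/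
def rotationIsometry {U V : Matrix (Fin 3) (Fin 3) ℝ} (hU : U ∈ so3) (hV : V ∈ so3) :
    Matrix (Fin 3) (Fin 3) ℝ ≃ᵢ Matrix (Fin 3) (Fin 3) ℝ :=
  IsometryEquiv.mk'
    (fun X => U * X * V) (fun X => Uᵀ * X * Vᵀ)
    (fun X => by
      calc U * (Uᵀ * X * Vᵀ) * V = (U * Uᵀ) * X * (Vᵀ * V) := by noncomm_ring
        _ = X := by rw [mul_transpose_of_mem_so3 hU, (mem_so3_iff.1 hV).1]; simp)
    (by
      refine Isometry.of_dist_eq fun X Y => ?_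
      rw [dist_eq_norm, dist_eq_norm]
      have h : U * X * V - U * Y * V = U * (X - Y) * V := by noncomm_ring
      rw [h, ← sq_eq_sq₀ (norm_nonneg _) (norm_nonneg _), ← reInner_self, ← reInner_self,
        reInner_eq_trace, reInner_eq_trace]
      set Z := X - Y
      calc ((U * Z * V)ᵀ * (U * Z * V)).trace = (Vᵀ * Zᵀ * (Uᵀ * U) * Z * V).trace := by
            simp only [transpose_mul]; congr 1; noncomm_ring
        _ = (Vᵀ * (Zᵀ * Z * V)).trace := by
            rw [(mem_so3_iff.1 hU).1]; congr 1; noncomm_ring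
        _ = (Zᵀ * Z * (V * Vᵀ)).trace := by
            rw [trace_mul_comm]; congr 1; noncomm_ring
        _ = (Zᵀ * Z).trace := by rw [mul_transpose_of_mem_so3 hV, mul_one])

/-- Bi-invariance of the volume: the two-sided translation is an isometry of the ambient Euclidean
space that maps SO₃ onto itself. -/
theorem setIntegral_so3_comp {U V : Matrix (Fin 3) (Fin 3) ℝ} (hU : U ∈ so3) (hV : V ∈ so3)
    (F : Matrix (Fin 3) (Fin 3) ℝ → ℝ) :
    ∫ q in so3, F (U * q * V) ∂μHE[3] = ∫ q in so3, F q ∂μHE[3] := by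
  have h : (rotationIsometry hU hV) ⁻¹' so3 = so3 := by
    ext X
    constructor
    · intro hX
      have hX : U * X * V ∈ so3 := hX
      have h1 := mul_mem_so3 (mul_mem_so3 (transpose_mem_so3 hU) hX) (transpose_mem_so3 hV)
      have e : Uᵀ * (U * X * V) * Vᵀ = X := by
        calc Uᵀ * (U * X * V) * Vᵀ = (Uᵀ * U) * X * (V * Vᵀ) := by noncomm_ring
          _ = X := by rw [mul_transpose_of_mem_so3 hV, (mem_so3_iff.1 hU).1]; simp
      rwa [e] at h1
    · exact fun hX => mul_mem_so3 (mul_mem_so3 hU hX) hV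
  exact setIntegral_comp_isometryEquiv (rotationIsometry hU hV) h F

/-! ### Skew-symmetric matrices of size three -/

/-- The matrix of the cross product with `x`. -/
def skew (x : Fin 3 → ℝ) : Matrix (Fin 3) (Fin 3) ℝ :=
  !![0, -x 2, x 1; x 2, 0, -x 0; -x 1, x 0, 0]

theorem exists_eq_skew {a : Matrix (Fin 3) (Fin 3) ℝ} (ha : aᵀ = -a) : ∃ x, a = skew x := by
  have h : ∀ i j, a j i = -a i j := fun i j => congrFun (congrFun ha i) j
  refine ⟨![a 2 1, a 0 2, a 1 0], ?_⟩
  ext i j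
  fin_cases i <;> fin_cases j <;> simp [skew] <;>
    linarith [h 0 0, h 1 1, h 2 2, h 0 1, h 0 2, h 1 2]

theorem transpose_mul_skew_mul {u : Matrix (Fin 3) (Fin 3) ℝ} (hu : u ∈ so3) (x : Fin 3 → ℝ) :
    uᵀ * skew x * u = skew (uᵀ *ᵥ x) := by
  -- This is a polynomial identity for every 3 × 3 matrix, the cofactor rule for cross products; for
  -- a rotation the adjugate is the transpose.
  have h1 : uᵀ * skew x * u = skew (u.adjugate *ᵥ x) := by
    ext i j
    fin_cases i <;> fin_cases j <;>
      simp [skew, mul_apply, Fin.sum_univ_three, adjugate_fin_three, mulVec, dotProduct] <;> ring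
  have h2 : u.adjugate = uᵀ := by
    calc u.adjugate = u.adjugate * (u * uᵀ) := by rw [mul_transpose_of_mem_so3 hu, mul_one]
      _ = uᵀ := by rw [← Matrix.mul_assoc, adjugate_mul, (mem_so3_iff.1 hu).2]; simp
  rw [h1, h2]

/-- The triple product formula x × (y × v) = y (x·v) - (x·y) v. -/
theorem skew_mul_skew (x y : Fin 3 → ℝ) :
    skew x * skew y = vecMulVec y x - (x ⬝ᵥ y) • (1 : Matrix (Fin 3) (Fin 3) ℝ) := by
  ext i j
  fin_cases i <;> fin_cases j <;>
    simp [skew, mul_apply, Fin.sum_univ_three, vecMulVec_apply, dotProduct] <;> ring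

theorem trace_skew_mul_skew (x y : Fin 3 → ℝ) : (skew x * skew y).trace = -2 * (x ⬝ᵥ y) := by
  simp [skew, trace_fin_three, Fin.sum_univ_three, dotProduct]
  ring

theorem trace_vecMulVec_mul (x y : Fin 3 → ℝ) (X : Matrix (Fin 3) (Fin 3) ℝ) :
    (vecMulVec x y * X).trace = y ⬝ᵥ (X *ᵥ x) := by
  rw [vecMulVec_mul, trace_vecMulVec, dotProduct_comm, dotProduct_mulVec]

/-! ### Moments of the volume of the rotation group -/

theorem integrableOn_so3 {F : Matrix (Fin 3) (Fin 3) ℝ → ℝ} (hF : Continuous F) :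
    IntegrableOn F so3 μHE[3] := by
  have : IsFiniteMeasure ((μHE[3] : Measure (Matrix (Fin 3) (Fin 3) ℝ)).restrict so3) :=
    ⟨by simpa using euclideanHausdorffMeasure_so3_lt_top⟩
  have h := hF.continuousOn.integrableOn_compact (μ := (μHE[3]).restrict so3) isCompact_so3
  rwa [IntegrableOn, Measure.restrict_restrict isCompact_so3.measurableSet, Set.inter_self] at h

theorem setIntegral_so3_mul_left {U : Matrix (Fin 3) (Fin 3) ℝ} (hU : U ∈ so3)
    (F : Matrix (Fin 3) (Fin 3) ℝ → ℝ) :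
    ∫ q in so3, F (U * q) ∂μHE[3] = ∫ q in so3, F q ∂μHE[3] := by
  simpa using setIntegral_so3_comp hU one_mem_so3 F

theorem diagonal_mem_so3 {v : Fin 3 → ℝ} (h : ∀ i, v i * v i = 1) (h' : v 0 * v 1 * v 2 = 1) :
    diagonal v ∈ so3 := by
  rw [mem_so3_iff]
  constructor
  · rw [diagonal_transpose, diagonal_mul_diagonal]
    simp [h]
  · rw [det_diagonal, Fin.prod_univ_three, h']

/-- The half turn about the `k`-th axis. -/
def halfTurn (k : Fin 3) : Matrix (Fin 3) (Fin 3) ℝ := diagonal fun i => if i = k then 1 else -1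

theorem halfTurn_mem_so3 (k : Fin 3) : halfTurn k ∈ so3 :=
  diagonal_mem_so3 (fun i => by split_ifs <;> norm_num) (by fin_cases k <;> simp)

theorem halfTurn_mulVec (k i : Fin 3) (w : Fin 3 → ℝ) :
    (halfTurn k *ᵥ w) i = if i = k then w i else -w i := by
  simp only [halfTurn, mulVec_diagonal]
  split_ifs <;> simp

/-- A half turn about any axis other than the i-th, here the next one cyclically, reverses the i-th
coordinate and preserves the volume. -/
theorem integral_so3_mulVec (y : Fin 3 → ℝ) (i : Fin 3) :
    ∫ q in so3, (q *ᵥ y) i ∂μHE[3] = 0 := by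
  have h := setIntegral_so3_mul_left (halfTurn_mem_so3 (i + 1)) (fun q => (q *ᵥ y) i)
  simp only [← mulVec_mulVec, halfTurn_mulVec] at h
  have hi : ¬ i = i + 1 := by fin_cases i <;> decide
  simp only [hi, if_false] at h
  rw [integral_neg] at h
  linarith

theorem continuous_mulVec_apply (y : Fin 3 → ℝ) (i : Fin 3) :
    Continuous fun q : Matrix (Fin 3) (Fin 3) ℝ => (q *ᵥ y) i :=
  (continuous_apply i).comp (Continuous.matrix_mulVec continuous_id continuous_const)

theorem integral_so3_trace (X : Matrix (Fin 3) (Fin 3) ℝ) :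
    ∫ q in so3, (X * q).trace ∂μHE[3] = 0 := by
  have h : ∀ q : Matrix (Fin 3) (Fin 3) ℝ, (X * q).trace = ∑ i, (q *ᵥ fun j => X j i) i := by
    intro q
    rw [trace_mul_comm]
    simp [trace, mul_apply, mulVec, dotProduct]
  simp_rw [h]
  rw [integral_finsetSum _ fun i _ => integrableOn_so3 (continuous_mulVec_apply _ i)]
  simp [integral_so3_mulVec]

/-- The half turn about the k-th axis keeps one factor and reverses the other. -/
theorem integral_so3_mulVec_mul_mulVec_of_ne (y : Fin 3 → ℝ) {i k : Fin 3} (hik : i ≠ k) :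
    ∫ q in so3, (q *ᵥ y) i * (q *ᵥ y) k ∂μHE[3] = 0 := by
  have h := setIntegral_so3_mul_left (halfTurn_mem_so3 k) (fun q => (q *ᵥ y) i * (q *ᵥ y) k)
  simp only [← mulVec_mulVec, halfTurn_mulVec, if_neg hik, if_true, neg_mul] at h
  rw [integral_neg] at h
  linarith

theorem cyclic_mem_so3 : (!![0, 1, 0; 0, 0, 1; 1, 0, 0] : Matrix (Fin 3) (Fin 3) ℝ) ∈ so3 := by
  rw [mem_so3_iff]
  constructor
  · ext i j
    fin_cases i <;> fin_cases j <;> simp [mul_apply, Fin.sum_univ_three]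
  · simp [det_fin_three]

theorem dotProduct_mulVec_self {q : Matrix (Fin 3) (Fin 3) ℝ} (hq : q ∈ so3) (y : Fin 3 → ℝ) :
    (q *ᵥ y) ⬝ᵥ (q *ᵥ y) = y ⬝ᵥ y := by
  rw [dotProduct_mulVec, ← mulVec_transpose, mulVec_mulVec, (mem_so3_iff.1 hq).1, one_mulVec]

/-- Cyclic permutation of the axes makes the three second moments equal, and their sum is the
integral of the constant |qy|² = |y|². -/
theorem three_mul_integral_so3_mulVec_sq (y : Fin 3 → ℝ) (i : Fin 3) :
    3 * ∫ q in so3, (q *ᵥ y) i * (q *ᵥ y) i ∂μHE[3] = (μHE[3]).real so3 * (y ⬝ᵥ y) := by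
  have hshift : ∀ i : Fin 3, ∫ q in so3, (q *ᵥ y) (i + 1) * (q *ᵥ y) (i + 1) ∂μHE[3]
      = ∫ q in so3, (q *ᵥ y) i * (q *ᵥ y) i ∂μHE[3] := by
    intro i
    rw [← setIntegral_so3_mul_left cyclic_mem_so3 (fun q => (q *ᵥ y) i * (q *ᵥ y) i)]
    congr 1
    ext1 q
    rw [← mulVec_mulVec]
    fin_cases i <;> simp [mulVec, dotProduct, Fin.sum_univ_three]
  have hint : ∀ i, IntegrableOn
      (fun q : Matrix (Fin 3) (Fin 3) ℝ => (q *ᵥ y) i * (q *ᵥ y) i) so3 μHE[3] := fun i =>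
    integrableOn_so3 ((continuous_mulVec_apply y i).mul (continuous_mulVec_apply y i))
  have hsum : ∑ i, ∫ q in so3, (q *ᵥ y) i * (q *ᵥ y) i ∂μHE[3]
      = (μHE[3]).real so3 * (y ⬝ᵥ y) := by
    rw [← integral_finsetSum _ fun i _ => hint i]
    have h : ∀ q ∈ so3, ∑ i, (q *ᵥ y) i * (q *ᵥ y) i = y ⬝ᵥ y := fun q hq =>
      dotProduct_mulVec_self hq y
    rw [setIntegral_congr_fun isCompact_so3.measurableSet h]
    simp
  have e0 := hshift 0
  have e1 := hshift 1
  have e2 := hshift 2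
  rw [Fin.sum_univ_three] at hsum
  simp only [zero_add, Fin.isValue, Fin.reduceAdd] at e0 e1 e2
  fin_cases i <;> simp only [Fin.zero_eta, Fin.mk_one, Fin.reduceFinMk] <;> linarith

theorem three_mul_integral_so3_sq (x y : Fin 3 → ℝ) :
    3 * ∫ q in so3, (x ⬝ᵥ (q *ᵥ y)) ^ 2 ∂μHE[3] = (μHE[3]).real so3 * (x ⬝ᵥ x) * (y ⬝ᵥ y) := by
  have h : ∀ q : Matrix (Fin 3) (Fin 3) ℝ, (x ⬝ᵥ (q *ᵥ y)) ^ 2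
      = ∑ i, ∑ k, x i * x k * ((q *ᵥ y) i * (q *ᵥ y) k) := by
    intro q
    simp only [dotProduct, pow_two, Finset.sum_mul_sum]
    exact Finset.sum_congr rfl fun i _ => Finset.sum_congr rfl fun k _ => by ring
  have hint : ∀ i k, IntegrableOn (fun q : Matrix (Fin 3) (Fin 3) ℝ =>
      x i * x k * ((q *ᵥ y) i * (q *ᵥ y) k)) so3 μHE[3] := fun i k =>
    integrableOn_so3 (continuous_const.mul
      ((continuous_mulVec_apply y i).mul (continuous_mulVec_apply y k)))
  simp_rw [h]
  rw [integral_finsetSum _ fun i _ => integrable_finsetSum _ fun k _ => hint i k]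
  simp_rw [integral_finsetSum _ fun k _ => hint _ k, integral_const_mul]
  have h2 : ∀ i, ∑ k, x i * x k * ∫ q in so3, (q *ᵥ y) i * (q *ᵥ y) k ∂μHE[3]
      = x i * x i * ∫ q in so3, (q *ᵥ y) i * (q *ᵥ y) i ∂μHE[3] := fun i =>
    Finset.sum_eq_single i (fun k _ hk => by
      rw [integral_so3_mulVec_mul_mulVec_of_ne y (Ne.symm hk), mul_zero]) (by simp)
  simp_rw [h2]
  rw [Finset.mul_sum]
  have h3 : ∀ i, 3 * (x i * x i * ∫ q in so3, (q *ᵥ y) i * (q *ᵥ y) i ∂μHE[3])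
      = x i * x i * ((μHE[3]).real so3 * (y ⬝ᵥ y)) := by
    intro i
    rw [← three_mul_integral_so3_mulVec_sq y i]
    ring
  simp_rw [h3]
  rw [← Finset.sum_mul]
  simp only [dotProduct]
  ring

/-! ### The integrands of the first variation -/

section Integrand

variable {u a d : Matrix (Fin 3) (Fin 3) ℝ}

theorem reInner_diagonal_direction (hu : u ∈ so3) (ha : aᵀ = -a) (hd : dᵀ = -d)
    {α δ : Matrix (Fin 3) (Fin 3) ℝ} (hα : αᵀ = -α) (hδ : δᵀ = -δ)
    (α' δ' : Matrix (Fin 3) (Fin 3) ℝ) :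
    reInner (a * u - u * d)
        (α' * u + α * (a * u - u * d) - ((a * u - u * d) * δ + u * δ')) =
      (aᵀ * α').trace + (dᵀ * δ').trace + ((uᵀ * a * u) * δ').trace
        + (d * (uᵀ * α' * u)).trace := by
  obtain ⟨h1, -⟩ := mem_so3_iff.1 hu
  have h2 := mul_transpose_of_mem_so3 hu
  set w := a * u - u * d with hw
  have hwT : wᵀ = -(uᵀ * a) + d * uᵀ := by
    simp only [hw, transpose_sub, transpose_mul, ha, hd]; noncomm_ring
  -- Skew matrices acting on either side of w give a vector orthogonal to w, so only the derivatives
  -- of the test fields survive.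
  have z1 : (wᵀ * (α * w)).trace = 0 := by
    have h := trace_transpose (wᵀ * (α * w))
    have e : (wᵀ * (α * w))ᵀ = -(wᵀ * (α * w)) := by
      simp only [transpose_mul, transpose_transpose, hα]; noncomm_ring
    rw [e, trace_neg] at h
    linarith
  have z2 : (wᵀ * (w * δ)).trace = 0 := by
    have h := trace_transpose (wᵀ * (w * δ))
    have e : (wᵀ * (w * δ))ᵀ = -(δ * (wᵀ * w)) := by
      simp only [transpose_mul, transpose_transpose, hδ]; noncomm_ring
    rw [e, trace_neg, trace_mul_comm, Matrix.mul_assoc] at h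
    linarith
  have t1 : (wᵀ * (α' * u)).trace = (aᵀ * α').trace + (d * (uᵀ * α' * u)).trace := by
    have e : wᵀ * (α' * u) = uᵀ * (aᵀ * α' * u) + d * (uᵀ * α' * u) := by
      rw [hwT, ha]; noncomm_ring
    rw [e, trace_add, trace_mul_comm, Matrix.mul_assoc, h2, mul_one]
  have t2 : (wᵀ * (u * δ')).trace = -((uᵀ * a * u) * δ').trace - (dᵀ * δ').trace := by
    have e : wᵀ * (u * δ') = -((uᵀ * a * u) * δ') - dᵀ * ((uᵀ * u) * δ') := by
      rw [hwT, hd]; noncomm_ring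
    rw [e, h1, one_mul, trace_sub, trace_neg]
  rw [reInner_eq_trace, mul_sub, mul_add, mul_add, trace_sub, trace_add, trace_add, z1, z2, t1, t2]
  ring

/-- The field β - uβᵀu is differentiated in time with u' = au - ud. Using uᵀu = uuᵀ = 1, everything
becomes linear in u except one cubic trace, which arises twice from the two occurrences of u in
uβᵀu. -/
theorem reInner_offDiagonal_direction (hu : u ∈ so3) (ha : aᵀ = -a) (hd : dᵀ = -d)
    (β β' : Matrix (Fin 3) (Fin 3) ℝ) :
    reInner (a * u - u * d)
        (β' - (((a * u - u * d) * βᵀ + u * β'ᵀ) * u + u * βᵀ * (a * u - u * d))) =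
      ((2 • (β'ᵀ * a - d * β'ᵀ) + 2 • (βᵀ * a * a - d * βᵀ * a + d * d * βᵀ)) * u).trace
        - 2 * (d * (uᵀ * a * u) * βᵀ * u).trace := by
  obtain ⟨h1, -⟩ := mem_so3_iff.1 hu
  have h2 := mul_transpose_of_mem_so3 hu
  set w := a * u - u * d with hw
  have hwT : wᵀ = -(uᵀ * a) + d * uᵀ := by
    simp only [hw, transpose_sub, transpose_mul, ha, hd]; noncomm_ring
  have t1 : (wᵀ * β').trace = ((β'ᵀ * a - d * β'ᵀ) * u).trace := by
    rw [← trace_transpose, transpose_mul, transpose_transpose, hw, mul_sub, sub_mul, trace_sub,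
      trace_sub, ← Matrix.mul_assoc, ← Matrix.mul_assoc, trace_mul_comm (β'ᵀ * u) d,
      Matrix.mul_assoc d]
  have t2 : (wᵀ * (u * β'ᵀ * u)).trace = -((β'ᵀ * a - d * β'ᵀ) * u).trace := by
    have e : wᵀ * (u * β'ᵀ * u) = -(uᵀ * (a * u * β'ᵀ * u)) + d * (uᵀ * u) * β'ᵀ * u := by
      rw [hwT]; noncomm_ring
    rw [e, h1, trace_add, trace_neg, trace_mul_comm uᵀ, Matrix.mul_assoc _ u, h2, mul_one, mul_one,
      sub_mul, trace_sub, trace_mul_comm (a * u), ← Matrix.mul_assoc]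
    ring
  have t3 : (wᵀ * (w * βᵀ * u)).trace
      = (-(βᵀ * a * a - d * βᵀ * a + d * d * βᵀ) * u).trace
        + (d * (uᵀ * a * u) * βᵀ * u).trace := by
    have e : wᵀ * (w * βᵀ * u) = -(uᵀ * (a * a * u * βᵀ * u)) + uᵀ * (a * u * d * βᵀ * u)
        + d * (uᵀ * a * u) * βᵀ * u - d * (uᵀ * u) * d * βᵀ * u := by
      rw [hwT, hw]; noncomm_ring
    have e2 : -(βᵀ * a * a - d * βᵀ * a + d * d * βᵀ) * u
        = -(βᵀ * (a * a * u)) + (d * βᵀ) * (a * u) - d * d * βᵀ * u := by noncomm_ring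
    rw [e, e2, h1, mul_one]
    simp only [trace_add, trace_sub, trace_neg]
    rw [trace_mul_comm uᵀ, trace_mul_comm uᵀ, Matrix.mul_assoc _ u uᵀ, Matrix.mul_assoc _ u uᵀ, h2,
      mul_one, mul_one, trace_mul_comm βᵀ, trace_mul_comm (d * βᵀ), Matrix.mul_assoc (a * u) d]
    ring
  have t4 : (wᵀ * (u * βᵀ * w)).trace
      = (-(βᵀ * a * a - d * βᵀ * a + d * d * βᵀ) * u).trace
        + (d * (uᵀ * a * u) * βᵀ * u).trace := by
    have e : w * wᵀ * u * βᵀ = -(a * (u * uᵀ) * a * u * βᵀ) + a * u * d * (uᵀ * u) * βᵀ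
        + u * (d * (uᵀ * a * u) * βᵀ) - u * (d * d * (uᵀ * u) * βᵀ) := by
      rw [hwT, hw]; noncomm_ring
    have e2 : -(βᵀ * a * a - d * βᵀ * a + d * d * βᵀ) * u
        = -(βᵀ * (a * a * u)) + (d * βᵀ) * (a * u) - d * d * βᵀ * u := by noncomm_ring
    have e3 : (wᵀ * (u * βᵀ * w)).trace = (w * wᵀ * u * βᵀ).trace := by
      rw [← Matrix.mul_assoc, trace_mul_comm]; congr 1; noncomm_ring
    rw [e3, e, e2, h1, h2]
    simp only [trace_add, trace_sub, trace_neg, mul_one]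
    rw [trace_mul_comm u, trace_mul_comm u, trace_mul_comm βᵀ, trace_mul_comm (d * βᵀ),
      Matrix.mul_assoc (a * u) d]
    ring
  have e : wᵀ * (β' - ((w * βᵀ + u * β'ᵀ) * u + u * βᵀ * w)) =
      wᵀ * β' - wᵀ * (u * β'ᵀ * u) - wᵀ * (w * βᵀ * u) - wᵀ * (u * βᵀ * w) := by noncomm_ring
  rw [reInner_eq_trace, e, trace_sub, trace_sub, trace_sub, t1, t2, t3, t4]
  simp only [add_mul, trace_add, smul_mul_assoc, trace_smul, neg_mul, trace_neg]
  simp only [nsmul_eq_mul]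
  push_cast
  ring

/-- Conjugation by u turns the matrix of x into that of uᵀx, and the triple product formula then
lowers the degree in u from three to two. -/
theorem trace_cubic (hu : u ∈ so3) (x y : Fin 3 → ℝ) (β : Matrix (Fin 3) (Fin 3) ℝ) :
    (skew y * (uᵀ * skew x * u) * βᵀ * u).trace
      = x ⬝ᵥ (β *ᵥ y) - (x ⬝ᵥ (u *ᵥ y)) * (βᵀ * u).trace := by
  have h2 := mul_transpose_of_mem_so3 hu
  rw [transpose_mul_skew_mul hu, skew_mul_skew, Matrix.mul_assoc, sub_mul, trace_sub,
    trace_vecMulVec_mul, smul_mul_assoc, one_mul, trace_smul, smul_eq_mul]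
  congr 1
  · rw [← mulVec_mulVec, mulVec_mulVec _ u uᵀ, h2, one_mulVec, mulVec_transpose, dotProduct_comm,
      dotProduct_mulVec]
  · congr 1
    rw [mulVec_transpose, dotProduct_comm, dotProduct_mulVec]

/-- On SO₃ the trace equals -2 (uᵀx)·y, linear in u, hence has mean zero. So the cross terms between
the two factors vanish on average. -/
theorem integral_so3_trace_skew (hx : aᵀ = -a) (hy : dᵀ = -d) :
    ∫ q in so3, ((qᵀ * a * q) * d).trace ∂μHE[3] = 0 := by
  obtain ⟨x, rfl⟩ := exists_eq_skew hx
  obtain ⟨y, rfl⟩ := exists_eq_skew hy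
  have h : ∀ q ∈ so3, ((qᵀ * skew x * q) * skew y).trace
      = (((-2 : ℝ) • vecMulVec y x) * q).trace := by
    intro q hq
    rw [transpose_mul_skew_mul hq, trace_skew_mul_skew, smul_mul_assoc, trace_smul,
      trace_vecMulVec_mul, smul_eq_mul, mulVec_transpose, dotProduct_mulVec]
  rw [setIntegral_congr_fun isCompact_so3.measurableSet h, integral_so3_trace]

end Integrand

section Rotations

attribute [local instance] frobeniusRing frobeniusAlgebra
attribute [local instance] Matrix.frobeniusNormedAddCommGroup Matrix.frobeniusNormedSpace

/-! ### The first variation along curves of pairs of rotations -/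

theorem _root_.HasDerivAt.transpose {u : ℝ → Matrix (Fin 3) (Fin 3) ℝ}
    {u' : Matrix (Fin 3) (Fin 3) ℝ} {t : ℝ} (hu : HasDerivAt u u' t) :
    HasDerivAt (fun t => (u t)ᵀ) u'ᵀ t := by
  simpa only [conjTranspose_eq_transpose_of_trivial] using hu.conjTranspose

/-- The angular velocity `A' Aᵀ` of the rotations `A(t)`. -/
def angularVelocity (A : ℝ → Matrix (Fin 3) (Fin 3) ℝ) (t : ℝ) : Matrix (Fin 3) (Fin 3) ℝ :=
  deriv A t * (A t)ᵀ

variable {J : Set ℝ} {A D : ℝ → Matrix (Fin 3) (Fin 3) ℝ}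

theorem deriv_transpose_mul_add (hJ : IsOpen J) (hA : ContDiffOn ℝ ∞ A J)
    (hAm : ∀ t ∈ J, A t ∈ so3) {t : ℝ} (ht : t ∈ J) :
    (deriv A t)ᵀ * A t + (A t)ᵀ * deriv A t = 0 := by
  have h1 : HasDerivAt A (deriv A t) t :=
    ((hA.contDiffAt (hJ.mem_nhds ht)).differentiableAt (by simp)).hasDerivAt
  refine (h1.transpose.mul h1).unique
    ((hasDerivAt_const t (1 : Matrix (Fin 3) (Fin 3) ℝ)).congr_of_eventuallyEq ?_)
  filter_upwards [hJ.mem_nhds ht] with τ hτ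
  exact (mem_so3_iff.1 (hAm τ hτ)).1

theorem transpose_angularVelocity (hJ : IsOpen J) (hA : ContDiffOn ℝ ∞ A J)
    (hAm : ∀ t ∈ J, A t ∈ so3) {t : ℝ} (ht : t ∈ J) :
    (angularVelocity A t)ᵀ = -angularVelocity A t := by
  have h1 := mul_transpose_of_mem_so3 (hAm t ht)
  have h := eq_neg_of_add_eq_zero_left (deriv_transpose_mul_add hJ hA hAm ht)
  rw [angularVelocity, transpose_mul, transpose_transpose]
  calc A t * (deriv A t)ᵀ = A t * ((deriv A t)ᵀ * A t) * (A t)ᵀ := by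
        rw [Matrix.mul_assoc, Matrix.mul_assoc, h1, mul_one]
    _ = -(A t * (A t)ᵀ * (deriv A t * (A t)ᵀ)) := by rw [h]; noncomm_ring
    _ = -(deriv A t * (A t)ᵀ) := by rw [h1, one_mul]

theorem deriv_eq_angularVelocity_mul (hAm : ∀ t ∈ J, A t ∈ so3) {t : ℝ} (ht : t ∈ J) :
    deriv A t = angularVelocity A t * A t := by
  rw [angularVelocity, Matrix.mul_assoc, (mem_so3_iff.1 (hAm t ht)).1, mul_one]

theorem contDiffOn_deriv (hJ : IsOpen J) (hA : ContDiffOn ℝ ∞ A J) :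
    ContDiffOn ℝ ∞ (deriv A) J :=
  hA.deriv_of_isOpen hJ (by norm_cast)

theorem _root_.ContDiffOn.transpose (hA : ContDiffOn ℝ ∞ A J) :
    ContDiffOn ℝ ∞ (fun t => (A t)ᵀ) J := by
  simpa only [conjTranspose_eq_transpose_of_trivial] using hA.conjTranspose

theorem contDiffOn_angularVelocity (hJ : IsOpen J) (hA : ContDiffOn ℝ ∞ A J) :
    ContDiffOn ℝ ∞ (angularVelocity A) J :=
  (contDiffOn_deriv hJ hA).mul hA.transpose

theorem hasDerivAt_position (hJ : IsOpen J) (hA : ContDiffOn ℝ ∞ A J) (hD : ContDiffOn ℝ ∞ D J)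
    (hAm : ∀ t ∈ J, A t ∈ so3) (hDm : ∀ t ∈ J, D t ∈ so3) {t : ℝ} (ht : t ∈ J)
    (q : Matrix (Fin 3) (Fin 3) ℝ) :
    HasDerivAt (fun τ => A τ * q * (D τ)ᵀ)
      (angularVelocity A t * (A t * q * (D t)ᵀ) - A t * q * (D t)ᵀ * angularVelocity D t) t := by
  have h1 : HasDerivAt A (deriv A t) t :=
    ((hA.contDiffAt (hJ.mem_nhds ht)).differentiableAt (by simp)).hasDerivAt
  have h2 : HasDerivAt D (deriv D t) t :=
    ((hD.contDiffAt (hJ.mem_nhds ht)).differentiableAt (by simp)).hasDerivAt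
  refine ((h1.mul_const q).mul h2.transpose).congr_deriv ?_
  have e1 : (D t)ᵀ * angularVelocity D t = -(deriv D t)ᵀ := by
    rw [angularVelocity, ← Matrix.mul_assoc,
      eq_neg_of_add_eq_zero_right (deriv_transpose_mul_add hJ hD hDm ht), neg_mul,
      Matrix.mul_assoc, mul_transpose_of_mem_so3 (hDm t ht), mul_one]
  have e2 : angularVelocity A t * (A t * q * (D t)ᵀ) = deriv A t * q * (D t)ᵀ := by
    rw [deriv_eq_angularVelocity_mul hAm ht]; noncomm_ring
  rw [Matrix.mul_assoc (A t * q), e1, e2]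
  noncomm_ring

/-- With right-trivialized fields the velocity at u = A q Dᵀ is αu - uδ + β - uβᵀu. Bi-invariance
then allows u itself as the variable of integration, which removes A and D in favour of the angular
velocities. -/
theorem firstVariation_so3 (hJ : IsOpen J) (hA : ContDiffOn ℝ ∞ A J) (hD : ContDiffOn ℝ ∞ D J)
    (hAm : ∀ t ∈ J, A t ∈ so3) (hDm : ∀ t ∈ J, D t ∈ so3)
    {γ W : ℝ → Matrix (Fin 3 ⊕ Fin 3) (Fin 3 ⊕ Fin 3) ℝ}
    (hγ : ∀ t ∈ J, γ t = fromBlocks (A t) 0 0 (D t))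
    {α δ β : ℝ → Matrix (Fin 3) (Fin 3) ℝ} {α' δ' β' : Matrix (Fin 3) (Fin 3) ℝ}
    (hW : ∀ t ∈ J, W t = fromBlocks (α t * A t) (β t * D t) ((β t)ᵀ * A t) (δ t * D t))
    {t : ℝ} (ht : t ∈ J) (hα : HasDerivAt α α' t) (hδ : HasDerivAt δ δ' t)
    (hβ : HasDerivAt β β' t) :
    firstVariation so3 3 γ W t = ∫ q in so3,
      (fun u => reInner (angularVelocity A t * u - u * angularVelocity D t)
        (α' * u + α t * (angularVelocity A t * u - u * angularVelocity D t)
          - ((angularVelocity A t * u - u * angularVelocity D t) * δ t + u * δ')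
          + (β' - (((angularVelocity A t * u - u * angularVelocity D t) * (β t)ᵀ + u * β'ᵀ) * u
            + u * (β t)ᵀ * (angularVelocity A t * u - u * angularVelocity D t))))) q
      ∂μHE[3] := by
  have hγm : ∀ t ∈ J, γ t ∈ blockDiag so3 := fun t ht =>
    ⟨A t, hAm t ht, D t, hDm t ht, hγ t ht⟩
  rw [firstVariation_of_blockDiag (fun U hU => conjTranspose_mul_of_mem_so3 hU) hJ hγm ht]
  refine Eq.trans ?_ (setIntegral_so3_comp (hAm t ht) (transpose_mem_so3 (hDm t ht)) _)
  congr 1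
  ext1 q
  have hu := hasDerivAt_position hJ hA hD hAm hDm ht q
  have hev : ∀ᶠ τ in nhds t, τ ∈ J := hJ.mem_nhds ht
  have e1 : (fun τ => (γ τ).toBlocks₁₁ * q * ((γ τ).toBlocks₂₂)ᴴ)
      =ᶠ[nhds t] fun τ => A τ * q * (D τ)ᵀ := by
    filter_upwards [hev] with τ hτ
    rw [hγ τ hτ, toBlocks_fromBlocks₁₁, toBlocks_fromBlocks₂₂,
      conjTranspose_eq_transpose_of_trivial]
  have e2 : (fun τ => ((W τ).toBlocks₁₁ * q + (W τ).toBlocks₁₂) * ((γ τ).toBlocks₂₂)ᴴ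
          - (γ τ).toBlocks₁₁ * q * ((γ τ).toBlocks₂₂)ᴴ
            * ((W τ).toBlocks₂₁ * q + (W τ).toBlocks₂₂) * ((γ τ).toBlocks₂₂)ᴴ)
      =ᶠ[nhds t] fun τ => α τ * (A τ * q * (D τ)ᵀ) - A τ * q * (D τ)ᵀ * δ τ
        + (β τ - A τ * q * (D τ)ᵀ * (β τ)ᵀ * (A τ * q * (D τ)ᵀ)) := by
    filter_upwards [hev] with τ hτ
    rw [hγ τ hτ, hW τ hτ, toBlocks_fromBlocks₁₁, toBlocks_fromBlocks₂₂, toBlocks_fromBlocks₁₁,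
      toBlocks_fromBlocks₂₂, toBlocks_fromBlocks₁₂, toBlocks_fromBlocks₂₁,
      conjTranspose_eq_transpose_of_trivial]
    have h1 := mul_transpose_of_mem_so3 (hDm τ hτ)
    calc _ = α τ * (A τ * q * (D τ)ᵀ) - A τ * q * (D τ)ᵀ * δ τ * (D τ * (D τ)ᵀ)
          + (β τ * (D τ * (D τ)ᵀ) - A τ * q * (D τ)ᵀ * (β τ)ᵀ * (A τ * q * (D τ)ᵀ)) := by
            noncomm_ring
      _ = _ := by rw [h1, mul_one, mul_one]
  have hv := ((hα.mul hu).sub (hu.mul hδ)).add (hβ.sub ((hu.mul hβ.transpose).mul hu))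
  exact congrArg₂ reInner (e1.deriv_eq.trans hu.deriv) (e2.deriv_eq.trans hv.deriv)

theorem volume_so3_pos : 0 < (μHE[3]).real so3 :=
  ENNReal.toReal_pos euclideanHausdorffMeasure_so3_pos.ne' euclideanHausdorffMeasure_so3_lt_top.ne

theorem firstVariation_so3_diagonal (hJ : IsOpen J) (hA : ContDiffOn ℝ ∞ A J)
    (hD : ContDiffOn ℝ ∞ D J) (hAm : ∀ t ∈ J, A t ∈ so3) (hDm : ∀ t ∈ J, D t ∈ so3)
    {γ W : ℝ → Matrix (Fin 3 ⊕ Fin 3) (Fin 3 ⊕ Fin 3) ℝ}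
    (hγ : ∀ t ∈ J, γ t = fromBlocks (A t) 0 0 (D t))
    {α δ : ℝ → Matrix (Fin 3) (Fin 3) ℝ} {α' δ' : Matrix (Fin 3) (Fin 3) ℝ}
    (hW : ∀ t ∈ J, W t = fromBlocks (α t * A t) 0 0 (δ t * D t))
    {t : ℝ} (ht : t ∈ J) (hα : HasDerivAt α α' t) (hδ : HasDerivAt δ δ' t)
    (hαs : ∀ t ∈ J, (α t)ᵀ = -α t) (hδs : ∀ t ∈ J, (δ t)ᵀ = -δ t) :
    firstVariation so3 3 γ W t = (μHE[3]).real so3 *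
      (reInner (angularVelocity A t) α' + reInner (angularVelocity D t) δ') := by
  have ha := transpose_angularVelocity hJ hA hAm ht
  have hd := transpose_angularVelocity hJ hD hDm ht
  have hev : ∀ᶠ τ in nhds t, τ ∈ J := hJ.mem_nhds ht
  have hα's : α'ᵀ = -α' := hα.transpose.unique (hα.neg.congr_of_eventuallyEq (hev.mono hαs))
  have hδ's : δ'ᵀ = -δ' := hδ.transpose.unique (hδ.neg.congr_of_eventuallyEq (hev.mono hδs))
  rw [firstVariation_so3 hJ hA hD hAm hDm hγ (β := fun _ => 0) (β' := 0)
    (fun t ht => by simp [hW t ht]) ht hα hδ (hasDerivAt_const _ _)]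
  set a := angularVelocity A t
  set d := angularVelocity D t
  have h : ∀ q ∈ so3, (fun u => reInner (a * u - u * d)
      (α' * u + α t * (a * u - u * d) - ((a * u - u * d) * δ t + u * δ')
        + (0 - (((a * u - u * d) * (0 : Matrix (Fin 3) (Fin 3) ℝ)ᵀ
          + u * (0 : Matrix (Fin 3) (Fin 3) ℝ)ᵀ) * u
          + u * (0 : Matrix (Fin 3) (Fin 3) ℝ)ᵀ * (a * u - u * d))))) q
      = (reInner a α' + reInner d δ') + ((qᵀ * a * q) * δ').trace
        + ((qᵀ * α' * q) * d).trace := by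
    intro q hq
    have := reInner_diagonal_direction hq ha hd (hαs t ht) (hδs t ht) α' δ'
    simp only [transpose_zero, mul_zero, zero_mul, add_zero, sub_zero]
    rw [this, reInner_eq_trace, reInner_eq_trace, trace_mul_comm d]
  rw [setIntegral_congr_fun isCompact_so3.measurableSet h]
  have hc : ∀ X Y : Matrix (Fin 3) (Fin 3) ℝ,
      Continuous fun q : Matrix (Fin 3) (Fin 3) ℝ => ((qᵀ * X * q) * Y).trace := fun X Y =>
    Continuous.matrix_trace (((((continuous_id.matrix_transpose).matrix_mul
      continuous_const).matrix_mul continuous_id)).matrix_mul continuous_const)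
  have i0 : IntegrableOn (fun _ : Matrix (Fin 3) (Fin 3) ℝ => reInner a α' + reInner d δ') so3
      μHE[3] := integrableOn_so3 continuous_const
  have i1 := integrableOn_so3 (hc a δ')
  have i2 := integrableOn_so3 (hc α' d)
  have i01 : IntegrableOn (fun q : Matrix (Fin 3) (Fin 3) ℝ =>
      reInner a α' + reInner d δ' + ((qᵀ * a * q) * δ').trace) so3 μHE[3] := i0.add i1
  rw [integral_add i01 i2, integral_add i0 i1, integral_so3_trace_skew ha hδ's,
    integral_so3_trace_skew hα's hd]
  simp

theorem integral_offDiagonal_direction {a d : Matrix (Fin 3) (Fin 3) ℝ} (ha : aᵀ = -a)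
    (hd : dᵀ = -d) (β β' : Matrix (Fin 3) (Fin 3) ℝ) :
    ∫ u in so3, reInner (a * u - u * d)
        (β' - (((a * u - u * d) * βᵀ + u * β'ᵀ) * u + u * βᵀ * (a * u - u * d))) ∂μHE[3] =
      -2 * ∫ u in so3, (d * (uᵀ * a * u) * βᵀ * u).trace ∂μHE[3] := by
  rw [setIntegral_congr_fun isCompact_so3.measurableSet fun u hu =>
    reInner_offDiagonal_direction hu ha hd β β']
  have hid : Continuous fun q : Matrix (Fin 3) (Fin 3) ℝ => q := continuous_id
  have h1 : Continuous fun q : Matrix (Fin 3) (Fin 3) ℝ =>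
      ((2 • (β'ᵀ * a - d * β'ᵀ) + 2 • (βᵀ * a * a - d * βᵀ * a + d * d * βᵀ)) * q).trace :=
    Continuous.matrix_trace (continuous_const.matrix_mul hid)
  have h2 : Continuous fun q : Matrix (Fin 3) (Fin 3) ℝ =>
      2 * (d * (qᵀ * a * q) * βᵀ * q).trace :=
    continuous_const.mul (Continuous.matrix_trace ((((continuous_const.matrix_mul
      ((hid.matrix_transpose.matrix_mul continuous_const).matrix_mul hid))).matrix_mul
        continuous_const).matrix_mul hid))
  rw [integral_sub (integrableOn_so3 h1) (integrableOn_so3 h2), integral_so3_trace,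
    integral_const_mul]
  ring

theorem firstVariation_so3_offDiagonal (hJ : IsOpen J) (hA : ContDiffOn ℝ ∞ A J)
    (hD : ContDiffOn ℝ ∞ D J) (hAm : ∀ t ∈ J, A t ∈ so3) (hDm : ∀ t ∈ J, D t ∈ so3)
    {γ W : ℝ → Matrix (Fin 3 ⊕ Fin 3) (Fin 3 ⊕ Fin 3) ℝ}
    (hγ : ∀ t ∈ J, γ t = fromBlocks (A t) 0 0 (D t)) {β : ℝ → Matrix (Fin 3) (Fin 3) ℝ}
    (hW : ∀ t ∈ J, W t = fromBlocks 0 (β t * D t) ((β t)ᵀ * A t) 0)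
    {t : ℝ} (ht : t ∈ J) (hβ : DifferentiableAt ℝ β t) :
    firstVariation so3 3 γ W t = -2 * ∫ u in so3,
      (angularVelocity D t * (uᵀ * angularVelocity A t * u) * (β t)ᵀ * u).trace ∂μHE[3] := by
  have ha := transpose_angularVelocity hJ hA hAm ht
  have hd := transpose_angularVelocity hJ hD hDm ht
  rw [firstVariation_so3 hJ hA hD hAm hDm hγ (α := fun _ => 0) (α' := 0) (δ := fun _ => 0)
    (δ' := 0) (fun t ht => by simp [hW t ht]) ht (hasDerivAt_const _ _) (hasDerivAt_const _ _)
    hβ.hasDerivAt, ← integral_offDiagonal_direction ha hd (β t) (deriv β t)]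
  congr 1
  ext1 q
  simp only [mul_zero, zero_mul, add_zero, sub_zero, zero_add]
  rfl

/-- The integrand is c (|x|²|y|² - (x·uy)²); the second term averages to a third of the first,
leaving 3 - 1 = 2. -/
theorem integral_so3_trace_cubic (x y : Fin 3 → ℝ) (c : ℝ) :
    3 * ∫ u in so3, (skew y * (uᵀ * skew x * u) * (c • vecMulVec x y)ᵀ * u).trace ∂μHE[3]
      = 2 * (μHE[3]).real so3 * (x ⬝ᵥ x) * (y ⬝ᵥ y) * c := by
  have h : ∀ u ∈ so3, (skew y * (uᵀ * skew x * u) * (c • vecMulVec x y)ᵀ * u).trace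
      = c * ((x ⬝ᵥ x) * (y ⬝ᵥ y)) - c * (x ⬝ᵥ (u *ᵥ y)) ^ 2 := by
    intro u hu
    rw [trace_cubic hu, transpose_smul, transpose_vecMulVec, smul_mul_assoc, trace_smul,
      trace_vecMulVec_mul, smul_mulVec, vecMulVec_mulVec]
    simp only [smul_eq_mul, dotProduct_smul, op_smul_eq_smul]
    ring
  rw [setIntegral_congr_fun isCompact_so3.measurableSet h]
  have hc : Continuous fun u : Matrix (Fin 3) (Fin 3) ℝ => c * (x ⬝ᵥ (u *ᵥ y)) ^ 2 :=
    continuous_const.mul ((continuous_const.dotProduct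
      (Continuous.matrix_mulVec continuous_id continuous_const)).pow 2)
  have h3 := three_mul_integral_so3_sq x y
  rw [integral_sub (integrableOn_so3 continuous_const) (integrableOn_so3 hc), setIntegral_const,
    integral_const_mul, smul_eq_mul]
  linear_combination -c * h3

end Rotations

theorem hasDerivAt_bilinear {F : Type*} [NormedAddCommGroup F] [NormedSpace ℝ F]
    (β : F →L[ℝ] F →L[ℝ] ℝ) {u v : ℝ → F} {u' v' : F} {t : ℝ} (hu : HasDerivAt u u' t)
    (hv : HasDerivAt v v' t) :
    HasDerivAt (fun t => β (u t) (v t)) (β (u t) v' + β u' (v t)) t := by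
  refine ((β.isBoundedBilinearMap.hasFDerivAt (u t, v t)).comp_hasDerivAt t
    (hu.prodMk hv)).congr_deriv ?_
  rw [β.isBoundedBilinearMap.deriv_apply]

section Geodesics

attribute [local instance] frobeniusRing frobeniusAlgebra
attribute [local instance] Matrix.frobeniusNormedAddCommGroup Matrix.frobeniusNormedSpace

variable {J : Set ℝ} {γ : ℝ → Matrix (Fin 3 ⊕ Fin 3) (Fin 3 ⊕ Fin 3) ℝ}

/-! ### Geodesics of pairs of rotations have constant angular velocities -/

theorem _root_.HasDerivAt.reInner {u v : ℝ → Matrix (Fin 3) (Fin 3) ℝ}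
    {u' v' : Matrix (Fin 3) (Fin 3) ℝ} {t : ℝ} (hu : HasDerivAt u u' t) (hv : HasDerivAt v v' t) :
    HasDerivAt (fun t => Mobius.reInner (u t) (v t))
      (Mobius.reInner (u t) v' + Mobius.reInner u' (v t)) t :=
  hasDerivAt_bilinear (reInnerL (n := Fin 3) (𝔽 := ℝ)) hu hv

theorem _root_.ContinuousOn.reInner {u v : ℝ → Matrix (Fin 3) (Fin 3) ℝ} {s : Set ℝ}
    (hu : ContinuousOn u s) (hv : ContinuousOn v s) :
    ContinuousOn (fun t => Mobius.reInner (u t) (v t)) s :=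
  ((reInnerL (n := Fin 3) (𝔽 := ℝ)).continuous.comp_continuousOn hu).clm_apply hv

theorem exists_Icc_subset (hJ : IsOpen J) {t : ℝ} (ht : t ∈ J) :
    ∃ ε > 0, Set.Icc (t - ε) (t + ε) ⊆ J := by
  obtain ⟨ε, hε, h⟩ := Metric.nhds_basis_closedBall.mem_iff.1 (hJ.mem_nhds ht)
  exact ⟨ε, hε, by rwa [Real.closedBall_eq_Icc] at h⟩

theorem transpose_deriv_eq_neg (hJ : IsOpen J) {a : ℝ → Matrix (Fin 3) (Fin 3) ℝ}
    (ha : ContDiffOn ℝ ∞ a J) (hs : ∀ t ∈ J, (a t)ᵀ = -a t) {t : ℝ} (ht : t ∈ J) :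
    (deriv a t)ᵀ = -deriv a t := by
  have h : HasDerivAt a (deriv a t) t :=
    ((ha.contDiffAt (hJ.mem_nhds ht)).differentiableAt (by simp)).hasDerivAt
  have hev : ∀ᶠ τ in nhds t, τ ∈ J := hJ.mem_nhds ht
  exact h.transpose.unique (h.neg.congr_of_eventuallyEq (hev.mono hs))

theorem skew_direction {α A : Matrix (Fin 3) (Fin 3) ℝ} (hα : αᵀ = -α) :
    (α * A)ᴴ * A + Aᴴ * (α * A) = 0 := by
  rw [conjTranspose_eq_transpose_of_trivial, conjTranspose_eq_transpose_of_trivial, transpose_mul,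
    hα]
  noncomm_ring

/-- For diagonal fields the first variation is that of a product of bi-invariant metrics. Testing it
with the derivatives of the angular velocities, cut off near t, and integrating by parts yields ∫ f
(|a'|² + |d'|²) = 0 with f positive at t. -/
theorem deriv_angularVelocity_eq_zero (hJ : IsOpen J)
    (hγ : IsGeodesic metricOo33 (blockDiag so3) J γ) {t : ℝ} (ht : t ∈ J) :
    deriv (angularVelocity fun t => (γ t).toBlocks₁₁) t = 0 ∧
      deriv (angularVelocity fun t => (γ t).toBlocks₂₂) t = 0 := by
  have hblk := fun t ht => mem_blockDiag_iff.1 (hγ.2.1 t ht)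
  set A : ℝ → Matrix (Fin 3) (Fin 3) ℝ := fun t => (γ t).toBlocks₁₁ with hAdef
  set D : ℝ → Matrix (Fin 3) (Fin 3) ℝ := fun t => (γ t).toBlocks₂₂ with hDdef
  have hA : ContDiffOn ℝ ∞ A J := contDiff_toBlocks₁₁.comp_contDiffOn hγ.1
  have hD : ContDiffOn ℝ ∞ D J := contDiff_toBlocks₂₂.comp_contDiffOn hγ.1
  have hAm : ∀ t ∈ J, A t ∈ so3 := fun t ht => (hblk t ht).1
  have hDm : ∀ t ∈ J, D t ∈ so3 := fun t ht => (hblk t ht).2.1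
  have ha := contDiffOn_angularVelocity hJ hA
  have hd := contDiffOn_angularVelocity hJ hD
  have has : ∀ t ∈ J, (angularVelocity A t)ᵀ = -angularVelocity A t := fun t ht =>
    transpose_angularVelocity hJ hA hAm ht
  have hds : ∀ t ∈ J, (angularVelocity D t)ᵀ = -angularVelocity D t := fun t ht =>
    transpose_angularVelocity hJ hD hDm ht
  set a := angularVelocity A
  set d := angularVelocity D
  have ha' := contDiffOn_deriv hJ ha
  have hd' := contDiffOn_deriv hJ hd
  obtain ⟨ε, hε, hIcc⟩ := exists_Icc_subset hJ ht
  set lo := t - ε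
  set hi := t + ε
  have hlh : lo < hi := by simp only [lo, hi]; linarith
  -- Zero at both ends and positive between: enough for fixed end points, since only smoothness on
  -- `J` is required of the variation.
  set f : ℝ → ℝ := fun τ => (τ - lo) * (hi - τ) with hf
  have hfs : ContDiffOn ℝ ∞ f J := by fun_prop
  have hα : ContDiffOn ℝ ∞ (fun τ => f τ • deriv a τ) J := hfs.smul ha'
  have hδ : ContDiffOn ℝ ∞ (fun τ => f τ • deriv d τ) J := hfs.smul hd'
  set α : ℝ → Matrix (Fin 3) (Fin 3) ℝ := fun τ => f τ • deriv a τ with hαdef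
  set δ : ℝ → Matrix (Fin 3) (Fin 3) ℝ := fun τ => f τ • deriv d τ with hδdef
  have hαs : ∀ τ ∈ J, (α τ)ᵀ = -α τ := fun τ hτ => by
    simp only [hαdef, transpose_smul, transpose_deriv_eq_neg hJ ha has hτ, smul_neg]
  have hδs : ∀ τ ∈ J, (δ τ)ᵀ = -δ τ := fun τ hτ => by
    simp only [hδdef, transpose_smul, transpose_deriv_eq_neg hJ hd hds hτ, smul_neg]
  have hα0 : α lo = 0 ∧ α hi = 0 := by simp [hαdef, hf]
  have hδ0 : δ lo = 0 ∧ δ hi = 0 := by simp [hδdef, hf]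
  have hdiff : ∀ {b : ℝ → Matrix (Fin 3) (Fin 3) ℝ}, ContDiffOn ℝ ∞ b J → ∀ τ ∈ J,
      HasDerivAt b (deriv b τ) τ := fun hb τ hτ =>
    ((hb.contDiffAt (hJ.mem_nhds hτ)).differentiableAt (by simp)).hasDerivAt
  have hzero := integral_firstVariation_eq_zero (fun P => eq_zero_of_transpose_mul_self)
    (fun U hU => conjTranspose_mul_of_mem_so3 hU) (fun x hx U hU => exp_mul_mem_so3 hx hU)
    isCompact_so3 euclideanHausdorffMeasure_so3_lt_top hJ hγ (hα.mul hA) (hδ.mul hD)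
    (fun τ hτ => skew_direction (hαs τ hτ)) (fun τ hτ => skew_direction (hδs τ hτ)) hlh hIcc
    (by simp [hα0.1]) (by simp [hδ0.1]) (by simp [hα0.2]) (by simp [hδ0.2])
  have hfv : ∀ τ ∈ Set.Icc lo hi,
      firstVariation so3 3 γ (fun τ => fromBlocks (α τ * A τ) 0 0 (δ τ * D τ)) τ
        = (μHE[3]).real so3 * (reInner (a τ) (deriv α τ) + reInner (d τ) (deriv δ τ)) :=
    fun τ hτ => firstVariation_so3_diagonal hJ hA hD hAm hDm (fun t ht => (hblk t ht).2.2)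
      (fun _ _ => rfl) (hIcc hτ) (hdiff hα τ (hIcc hτ)) (hdiff hδ τ (hIcc hτ)) hαs hδs
  have hz1 : ∫ τ in lo..hi, (reInner (a τ) (deriv α τ) + reInner (d τ) (deriv δ τ)) = 0 := by
    have h : ∫ τ in lo..hi, firstVariation so3 3 γ
        (fun τ => fromBlocks (α τ * A τ) 0 0 (δ τ * D τ)) τ = 0 := hzero
    rw [intervalIntegral.integral_congr (g := fun τ => (μHE[3]).real so3 *
      (reInner (a τ) (deriv α τ) + reInner (d τ) (deriv δ τ)))
      (fun τ hτ => hfv τ (by rwa [Set.uIcc_of_le hlh.le] at hτ)),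
      intervalIntegral.integral_const_mul] at h
    exact (mul_eq_zero.1 h).resolve_left volume_so3_pos.ne'
  have hcA : ContinuousOn (fun τ => reInner (a τ) (deriv α τ) + reInner (d τ) (deriv δ τ))
      (Set.Icc lo hi) :=
    ((ha.continuousOn.reInner (contDiffOn_deriv hJ hα).continuousOn).add
      (hd.continuousOn.reInner (contDiffOn_deriv hJ hδ).continuousOn)).mono hIcc
  have hcB : ContinuousOn (fun τ => reInner (deriv a τ) (α τ) + reInner (deriv d τ) (δ τ))
      (Set.Icc lo hi) :=
    ((ha'.continuousOn.reInner hα.continuousOn).add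
      (hd'.continuousOn.reInner hδ.continuousOn)).mono hIcc
  have hiA : IntervalIntegrable
      (fun τ => reInner (a τ) (deriv α τ) + reInner (d τ) (deriv δ τ)) volume lo hi :=
    ContinuousOn.intervalIntegrable (by rwa [Set.uIcc_of_le hlh.le])
  have hiB : IntervalIntegrable
      (fun τ => reInner (deriv a τ) (α τ) + reInner (deriv d τ) (δ τ)) volume lo hi :=
    ContinuousOn.intervalIntegrable (by rwa [Set.uIcc_of_le hlh.le])
  have hz2 : ∫ τ in lo..hi, (reInner (deriv a τ) (α τ) + reInner (deriv d τ) (δ τ)) = 0 := by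
    have hftc := intervalIntegral.integral_eq_sub_of_hasDerivAt
      (f := fun τ => reInner (a τ) (α τ) + reInner (d τ) (δ τ))
      (f' := fun τ => (reInner (a τ) (deriv α τ) + reInner (d τ) (deriv δ τ))
        + (reInner (deriv a τ) (α τ) + reInner (deriv d τ) (δ τ))) (a := lo) (b := hi)
      (fun τ hτ => by
        rw [Set.uIcc_of_le hlh.le] at hτ
        have h := ((hdiff ha τ (hIcc hτ)).reInner (hdiff hα τ (hIcc hτ))).add
          ((hdiff hd τ (hIcc hτ)).reInner (hdiff hδ τ (hIcc hτ)))
        exact h.congr_deriv (by ring)) (hiA.add hiB)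
    rw [intervalIntegral.integral_add hiA hiB, hz1, hα0.1, hα0.2, hδ0.1, hδ0.2] at hftc
    simpa [reInner] using hftc
  have hval : ∀ τ, reInner (deriv a τ) (α τ) + reInner (deriv d τ) (δ τ)
      = f τ * (‖deriv a τ‖ ^ 2 + ‖deriv d τ‖ ^ 2) := by
    intro τ
    rw [← reInner_self, ← reInner_self]
    simp [hαdef, hδdef, reInner, Finset.mul_sum, mul_add]
    ring_nf
  have hnonneg : ∀ τ ∈ Set.Ioc lo hi, 0 ≤ reInner (deriv a τ) (α τ) + reInner (deriv d τ) (δ τ) := by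
    intro τ hτ
    rw [hval]
    exact mul_nonneg (mul_nonneg (by linarith [hτ.1]) (by linarith [hτ.2])) (by positivity)
  have ht0 : ‖deriv a t‖ ^ 2 + ‖deriv d t‖ ^ 2 = 0 := by
    by_contra hne
    have hpos : 0 < ‖deriv a t‖ ^ 2 + ‖deriv d t‖ ^ 2 :=
      lt_of_le_of_ne (by positivity) (Ne.symm hne)
    refine (intervalIntegral.integral_pos hlh hcB hnonneg ⟨t, ⟨?_, ?_⟩, ?_⟩).ne' hz2
    · simp only [lo]; linarith
    · simp only [hi]; linarith
    · rw [hval]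
      refine mul_pos (mul_pos ?_ ?_) hpos
      · simp only [lo]; linarith
      · simp only [hi]; linarith
  have n1 := sq_nonneg ‖deriv a t‖
  have n2 := sq_nonneg ‖deriv d t‖
  exact ⟨norm_eq_zero.1 (pow_eq_zero_iff two_ne_zero |>.1 (by linarith)),
    norm_eq_zero.1 (pow_eq_zero_iff two_ne_zero |>.1 (by linarith))⟩

/-! ### Geodesics in one factor -/

theorem angularVelocity_eq_zero_of_const (hJ : IsOpen J) {A : ℝ → Matrix (Fin 3) (Fin 3) ℝ}
    {A₀ : Matrix (Fin 3) (Fin 3) ℝ} (h : ∀ t ∈ J, A t = A₀) {t : ℝ} (ht : t ∈ J) :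
    angularVelocity A t = 0 := by
  have hev : A =ᶠ[nhds t] fun _ => A₀ := Filter.eventually_of_mem (hJ.mem_nhds ht) h
  have h0 : deriv A t = 0 := hev.deriv_eq.trans (deriv_const _ _)
  rw [angularVelocity, h0, zero_mul]

theorem isGeodesic_oo33_of_angularVelocity_eq_zero (hJ : IsOpen J)
    (hγ : IsGeodesic metricOo33 (blockDiag so3) J γ)
    (h0 : ∀ t ∈ J, angularVelocity (fun t => (γ t).toBlocks₁₁) t = 0 ∨
      angularVelocity (fun t => (γ t).toBlocks₂₂) t = 0) :
    IsGeodesic metricOo33 oo33 J γ := by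
  refine isGeodesic_of_blockDiag (fun P => eq_zero_of_transpose_mul_self)
    (fun U hU => conjTranspose_mul_of_mem_so3 hU) (fun x hx U hU => exp_mul_mem_so3 hx hU)
    isCompact_so3 euclideanHausdorffMeasure_so3_lt_top hJ (connectedComponentIn_subset _ _)
    blockDiag_so3_subset_oo33 hγ fun b c hb hc hbc t ht => ?_
  have hblk := fun t ht => mem_blockDiag_iff.1 (hγ.2.1 t ht)
  have hA : ContDiffOn ℝ ∞ (fun t => (γ t).toBlocks₁₁) J :=
    contDiff_toBlocks₁₁.comp_contDiffOn hγ.1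
  have hD : ContDiffOn ℝ ∞ (fun t => (γ t).toBlocks₂₂) J :=
    contDiff_toBlocks₂₂.comp_contDiffOn hγ.1
  -- With β = b Dᵀ, the tangency relation gives c = βᵀ A, the form in which off-diagonal directions
  -- were evaluated.
  have hβ : ContDiffOn ℝ ∞ (fun t => b t * ((γ t).toBlocks₂₂)ᵀ) J := hb.mul hD.transpose
  rw [firstVariation_so3_offDiagonal hJ hA hD (fun t ht => (hblk t ht).1)
    (fun t ht => (hblk t ht).2.1) (fun t ht => (hblk t ht).2.2)
    (β := fun t => b t * ((γ t).toBlocks₂₂)ᵀ) (fun τ hτ => ?_) ht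
    ((hβ.contDiffAt (hJ.mem_nhds ht)).differentiableAt (by simp))]
  -- Both angular velocities are factors of the cubic integrand, so one of them being zero suffices.
  · rcases h0 t ht with h | h <;> simp [h]
  · have e1 := (mem_so3_iff.1 (hblk τ hτ).2.1).1
    have e2 := mul_transpose_of_mem_so3 (hblk τ hτ).1
    have e3 := hbc τ hτ
    rw [conjTranspose_eq_transpose_of_trivial, conjTranspose_eq_transpose_of_trivial] at e3
    have e4 : (b τ)ᵀ * (γ τ).toBlocks₁₁ = ((γ τ).toBlocks₂₂)ᵀ * c τ := by
      have := congrArg Matrix.transpose e3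
      simpa only [transpose_mul, transpose_transpose] using this
    congr 1
    · rw [Matrix.mul_assoc, e1, mul_one]
    · rw [transpose_mul, transpose_transpose, Matrix.mul_assoc, e4, ← Matrix.mul_assoc,
        mul_transpose_of_mem_so3 (hblk τ hτ).2.1, one_mul]

/-! ### Hyperbolic variations -/

/-- The infinitesimal transvection with off-diagonal block `β`. -/
def transvection (β : Matrix (Fin 3) (Fin 3) ℝ) : Matrix (Fin 3 ⊕ Fin 3) (Fin 3 ⊕ Fin 3) ℝ :=
  fromBlocks 0 β βᵀ 0

/-- The generator is symmetric and anticommutes with the matrix I of the form, so its exponential E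
is symmetric and satisfies I E = E⁻¹ I. Hence Eᴴ I E = I. -/
theorem exp_transvection_mul_mem {β : Matrix (Fin 3) (Fin 3) ℝ} (r : ℝ)
    {T : Matrix (Fin 3 ⊕ Fin 3) (Fin 3 ⊕ Fin 3) ℝ} (hT : T ∈ splitUnitary (Fin 3)) :
    NormedSpace.exp (r • transvection β) * T ∈ splitUnitary (Fin 3) := by
  set X := r • transvection β with hX
  set I : Matrix (Fin 3 ⊕ Fin 3) (Fin 3 ⊕ Fin 3) ℝ := fromBlocks 1 0 0 (-1) with hI
  have hII : I * I = 1 := by simp [hI, fromBlocks_multiply, fromBlocks_one]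
  have hXs : Xᴴ = X := by
    rw [hX, conjTranspose_smul, conjTranspose_eq_transpose_of_trivial, transvection,
      fromBlocks_transpose]
    simp
  have hIX : I * X * I⁻¹ = -X := by
    rw [inv_eq_left_inv hII, hX, transvection, hI]
    simp [fromBlocks_multiply, fromBlocks_smul, fromBlocks_neg]
  have hIu : IsUnit I := ⟨⟨I, I, hII, hII⟩, rfl⟩
  have hconj : I * NormedSpace.exp X = NormedSpace.exp (-X) * I := by
    rw [← hIX, Matrix.exp_conj I X hIu, Matrix.mul_assoc, inv_eq_left_inv hII, hII, mul_one]
  have hE : (NormedSpace.exp X)ᴴ = NormedSpace.exp X := by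
    rw [← Matrix.exp_conjTranspose, hXs]
  have hinv : NormedSpace.exp X * NormedSpace.exp (-X) = 1 := by
    rw [← Matrix.exp_add_of_commute _ _ (Commute.neg_right (Commute.refl X)), add_neg_cancel,
      NormedSpace.exp_zero]
  change (NormedSpace.exp X * T)ᴴ * I * (NormedSpace.exp X * T) = I
  have hT : Tᴴ * I * T = I := hT
  rw [conjTranspose_mul, hE]
  calc Tᴴ * NormedSpace.exp X * I * (NormedSpace.exp X * T)
      = Tᴴ * NormedSpace.exp X * (I * NormedSpace.exp X) * T := by noncomm_ring
    _ = Tᴴ * (NormedSpace.exp X * NormedSpace.exp (-X)) * I * T := by rw [hconj]; noncomm_ring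
    _ = I := by rw [hinv, mul_one, hT]

/-- The path in r passes through `T` at r = 0, hence stays in the component of `T`. -/
theorem exp_transvection_mul_mem_oo33 {β : Matrix (Fin 3) (Fin 3) ℝ} (r : ℝ)
    {T : Matrix (Fin 3 ⊕ Fin 3) (Fin 3 ⊕ Fin 3) ℝ} (hT : T ∈ oo33) :
    NormedSpace.exp (r • transvection β) * T ∈ oo33 := by
  have hTs : T ∈ splitUnitary (Fin 3) := connectedComponentIn_subset _ _ hT
  have hcont : Continuous fun r : ℝ => NormedSpace.exp (r • transvection β) * T :=
    (contDiff_exp_matrix.continuous.comp (continuous_id.smul continuous_const)).matrix_mul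
      continuous_const
  have hpre : IsPreconnected (Set.range fun r : ℝ => NormedSpace.exp (r • transvection β) * T) :=
    isPreconnected_range hcont
  have hsub := hpre.subset_connectedComponentIn (F := splitUnitary (Fin 3)) (x := T)
    ⟨0, by simp⟩ (by rintro _ ⟨r, rfl⟩; exact exp_transvection_mul_mem r hTs)
  have heq : oo33 = connectedComponentIn (splitUnitary (Fin 3)) T := connectedComponentIn_eq hT
  rw [heq]
  exact hsub ⟨r, rfl⟩

theorem integral_firstVariation_transvection_eq_zero (hJ : IsOpen J)
    (hγ : IsGeodesic metricOo33 oo33 J γ) (β : Matrix (Fin 3) (Fin 3) ℝ) {f : ℝ → ℝ}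
    (hf : ContDiffOn ℝ ∞ f J) {lo hi : ℝ} (hlh : lo < hi) (hIcc : Set.Icc lo hi ⊆ J)
    (hlo : f lo = 0) (hhi : f hi = 0) :
    ∫ t in lo..hi, firstVariation so3 3 γ (fun τ => f τ • transvection β * γ τ) t = 0 := by
  obtain ⟨hγs, hγm, hcrit⟩ := hγ
  set Γ : ℝ → ℝ → Matrix (Fin 3 ⊕ Fin 3) (Fin 3 ⊕ Fin 3) ℝ := fun s t =>
    NormedSpace.exp (s • (f t • transvection β)) * γ t with hΓ
  have hmem : ∀ s, ∀ t ∈ J, Γ s t ∈ oo33 := fun s t ht => by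
    simp only [hΓ, smul_smul]
    exact exp_transvection_mul_mem_oo33 _ (hγm t ht)
  have hsm : ContDiffOn ℝ ∞ (fun p : ℝ × ℝ => Γ p.1 p.2) (Set.Ioo (-1) 1 ×ˢ J) :=
    contDiffOn_exp_smul_mul (hf.smul contDiffOn_const) hγs _
  have hz : ∀ s t, s = 0 ∨ f t = 0 → Γ s t = γ t := by
    rintro s t (h | h) <;> simp [hΓ, h]
  have hvar : IsProperVariation oo33 J γ lo hi 1 Γ :=
    { smooth := hsm
      mem := fun s _ t ht => hmem s t ht
      zero := fun t _ => hz 0 t (Or.inl rfl)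
      left := fun s _ => hz s lo (Or.inr hlo)
      right := fun s _ => hz s hi (Or.inr hhi) }
  have h0 := hcrit lo hi 1 hlh hIcc one_pos Γ hvar
  have h1 := hasDerivAt_energy isCompact_so3 euclideanHausdorffMeasure_so3_lt_top hJ one_pos hsm
    (fun s _ t ht q hq => isUnit_of_mem_splitUnitary (fun P => eq_zero_of_transpose_mul_self)
      (connectedComponentIn_subset _ _ (hmem s t ht)) (conjTranspose_mul_of_mem_so3 hq))
    hlh.le hIcc
  rw [h0.unique h1]
  refine intervalIntegral.integral_congr fun t ht => ?_
  rw [Set.uIcc_of_le hlh.le] at ht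
  exact firstVariation_congr hJ (fun τ hτ => (hvar.zero τ hτ).symm)
    (fun τ _ => (hasDerivAt_exp_smul_mul (f τ • transvection β) (γ τ)).deriv.symm) (hIcc ht)

theorem eqOn_of_angularVelocity_eq_zero (hJ : IsOpen J) (hJc : J.OrdConnected)
    {A : ℝ → Matrix (Fin 3) (Fin 3) ℝ} (hA : ContDiffOn ℝ ∞ A J) (hAm : ∀ t ∈ J, A t ∈ so3)
    (h0 : ∀ t ∈ J, angularVelocity A t = 0) {s t : ℝ} (hs : s ∈ J) (ht : t ∈ J) : A t = A s :=
  hJ.is_const_of_deriv_eq_zero hJc.isPreconnected (hA.differentiableOn (by simp))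
    (fun τ hτ => (deriv_eq_angularVelocity_mul hAm hτ).trans (by
      rw [h0 τ hτ, zero_mul]; rfl)) ht hs

theorem angularVelocity_eq_zero_of_isGeodesic_oo33 (hJ : IsOpen J) (hJc : J.OrdConnected)
    (hγ : IsGeodesic metricOo33 (blockDiag so3) J γ) (hγ' : IsGeodesic metricOo33 oo33 J γ) :
    (∀ t ∈ J, angularVelocity (fun t => (γ t).toBlocks₁₁) t = 0) ∨
      (∀ t ∈ J, angularVelocity (fun t => (γ t).toBlocks₂₂) t = 0) := by
  rcases J.eq_empty_or_nonempty with rfl | ⟨t₀, ht₀⟩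
  · exact Or.inl fun t ht => ht.elim
  have hblk := fun t ht => mem_blockDiag_iff.1 (hγ.2.1 t ht)
  have hA : ContDiffOn ℝ ∞ (fun t => (γ t).toBlocks₁₁) J :=
    contDiff_toBlocks₁₁.comp_contDiffOn hγ.1
  have hD : ContDiffOn ℝ ∞ (fun t => (γ t).toBlocks₂₂) J :=
    contDiff_toBlocks₂₂.comp_contDiffOn hγ.1
  have hAm : ∀ t ∈ J, (γ t).toBlocks₁₁ ∈ so3 := fun t ht => (hblk t ht).1
  have hDm : ∀ t ∈ J, (γ t).toBlocks₂₂ ∈ so3 := fun t ht => (hblk t ht).2.1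
  have hder := fun t ht => deriv_angularVelocity_eq_zero hJ hγ (t := t) ht
  set a := angularVelocity fun t => (γ t).toBlocks₁₁ with hadef
  set d := angularVelocity fun t => (γ t).toBlocks₂₂ with hddef
  have hac : ∀ t ∈ J, a t = a t₀ := fun t ht =>
    hJ.is_const_of_deriv_eq_zero hJc.isPreconnected
      ((contDiffOn_angularVelocity hJ hA).differentiableOn (by simp))
      (fun τ hτ => (hder τ hτ).1) ht ht₀
  have hdc : ∀ t ∈ J, d t = d t₀ := fun t ht =>
    hJ.is_const_of_deriv_eq_zero hJc.isPreconnected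
      ((contDiffOn_angularVelocity hJ hD).differentiableOn (by simp))
      (fun τ hτ => (hder τ hτ).2) ht ht₀
  obtain ⟨x, hx⟩ := exists_eq_skew (transpose_angularVelocity hJ hA hAm ht₀)
  obtain ⟨y, hy⟩ := exists_eq_skew (transpose_angularVelocity hJ hD hDm ht₀)
  obtain ⟨ε, hε, hIcc⟩ := exists_Icc_subset hJ ht₀
  set lo := t₀ - ε with hlo
  set hi := t₀ + ε with hhi
  have hlh : lo < hi := by simp only [hlo, hhi]; linarith
  set f : ℝ → ℝ := fun τ => (τ - lo) * (hi - τ) with hf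
  have hfs : ContDiff ℝ ∞ f := by fun_prop
  -- With β = x yᵀ the cubic trace is a Cauchy–Schwarz defect, nonnegative with mean 2/3 |x|²|y|²,
  -- so it detects whether both angular velocities are nonzero. The factor -2 in the first variation
  -- makes this -4/3.
  have hint := integral_firstVariation_transvection_eq_zero hJ hγ' (vecMulVec x y) (f := f)
    hfs.contDiffOn hlh hIcc (by simp [hf]) (by simp [hf])
  have hfv : ∀ t ∈ Set.Icc lo hi,
      firstVariation so3 3 γ (fun τ => f τ • transvection (vecMulVec x y) * γ τ) t
        = (-4 / 3 * (μHE[3]).real so3 * (x ⬝ᵥ x) * (y ⬝ᵥ y)) * f t := by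
    intro t ht
    have hβ : DifferentiableAt ℝ (fun t => f t • vecMulVec x y) t :=
      ((hfs.differentiable (by simp)) t).smul_const _
    rw [firstVariation_so3_offDiagonal hJ hA hD hAm hDm (fun t ht => (hblk t ht).2.2)
      (β := fun t => f t • vecMulVec x y) (fun τ hτ => ?_) (hIcc ht) hβ]
    · have h3 := integral_so3_trace_cubic x y (f t)
      rw [← hx, ← hy] at h3
      change -2 * ∫ u in so3, (d t * (uᵀ * a t * u) * (f t • vecMulVec x y)ᵀ * u).trace ∂μHE[3] = _
      rw [hac t (hIcc ht), hdc t (hIcc ht)]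
      linear_combination (-2 / 3 : ℝ) * h3
    · conv_lhs => rw [(hblk τ hτ).2.2]
      simp [transvection, fromBlocks_smul, fromBlocks_multiply]
  rw [intervalIntegral.integral_congr (g := fun t =>
      (-4 / 3 * (μHE[3]).real so3 * (x ⬝ᵥ x) * (y ⬝ᵥ y)) * f t)
    (fun τ hτ => hfv τ (by rwa [Set.uIcc_of_le hlh.le] at hτ)),
    intervalIntegral.integral_const_mul] at hint
  have hfpos : 0 < ∫ t in lo..hi, f t := by
    refine intervalIntegral.integral_pos hlh hfs.continuous.continuousOn
      (fun t ht => mul_nonneg (by linarith [ht.1]) (by linarith [ht.2]))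
      ⟨t₀, ⟨by simp only [hlo]; linarith, by simp only [hhi]; linarith⟩, mul_pos ?_ ?_⟩
    · simp only [hlo]; linarith
    · simp only [hhi]; linarith
  have hprod : (x ⬝ᵥ x) = 0 ∨ (y ⬝ᵥ y) = 0 := by
    have h := (mul_eq_zero.1 hint).resolve_right hfpos.ne'
    rcases mul_eq_zero.1 h with h | h
    · exact Or.inl ((mul_eq_zero.1 h).resolve_left
        (mul_ne_zero (by norm_num) volume_so3_pos.ne'))
    · exact Or.inr h
  have hskew0 : skew 0 = 0 := by
    ext i j
    fin_cases i <;> fin_cases j <;> simp [skew]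
  rcases hprod with h | h
  · left
    intro t ht
    rw [hac t ht, show a t₀ = skew x from hx, dotProduct_self_eq_zero.1 h, hskew0]
  · right
    intro t ht
    rw [hdc t ht, show d t₀ = skew y from hy, dotProduct_self_eq_zero.1 h, hskew0]

theorem isGeodesic_oo33_iff (hJ : IsOpen J) (hJc : J.OrdConnected)
    (hγ : IsGeodesic metricOo33 (blockDiag so3) J γ) :
    IsGeodesic metricOo33 oo33 J γ ↔
      (∃ D ∈ so3, ∀ t ∈ J, ∃ A ∈ so3, γ t = fromBlocks A 0 0 D) ∨
      (∃ A ∈ so3, ∀ t ∈ J, ∃ D ∈ so3, γ t = fromBlocks A 0 0 D) := by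
  have hblk := fun t ht => mem_blockDiag_iff.1 (hγ.2.1 t ht)
  constructor
  · intro hγ'
    rcases J.eq_empty_or_nonempty with rfl | ⟨t₀, ht₀⟩
    -- On an empty interval any constant factor will do; the identity is chosen.
    · exact Or.inl ⟨1, one_mem_so3, fun t ht => ht.elim⟩
    rcases angularVelocity_eq_zero_of_isGeodesic_oo33 hJ hJc hγ hγ' with h | h
    · refine Or.inr ⟨(γ t₀).toBlocks₁₁, (hblk t₀ ht₀).1, fun t ht =>
        ⟨(γ t).toBlocks₂₂, (hblk t ht).2.1, ?_⟩⟩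
      have e := eqOn_of_angularVelocity_eq_zero hJ hJc
        (contDiff_toBlocks₁₁.comp_contDiffOn hγ.1) (fun t ht => (hblk t ht).1) h ht₀ ht
      exact (hblk t ht).2.2.trans (by rw [show (γ t).toBlocks₁₁ = (γ t₀).toBlocks₁₁ from e])
    · refine Or.inl ⟨(γ t₀).toBlocks₂₂, (hblk t₀ ht₀).2.1, fun t ht =>
        ⟨(γ t).toBlocks₁₁, (hblk t ht).1, ?_⟩⟩
      have e := eqOn_of_angularVelocity_eq_zero hJ hJc
        (contDiff_toBlocks₂₂.comp_contDiffOn hγ.1) (fun t ht => (hblk t ht).2.1) h ht₀ ht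
      exact (hblk t ht).2.2.trans (by rw [show (γ t).toBlocks₂₂ = (γ t₀).toBlocks₂₂ from e])
  · rintro (⟨D, -, h⟩ | ⟨A, -, h⟩)
    · refine isGeodesic_oo33_of_angularVelocity_eq_zero hJ hγ fun t ht => Or.inr ?_
      refine angularVelocity_eq_zero_of_const hJ (A₀ := D) (fun τ hτ => ?_) ht
      obtain ⟨A, -, e⟩ := h τ hτ
      rw [e, toBlocks_fromBlocks₂₂]
    · refine isGeodesic_oo33_of_angularVelocity_eq_zero hJ hγ fun t ht => Or.inl ?_
      refine angularVelocity_eq_zero_of_const hJ (A₀ := A) (fun τ hτ => ?_) ht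
      obtain ⟨D, -, e⟩ := h τ hτ
      rw [e, toBlocks_fromBlocks₁₁]

end Geodesics

end Mobius

end

theorem corollary6p5 :
    Mobius.IsTotallyGeodesic Mobius.metricSp11 (Mobius.blockDiag Mobius.sp1) Mobius.sp11 ∧
    ∀ J : Set ℝ, IsOpen J → J.OrdConnected →
      ∀ γ : ℝ → Matrix (Fin 3 ⊕ Fin 3) (Fin 3 ⊕ Fin 3) ℝ,
        Mobius.IsGeodesic Mobius.metricOo33 (Mobius.blockDiag Mobius.so3) J γ →
          (Mobius.IsGeodesic Mobius.metricOo33 Mobius.oo33 J γ ↔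
            (∃ D ∈ Mobius.so3, ∀ t ∈ J, ∃ A ∈ Mobius.so3, γ t = Matrix.fromBlocks A 0 0 D) ∨
            (∃ A ∈ Mobius.so3, ∀ t ∈ J, ∃ D ∈ Mobius.so3, γ t = Matrix.fromBlocks A 0 0 D)) :=
  ⟨Mobius.totallyGeodesic_sp1, fun _ hJ hJc _ hγ => Mobius.isGeodesic_oo33_iff hJ hJc hγ⟩
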